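/- **Definitions.** A *(Verity) double bicategory* $D$ consists of two bicategories $\mathcal H$ and $\mathcal V$ with the same class of objects, and a class $\mathcal S$ of squares $\sigma$, each with a boundary consisting of two arrows $h,\bar h$ of $\mathcal H$ (top and bottom) and two arrows $v,v'$ of $\mathcal V$ (left and right). The 2-cells of $\mathcal H$ act on squares at the top (contravariantly, $\alpha:h_1\Rightarrow h$ giving $\alpha *_V\sigma$ with top $h_1$) and at the bottom (covariantly, $\sigma *_V\bar\alpha$), those of $\mathcal V$ on the left (contravariantly, $\beta *_H\sigma$) and on the right (covariantly, $\sigma *_H\beta'$); the four actions are unital, associative and commute with each other. Squares can be pasted horizontally and vertically, and each arrow of $\mathcal V$ (of $\mathcal H$) has a horizontal (vertical) identity square; pasting is compatible with the actions (on the outer sides, with whiskering where two arrows are composed, and associatively along the common side), the identity squares are natural with respect to 2-cells, pasting is associative and unital modulo the constraints of $\mathcal H$ and $\mathcal V$, and the interchange laws (for composites and for identities) hold strictly. An *intercategory* is a double pseudocategory in the 2-category of categories. It has objects; transversal, horizontal and vertical arrows; horizontal cells and vertical cells (the transversal morphisms of horizontal, respectively vertical, arrows); basic cells, bounded by two horizontal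 and two vertical arrows; and cubes (the transversal morphisms of basic cells). Transversal composition is strict; horizontal and vertical composition are weak, with coherent natural invertible constraints; and they are related by natural special cubes, the interchangers $$\chi:\tfrac{\sigma_0|\rho_0}{\sigma_1|\rho_1}\to\tfrac{\sigma_0}{\sigma_1}\Big|\tfrac{\rho_0}{\rho_1},\quad \mu:\tfrac{\mathrm{id}_v}{\mathrm{id}_w}\to \mathrm{id}_{\frac vw},\quad \delta:\mathrm{Id}_{h|k}\to \mathrm{Id}_h|\mathrm{Id}_k,\quad \tau:\mathrm{Id}_{\mathrm{id}_A}\to\mathrm{id}_{\mathrm{Id}_A},$$ which make horizontal composition and horizontal identities lax functors, and the horizontal constraints transformations of lax functors, with respect to the vertical structure. In both cases *strict functors* are the maps that preserve all the structure on the nose. For an intercategory let $\mathbf H$, $\mathbf V$, $\mathbf S$ be the categories of horizontal arrows and cells, vertical arrows and cells, and basic cells and cubes. *Condition $(*)$*: the span $$\mathbf V\times\mathbf H\xleftarrow{(\partial_0,\partial_0)}\mathbf S\xrightarrow{(\partial_1,\partial_1)}\mathbf V\times\mathbf H,$$ where $\partial_0$ gives the left side and the top of a basic cell and $\partial_1$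 its right side and its bottom, is a discrete bifibration. Here a span $B\xleftarrow{P}E\xrightarrow{Q}C$ is a discrete bifibration if every $b\to Pe$ lifts along $P$ to a unique arrow $e'\to e$ lying over the identity of $Qe$, every $Qe\to c$ lifts along $Q$ to a unique arrow $e\to e''$ lying over the identity of $Pe$, and every arrow $e\to e'$ of $E$ factors as an arrow over the identity of $Pe$ followed by an arrow over the identity of $Qe'$. For a double bicategory $D$ let $\mathsf D$ be the intercategory with the objects of $D$; only identity transversal arrows; as horizontal (vertical) arrows and cells the arrows and 2-cells of $\mathcal H$ (of $\mathcal V$); as basic cells the squares of $D$; a single cube $\sigma\to\sigma'$ with top, left, right and bottom faces $\alpha,\beta,\beta',\bar\alpha$ if $$(\sigma *_H\beta') *_V\bar\alpha=\alpha *_V(\beta *_H\sigma'),$$ and none otherwise; with compositions, identities and constraints given by those of $D$; and with all interchangers identities. **Theorem.** The construction $D\mapsto\mathsf D$ is the object part of a functor (acting on strict functors in the evident way), which is an equivalence of categories between double bicategories with strict functors and the intercategories that satisfy $(*)$ and whose transversal arrows are all identities, with strict functors. Moreover, in every intercategory satisfying $(*)$ all the interchangers $\chi,\mu,\delta,\tau$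 are identities. -/

import Mathlib

open CategoryTheory

universe u v w
set_option linter.checkUnivs false

namespace Intercat

/-- A weak double category whose category of objects and strict arrows is `A`, i.e. a pseudocategory
in the 2-category of categories with object-of-objects `A`.  `Arr` are the arrows of the weak
direction and `Cell f f'` the double cells from `f` to `f'`, whose two remaining sides `src`, `tgt`
are arrows of `A`.  `tid`, `tcomp` are the strict (transversal) identities and compositions of
cells; `idArr`, `comp`, `idCell`, `compCell` are the identities and compositions of the weak
direction. -/
structure WeakDouble (A : Type u) [Category.{w} A] where
  Arr : A → A → Type v
  Cell : {a b a' b' : A} → Arr a b → Arr a' b' → Type w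
  src : {a b a' b' : A} → {f : Arr a b} → {f' : Arr a' b'} → Cell f f' → (a ⟶ a')
  tgt : {a b a' b' : A} → {f : Arr a b} → {f' : Arr a' b'} → Cell f f' → (b ⟶ b')
  -- the category of arrows and cells, with functors `src` and `tgt` to `A`
  tid {a b : A} (f : Arr a b) : Cell f f
  tcomp {a b a' b' a'' b'' : A} {f : Arr a b} {f' : Arr a' b'} {f'' : Arr a'' b''} :
    Cell f f' → Cell f' f'' → Cell f f''
  tid_tcomp {a b a' b' : A} {f : Arr a b} {f' : Arr a' b'} (φ : Cell f f') :
    tcomp (tid f) φ = φ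
  tcomp_tid {a b a' b' : A} {f : Arr a b} {f' : Arr a' b'} (φ : Cell f f') :
    tcomp φ (tid f') = φ
  tcomp_assoc {a b a' b' a'' b'' c d : A} {f : Arr a b} {f' : Arr a' b'} {f'' : Arr a'' b''}
    {g : Arr c d} (φ : Cell f f') (ψ : Cell f' f'') (θ : Cell f'' g) :
    tcomp (tcomp φ ψ) θ = tcomp φ (tcomp ψ θ)
  src_tid {a b : A} (f : Arr a b) : src (tid f) = 𝟙 a
  tgt_tid {a b : A} (f : Arr a b) : tgt (tid f) = 𝟙 b
  src_tcomp {a b a' b' a'' b'' : A} {f : Arr a b} {f' : Arr a' b'} {f'' : Arr a'' b''}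
    (φ : Cell f f') (ψ : Cell f' f'') : src (tcomp φ ψ) = src φ ≫ src ψ
  tgt_tcomp {a b a' b' a'' b'' : A} {f : Arr a b} {f' : Arr a' b'} {f'' : Arr a'' b''}
    (φ : Cell f f') (ψ : Cell f' f'') : tgt (tcomp φ ψ) = tgt φ ≫ tgt ψ
  -- the identity functor of the weak direction
  idArr (a : A) : Arr a a
  idCell {a a' : A} (t : a ⟶ a') : Cell (idArr a) (idArr a')
  src_idCell {a a' : A} (t : a ⟶ a') : src (idCell t) = t
  tgt_idCell {a a' : A} (t : a ⟶ a') : tgt (idCell t) = t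
  idCell_id (a : A) : idCell (𝟙 a) = tid (idArr a)
  idCell_comp {a a' a'' : A} (s : a ⟶ a') (t : a' ⟶ a'') :
    idCell (s ≫ t) = tcomp (idCell s) (idCell t)
  -- the composition functor of the weak direction
  comp {a b c : A} : Arr a b → Arr b c → Arr a c
  compCell {a b c a' b' c' : A} {f : Arr a b} {g : Arr b c} {f' : Arr a' b'} {g' : Arr b' c'}
    (φ : Cell f f') (ψ : Cell g g') (e : tgt φ = src ψ) : Cell (comp f g) (comp f' g')
  src_compCell {a b c a' b' c' : A} {f : Arr a b} {g : Arr b c} {f' : Arr a' b'} {g' : Arr b' c'}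
    (φ : Cell f f') (ψ : Cell g g') (e : tgt φ = src ψ) : src (compCell φ ψ e) = src φ
  tgt_compCell {a b c a' b' c' : A} {f : Arr a b} {g : Arr b c} {f' : Arr a' b'} {g' : Arr b' c'}
    (φ : Cell f f') (ψ : Cell g g') (e : tgt φ = src ψ) : tgt (compCell φ ψ e) = tgt ψ
  compCell_tid {a b c : A} (f : Arr a b) (g : Arr b c) :
    compCell (tid f) (tid g) (by rw [tgt_tid, src_tid]) = tid (comp f g)
  compCell_tcomp {a b c a' b' c' a'' b'' c'' : A} {f : Arr a b} {g : Arr b c}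
    {f' : Arr a' b'} {g' : Arr b' c'} {f'' : Arr a'' b''} {g'' : Arr b'' c''}
    (φ : Cell f f') (ψ : Cell g g') (φ' : Cell f' f'') (ψ' : Cell g' g'')
    (e : tgt φ = src ψ) (e' : tgt φ' = src ψ') :
    compCell (tcomp φ φ') (tcomp ψ ψ') (by rw [tgt_tcomp, src_tcomp, e, e']) =
      tcomp (compCell φ ψ e) (compCell φ' ψ' e')
  -- associativity and unit constraints: natural, invertible, special, coherent
  assoc {a b c d : A} (f : Arr a b) (g : Arr b c) (k : Arr c d) :
    Cell (comp (comp f g) k) (comp f (comp g k))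
  src_assoc {a b c d : A} (f : Arr a b) (g : Arr b c) (k : Arr c d) : src (assoc f g k) = 𝟙 a
  tgt_assoc {a b c d : A} (f : Arr a b) (g : Arr b c) (k : Arr c d) : tgt (assoc f g k) = 𝟙 d
  assoc_iso {a b c d : A} (f : Arr a b) (g : Arr b c) (k : Arr c d) :
    ∃ ψ : Cell (comp f (comp g k)) (comp (comp f g) k),
      tcomp (assoc f g k) ψ = tid _ ∧ tcomp ψ (assoc f g k) = tid _
  assoc_nat {a b c d a' b' c' d' : A} {f : Arr a b} {g : Arr b c} {k : Arr c d}
    {f' : Arr a' b'} {g' : Arr b' c'} {k' : Arr c' d'}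
    (φ : Cell f f') (ψ : Cell g g') (θ : Cell k k') (e₁ : tgt φ = src ψ) (e₂ : tgt ψ = src θ) :
    tcomp (compCell (compCell φ ψ e₁) θ (by rw [tgt_compCell, e₂])) (assoc f' g' k') =
      tcomp (assoc f g k) (compCell φ (compCell ψ θ e₂) (by rw [src_compCell, e₁]))
  lunit {a b : A} (f : Arr a b) : Cell (comp (idArr a) f) f
  src_lunit {a b : A} (f : Arr a b) : src (lunit f) = 𝟙 a
  tgt_lunit {a b : A} (f : Arr a b) : tgt (lunit f) = 𝟙 b
  lunit_iso {a b : A} (f : Arr a b) :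
    ∃ ψ : Cell f (comp (idArr a) f), tcomp (lunit f) ψ = tid _ ∧ tcomp ψ (lunit f) = tid _
  lunit_nat {a b a' b' : A} {f : Arr a b} {f' : Arr a' b'} (φ : Cell f f') :
    tcomp (compCell (idCell (src φ)) φ (by rw [tgt_idCell])) (lunit f') = tcomp (lunit f) φ
  runit {a b : A} (f : Arr a b) : Cell (comp f (idArr b)) f
  src_runit {a b : A} (f : Arr a b) : src (runit f) = 𝟙 a
  tgt_runit {a b : A} (f : Arr a b) : tgt (runit f) = 𝟙 b
  runit_iso {a b : A} (f : Arr a b) :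
    ∃ ψ : Cell f (comp f (idArr b)), tcomp (runit f) ψ = tid _ ∧ tcomp ψ (runit f) = tid _
  runit_nat {a b a' b' : A} {f : Arr a b} {f' : Arr a' b'} (φ : Cell f f') :
    tcomp (compCell φ (idCell (tgt φ)) (by rw [src_idCell])) (runit f') = tcomp (runit f) φ
  pentagon {a b c d e : A} (f : Arr a b) (g : Arr b c) (k : Arr c d) (l : Arr d e) :
    tcomp (tcomp (compCell (assoc f g k) (tid l) (by rw [tgt_assoc, src_tid]))
        (assoc f (comp g k) l)) (compCell (tid f) (assoc g k l) (by rw [tgt_tid, src_assoc])) =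
      tcomp (assoc (comp f g) k l) (assoc f g (comp k l))
  triangle {a b c : A} (f : Arr a b) (g : Arr b c) :
    tcomp (assoc f (idArr b) g) (compCell (tid f) (lunit g) (by rw [tgt_tid, src_lunit])) =
      compCell (runit f) (tid g) (by rw [tgt_runit, src_tid])

/-- The part of an intercategory that does not mention composition of basic cells: objects with
transversal arrows, the weak double categories `hor` of horizontal arrows and horizontal cells and
`ver` of vertical arrows and vertical cells over the same transversal category, the basic cells
(`Sq h v w k` has top `h`, left side `v`, right side `w` and bottom `k`) and the transversal
category of basic cells and cubes, with its four boundary functors. -/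
structure CubeFrame where
  Obj : Type u
  trans : Category.{w} Obj
  hor : WeakDouble.{u, v, w} Obj
  ver : WeakDouble.{u, v, w} Obj
  Sq : {A B C D : Obj} → hor.Arr A B → ver.Arr A C → ver.Arr B D → hor.Arr C D → Type v
  Cube : {A B C D A' B' C' D' : Obj} →
    {h : hor.Arr A B} → {v : ver.Arr A C} → {w : ver.Arr B D} → {k : hor.Arr C D} →
    {h' : hor.Arr A' B'} → {v' : ver.Arr A' C'} → {w' : ver.Arr B' D'} → {k' : hor.Arr C' D'} →
    Sq h v w k → Sq h' v' w' k' → Type w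
  top {A B C D A' B' C' D' h v w k h' v' w' k'}
    {σ : @Sq A B C D h v w k} {σ' : @Sq A' B' C' D' h' v' w' k'} : Cube σ σ' → hor.Cell h h'
  left {A B C D A' B' C' D' h v w k h' v' w' k'}
    {σ : @Sq A B C D h v w k} {σ' : @Sq A' B' C' D' h' v' w' k'} : Cube σ σ' → ver.Cell v v'
  right {A B C D A' B' C' D' h v w k h' v' w' k'}
    {σ : @Sq A B C D h v w k} {σ' : @Sq A' B' C' D' h' v' w' k'} : Cube σ σ' → ver.Cell w w'
  bot {A B C D A' B' C' D' h v w k h' v' w' k'}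
    {σ : @Sq A B C D h v w k} {σ' : @Sq A' B' C' D' h' v' w' k'} : Cube σ σ' → hor.Cell k k'
  src_top {A B C D A' B' C' D' h v w k h' v' w' k'}
    {σ : @Sq A B C D h v w k} {σ' : @Sq A' B' C' D' h' v' w' k'} (c : Cube σ σ') :
    hor.src (top c) = ver.src (left c)
  tgt_top {A B C D A' B' C' D' h v w k h' v' w' k'}
    {σ : @Sq A B C D h v w k} {σ' : @Sq A' B' C' D' h' v' w' k'} (c : Cube σ σ') :
    hor.tgt (top c) = ver.src (right c)
  src_bot {A B C D A' B' C' D' h v w k h' v' w' k'}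
    {σ : @Sq A B C D h v w k} {σ' : @Sq A' B' C' D' h' v' w' k'} (c : Cube σ σ') :
    hor.src (bot c) = ver.tgt (left c)
  tgt_bot {A B C D A' B' C' D' h v w k h' v' w' k'}
    {σ : @Sq A B C D h v w k} {σ' : @Sq A' B' C' D' h' v' w' k'} (c : Cube σ σ') :
    hor.tgt (bot c) = ver.tgt (right c)
  tid {A B C D h v w k} (σ : @Sq A B C D h v w k) : Cube σ σ
  tcomp {A B C D A' B' C' D' A'' B'' C'' D'' h v w k h' v' w' k' h'' v'' w'' k''}
    {σ : @Sq A B C D h v w k} {σ' : @Sq A' B' C' D' h' v' w' k'}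
    {σ'' : @Sq A'' B'' C'' D'' h'' v'' w'' k''} : Cube σ σ' → Cube σ' σ'' → Cube σ σ''
  tid_tcomp {A B C D A' B' C' D' h v w k h' v' w' k'}
    {σ : @Sq A B C D h v w k} {σ' : @Sq A' B' C' D' h' v' w' k'} (c : Cube σ σ') :
    tcomp (tid σ) c = c
  tcomp_tid {A B C D A' B' C' D' h v w k h' v' w' k'}
    {σ : @Sq A B C D h v w k} {σ' : @Sq A' B' C' D' h' v' w' k'} (c : Cube σ σ') :
    tcomp c (tid σ') = c
  tcomp_assoc {A B C D A' B' C' D' A'' B'' C'' D'' A₃ B₃ C₃ D₃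
      h v w k h' v' w' k' h'' v'' w'' k'' h₃ v₃ w₃ k₃}
    {σ : @Sq A B C D h v w k} {σ' : @Sq A' B' C' D' h' v' w' k'}
    {σ'' : @Sq A'' B'' C'' D'' h'' v'' w'' k''} {σ₃ : @Sq A₃ B₃ C₃ D₃ h₃ v₃ w₃ k₃}
    (c : Cube σ σ') (d : Cube σ' σ'') (e : Cube σ'' σ₃) :
    tcomp (tcomp c d) e = tcomp c (tcomp d e)
  top_tid {A B C D h v w k} (σ : @Sq A B C D h v w k) : top (tid σ) = hor.tid h
  left_tid {A B C D h v w k} (σ : @Sq A B C D h v w k) : left (tid σ) = ver.tid v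
  right_tid {A B C D h v w k} (σ : @Sq A B C D h v w k) : right (tid σ) = ver.tid w
  bot_tid {A B C D h v w k} (σ : @Sq A B C D h v w k) : bot (tid σ) = hor.tid k
  top_tcomp {A B C D A' B' C' D' A'' B'' C'' D'' h v w k h' v' w' k' h'' v'' w'' k''}
    {σ : @Sq A B C D h v w k} {σ' : @Sq A' B' C' D' h' v' w' k'}
    {σ'' : @Sq A'' B'' C'' D'' h'' v'' w'' k''} (c : Cube σ σ') (d : Cube σ' σ'') :
    top (tcomp c d) = hor.tcomp (top c) (top d)
  left_tcomp {A B C D A' B' C' D' A'' B'' C'' D'' h v w k h' v' w' k' h'' v'' w'' k''}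
    {σ : @Sq A B C D h v w k} {σ' : @Sq A' B' C' D' h' v' w' k'}
    {σ'' : @Sq A'' B'' C'' D'' h'' v'' w'' k''} (c : Cube σ σ') (d : Cube σ' σ'') :
    left (tcomp c d) = ver.tcomp (left c) (left d)
  right_tcomp {A B C D A' B' C' D' A'' B'' C'' D'' h v w k h' v' w' k' h'' v'' w'' k''}
    {σ : @Sq A B C D h v w k} {σ' : @Sq A' B' C' D' h' v' w' k'}
    {σ'' : @Sq A'' B'' C'' D'' h'' v'' w'' k''} (c : Cube σ σ') (d : Cube σ' σ'') :
    right (tcomp c d) = ver.tcomp (right c) (right d)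
  bot_tcomp {A B C D A' B' C' D' A'' B'' C'' D'' h v w k h' v' w' k' h'' v'' w'' k''}
    {σ : @Sq A B C D h v w k} {σ' : @Sq A' B' C' D' h' v' w' k'}
    {σ'' : @Sq A'' B'' C'' D'' h'' v'' w'' k''} (c : Cube σ σ') (d : Cube σ' σ'') :
    bot (tcomp c d) = hor.tcomp (bot c) (bot d)

/-- Basic cells and cubes form weak double categories in two ways: horizontally over the vertical
arrows and cells, and vertically over the horizontal arrows and cells, and all boundary functors
are strict double functors.  `sqH`, `cubeH` and `sqV`, `cubeV` are the horizontal and vertical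
compositions of basic cells and of cubes, `sqHid`, `cubeHid`, `sqVid`, `cubeVid` the identities. -/
structure CubeComp extends CubeFrame.{u, v, w} where
  -- horizontal composition of basic cells and cubes: a functor, strict for the boundaries
  sqH {A B C D E F h₀ h₁ k₀ k₁ v w x} (σ : @Sq A B D E h₀ v w k₀) (ρ : @Sq B C E F h₁ w x k₁) :
    Sq (hor.comp h₀ h₁) v x (hor.comp k₀ k₁)
  cubeH {A B C D E F h₀ h₁ k₀ k₁ v w x} {A' B' C' D' E' F' h₀' h₁' k₀' k₁' v' w' x'}
    {σ : @Sq A B D E h₀ v w k₀} {ρ : @Sq B C E F h₁ w x k₁} {σ' : @Sq A' B' D' E' h₀' v' w' k₀'}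
    {ρ' : @Sq B' C' E' F' h₁' w' x' k₁'} (c : Cube σ σ') (d : Cube ρ ρ') (e : right c = left d) :
    Cube (sqH σ ρ) (sqH σ' ρ')
  top_cubeH {A B C D E F h₀ h₁ k₀ k₁ v w x} {A' B' C' D' E' F' h₀' h₁' k₀' k₁' v' w' x'}
    {σ : @Sq A B D E h₀ v w k₀} {ρ : @Sq B C E F h₁ w x k₁} {σ' : @Sq A' B' D' E' h₀' v' w' k₀'}
    {ρ' : @Sq B' C' E' F' h₁' w' x' k₁'} (c : Cube σ σ') (d : Cube ρ ρ') (e : right c = left d) :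
    top (cubeH c d e) = hor.compCell (top c) (top d) (by rw [tgt_top, src_top, e])
  bot_cubeH {A B C D E F h₀ h₁ k₀ k₁ v w x} {A' B' C' D' E' F' h₀' h₁' k₀' k₁' v' w' x'}
    {σ : @Sq A B D E h₀ v w k₀} {ρ : @Sq B C E F h₁ w x k₁} {σ' : @Sq A' B' D' E' h₀' v' w' k₀'}
    {ρ' : @Sq B' C' E' F' h₁' w' x' k₁'} (c : Cube σ σ') (d : Cube ρ ρ') (e : right c = left d) :
    bot (cubeH c d e) = hor.compCell (bot c) (bot d) (by rw [tgt_bot, src_bot, e])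
  left_cubeH {A B C D E F h₀ h₁ k₀ k₁ v w x} {A' B' C' D' E' F' h₀' h₁' k₀' k₁' v' w' x'}
    {σ : @Sq A B D E h₀ v w k₀} {ρ : @Sq B C E F h₁ w x k₁} {σ' : @Sq A' B' D' E' h₀' v' w' k₀'}
    {ρ' : @Sq B' C' E' F' h₁' w' x' k₁'} (c : Cube σ σ') (d : Cube ρ ρ') (e : right c = left d) :
    left (cubeH c d e) = left c
  right_cubeH {A B C D E F h₀ h₁ k₀ k₁ v w x} {A' B' C' D' E' F' h₀' h₁' k₀' k₁' v' w' x'}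
    {σ : @Sq A B D E h₀ v w k₀} {ρ : @Sq B C E F h₁ w x k₁} {σ' : @Sq A' B' D' E' h₀' v' w' k₀'}
    {ρ' : @Sq B' C' E' F' h₁' w' x' k₁'} (c : Cube σ σ') (d : Cube ρ ρ') (e : right c = left d) :
    right (cubeH c d e) = right d
  cubeH_tid {A B C D E F h₀ h₁ k₀ k₁ v w x} (σ : @Sq A B D E h₀ v w k₀)
    (ρ : @Sq B C E F h₁ w x k₁) :
    cubeH (tid σ) (tid ρ) (by rw [right_tid, left_tid]) = tid (sqH σ ρ)
  cubeH_tcomp {A B C D E F h₀ h₁ k₀ k₁ v w x} {A' B' C' D' E' F' h₀' h₁' k₀' k₁' v' w' x'}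
    {A'' B'' C'' D'' E'' F'' h₀'' h₁'' k₀'' k₁'' v'' w'' x''} {σ : @Sq A B D E h₀ v w k₀}
    {ρ : @Sq B C E F h₁ w x k₁} {σ' : @Sq A' B' D' E' h₀' v' w' k₀'}
    {ρ' : @Sq B' C' E' F' h₁' w' x' k₁'} {σ'' : @Sq A'' B'' D'' E'' h₀'' v'' w'' k₀''}
    {ρ'' : @Sq B'' C'' E'' F'' h₁'' w'' x'' k₁''} (c : Cube σ σ') (d : Cube ρ ρ')
    (c' : Cube σ' σ'') (d' : Cube ρ' ρ'') (e : right c = left d) (e' : right c' = left d') :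
    cubeH (tcomp c c') (tcomp d d') (by rw [right_tcomp, left_tcomp, e, e']) =
      tcomp (cubeH c d e) (cubeH c' d' e')
  -- horizontal identities: a functor from vertical arrows and cells to basic cells and cubes
  sqHid {A B} (v : ver.Arr A B) :
    Sq (hor.idArr A) v v (hor.idArr B)
  cubeHid {A B A' B'} {v : ver.Arr A B} {v' : ver.Arr A' B'} (φ : ver.Cell v v') :
    Cube (sqHid v) (sqHid v')
  top_cubeHid {A B A' B'} {v : ver.Arr A B} {v' : ver.Arr A' B'} (φ : ver.Cell v v') :
    top (cubeHid φ) = hor.idCell (ver.src φ)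
  bot_cubeHid {A B A' B'} {v : ver.Arr A B} {v' : ver.Arr A' B'} (φ : ver.Cell v v') :
    bot (cubeHid φ) = hor.idCell (ver.tgt φ)
  left_cubeHid {A B A' B'} {v : ver.Arr A B} {v' : ver.Arr A' B'} (φ : ver.Cell v v') :
    left (cubeHid φ) = φ
  right_cubeHid {A B A' B'} {v : ver.Arr A B} {v' : ver.Arr A' B'} (φ : ver.Cell v v') :
    right (cubeHid φ) = φ
  cubeHid_tid {A B} (v : ver.Arr A B) :
    cubeHid (ver.tid v) = tid (sqHid v)
  cubeHid_tcomp {A B A' B' A'' B''} {v : ver.Arr A B} {v' : ver.Arr A' B'}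
    {v'' : ver.Arr A'' B''} (φ : ver.Cell v v') (ψ : ver.Cell v' v'') :
    cubeHid (ver.tcomp φ ψ) = tcomp (cubeHid φ) (cubeHid ψ)
  -- horizontal associativity and unit cubes: natural, invertible, coherent
  hAssoc {A B C D E F G H h₀ h₁ h₂ k₀ k₁ k₂ v w x y} (σ : @Sq A B E F h₀ v w k₀)
    (ρ : @Sq B C F G h₁ w x k₁) (π : @Sq C D G H h₂ x y k₂) :
    Cube (sqH (sqH σ ρ) π) (sqH σ (sqH ρ π))
  top_hAssoc {A B C D E F G H h₀ h₁ h₂ k₀ k₁ k₂ v w x y} (σ : @Sq A B E F h₀ v w k₀)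
    (ρ : @Sq B C F G h₁ w x k₁) (π : @Sq C D G H h₂ x y k₂) :
    top (hAssoc σ ρ π) = hor.assoc h₀ h₁ h₂
  bot_hAssoc {A B C D E F G H h₀ h₁ h₂ k₀ k₁ k₂ v w x y} (σ : @Sq A B E F h₀ v w k₀)
    (ρ : @Sq B C F G h₁ w x k₁) (π : @Sq C D G H h₂ x y k₂) :
    bot (hAssoc σ ρ π) = hor.assoc k₀ k₁ k₂
  left_hAssoc {A B C D E F G H h₀ h₁ h₂ k₀ k₁ k₂ v w x y} (σ : @Sq A B E F h₀ v w k₀)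
    (ρ : @Sq B C F G h₁ w x k₁) (π : @Sq C D G H h₂ x y k₂) :
    left (hAssoc σ ρ π) = ver.tid v
  right_hAssoc {A B C D E F G H h₀ h₁ h₂ k₀ k₁ k₂ v w x y} (σ : @Sq A B E F h₀ v w k₀)
    (ρ : @Sq B C F G h₁ w x k₁) (π : @Sq C D G H h₂ x y k₂) :
    right (hAssoc σ ρ π) = ver.tid y
  hAssoc_iso {A B C D E F G H h₀ h₁ h₂ k₀ k₁ k₂ v w x y} (σ : @Sq A B E F h₀ v w k₀)
    (ρ : @Sq B C F G h₁ w x k₁) (π : @Sq C D G H h₂ x y k₂) :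
    ∃ z : Cube (sqH σ (sqH ρ π)) (sqH (sqH σ ρ) π),
      tcomp (hAssoc σ ρ π) z = tid _ ∧ tcomp z (hAssoc σ ρ π) = tid _
  hAssoc_nat {A B C D E F G H h₀ h₁ h₂ k₀ k₁ k₂ v w x y}
    {A' B' C' D' E' F' G' H' h₀' h₁' h₂' k₀' k₁' k₂' v' w' x' y'} {σ : @Sq A B E F h₀ v w k₀}
    {ρ : @Sq B C F G h₁ w x k₁} {π : @Sq C D G H h₂ x y k₂} {σ' : @Sq A' B' E' F' h₀' v' w' k₀'}
    {ρ' : @Sq B' C' F' G' h₁' w' x' k₁'} {π' : @Sq C' D' G' H' h₂' x' y' k₂'} (c : Cube σ σ')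
    (d : Cube ρ ρ') (f : Cube π π') (e₁ : right c = left d) (e₂ : right d = left f) :
    tcomp (cubeH (cubeH c d e₁) f (by rw [right_cubeH, e₂])) (hAssoc σ' ρ' π') =
      tcomp (hAssoc σ ρ π) (cubeH c (cubeH d f e₂) (by rw [left_cubeH, e₁]))
  hLunit {A B C D h k v w} (σ : @Sq A B C D h v w k) :
    Cube (sqH (sqHid v) σ) σ
  top_hLunit {A B C D h k v w} (σ : @Sq A B C D h v w k) :
    top (hLunit σ) = hor.lunit h
  bot_hLunit {A B C D h k v w} (σ : @Sq A B C D h v w k) :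
    bot (hLunit σ) = hor.lunit k
  left_hLunit {A B C D h k v w} (σ : @Sq A B C D h v w k) :
    left (hLunit σ) = ver.tid v
  right_hLunit {A B C D h k v w} (σ : @Sq A B C D h v w k) :
    right (hLunit σ) = ver.tid w
  hLunit_iso {A B C D h k v w} (σ : @Sq A B C D h v w k) :
    ∃ z : Cube σ (sqH (sqHid v) σ), tcomp (hLunit σ) z = tid _ ∧ tcomp z (hLunit σ) = tid _
  hLunit_nat {A B C D h k v w} {A' B' C' D' h' k' v' w'} {σ : @Sq A B C D h v w k}
    {σ' : @Sq A' B' C' D' h' v' w' k'} (c : Cube σ σ') :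
    tcomp (cubeH (cubeHid (left c)) c (by rw [right_cubeHid])) (hLunit σ') =
      tcomp (hLunit σ) c
  hRunit {A B C D h k v w} (σ : @Sq A B C D h v w k) :
    Cube (sqH σ (sqHid w)) σ
  top_hRunit {A B C D h k v w} (σ : @Sq A B C D h v w k) :
    top (hRunit σ) = hor.runit h
  bot_hRunit {A B C D h k v w} (σ : @Sq A B C D h v w k) :
    bot (hRunit σ) = hor.runit k
  left_hRunit {A B C D h k v w} (σ : @Sq A B C D h v w k) :
    left (hRunit σ) = ver.tid v
  right_hRunit {A B C D h k v w} (σ : @Sq A B C D h v w k) :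
    right (hRunit σ) = ver.tid w
  hRunit_iso {A B C D h k v w} (σ : @Sq A B C D h v w k) :
    ∃ z : Cube σ (sqH σ (sqHid w)), tcomp (hRunit σ) z = tid _ ∧ tcomp z (hRunit σ) = tid _
  hRunit_nat {A B C D h k v w} {A' B' C' D' h' k' v' w'} {σ : @Sq A B C D h v w k}
    {σ' : @Sq A' B' C' D' h' v' w' k'} (c : Cube σ σ') :
    tcomp (cubeH c (cubeHid (right c)) (by rw [left_cubeHid])) (hRunit σ') =
      tcomp (hRunit σ) c
  hPentagon {A B C D E F G H I J h₁ h₂ h₃ h₄ k₁ k₂ k₃ k₄ v₀ v₁ v₂ v₃ v₄}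
    (σ₁ : @Sq A B F G h₁ v₀ v₁ k₁) (σ₂ : @Sq B C G H h₂ v₁ v₂ k₂) (σ₃ : @Sq C D H I h₃ v₂ v₃ k₃)
    (σ₄ : @Sq D E I J h₄ v₃ v₄ k₄) :
    tcomp (tcomp (cubeH (hAssoc σ₁ σ₂ σ₃) (tid σ₄) (by rw [right_hAssoc, left_tid]))
        (hAssoc σ₁ (sqH σ₂ σ₃) σ₄))
        (cubeH (tid σ₁) (hAssoc σ₂ σ₃ σ₄) (by rw [right_tid, left_hAssoc])) =
      tcomp (hAssoc (sqH σ₁ σ₂) σ₃ σ₄) (hAssoc σ₁ σ₂ (sqH σ₃ σ₄))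
  hTriangle {A B C D E F h₀ h₁ k₀ k₁ v w x} (σ : @Sq A B D E h₀ v w k₀)
    (ρ : @Sq B C E F h₁ w x k₁) :
    tcomp (hAssoc σ (sqHid w) ρ) (cubeH (tid σ) (hLunit ρ) (by rw [right_tid, left_hLunit])) =
      cubeH (hRunit σ) (tid ρ) (by rw [right_hRunit, left_tid])
  -- vertical composition of basic cells and cubes: a functor, strict for the boundaries
  sqV {A B C D E F h k l v₀ w₀ v₁ w₁} (σ₀ : @Sq A B C D h v₀ w₀ k) (σ₁ : @Sq C D E F k v₁ w₁ l) :
    Sq h (ver.comp v₀ v₁) (ver.comp w₀ w₁) l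
  cubeV {A B C D E F h k l v₀ w₀ v₁ w₁} {A' B' C' D' E' F' h' k' l' v₀' w₀' v₁' w₁'}
    {σ₀ : @Sq A B C D h v₀ w₀ k} {σ₁ : @Sq C D E F k v₁ w₁ l}
    {σ₀' : @Sq A' B' C' D' h' v₀' w₀' k'} {σ₁' : @Sq C' D' E' F' k' v₁' w₁' l'}
    (c₀ : Cube σ₀ σ₀') (c₁ : Cube σ₁ σ₁') (e : bot c₀ = top c₁) :
    Cube (sqV σ₀ σ₁) (sqV σ₀' σ₁')
  left_cubeV {A B C D E F h k l v₀ w₀ v₁ w₁} {A' B' C' D' E' F' h' k' l' v₀' w₀' v₁' w₁'}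
    {σ₀ : @Sq A B C D h v₀ w₀ k} {σ₁ : @Sq C D E F k v₁ w₁ l}
    {σ₀' : @Sq A' B' C' D' h' v₀' w₀' k'} {σ₁' : @Sq C' D' E' F' k' v₁' w₁' l'}
    (c₀ : Cube σ₀ σ₀') (c₁ : Cube σ₁ σ₁') (e : bot c₀ = top c₁) :
    left (cubeV c₀ c₁ e) = ver.compCell (left c₀) (left c₁) (by rw [← src_bot, ← src_top, e])
  right_cubeV {A B C D E F h k l v₀ w₀ v₁ w₁} {A' B' C' D' E' F' h' k' l' v₀' w₀' v₁' w₁'}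
    {σ₀ : @Sq A B C D h v₀ w₀ k} {σ₁ : @Sq C D E F k v₁ w₁ l}
    {σ₀' : @Sq A' B' C' D' h' v₀' w₀' k'} {σ₁' : @Sq C' D' E' F' k' v₁' w₁' l'}
    (c₀ : Cube σ₀ σ₀') (c₁ : Cube σ₁ σ₁') (e : bot c₀ = top c₁) :
    right (cubeV c₀ c₁ e) = ver.compCell (right c₀) (right c₁) (by rw [← tgt_bot, ← tgt_top, e])
  top_cubeV {A B C D E F h k l v₀ w₀ v₁ w₁} {A' B' C' D' E' F' h' k' l' v₀' w₀' v₁' w₁'}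
    {σ₀ : @Sq A B C D h v₀ w₀ k} {σ₁ : @Sq C D E F k v₁ w₁ l}
    {σ₀' : @Sq A' B' C' D' h' v₀' w₀' k'} {σ₁' : @Sq C' D' E' F' k' v₁' w₁' l'}
    (c₀ : Cube σ₀ σ₀') (c₁ : Cube σ₁ σ₁') (e : bot c₀ = top c₁) :
    top (cubeV c₀ c₁ e) = top c₀
  bot_cubeV {A B C D E F h k l v₀ w₀ v₁ w₁} {A' B' C' D' E' F' h' k' l' v₀' w₀' v₁' w₁'}
    {σ₀ : @Sq A B C D h v₀ w₀ k} {σ₁ : @Sq C D E F k v₁ w₁ l}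
    {σ₀' : @Sq A' B' C' D' h' v₀' w₀' k'} {σ₁' : @Sq C' D' E' F' k' v₁' w₁' l'}
    (c₀ : Cube σ₀ σ₀') (c₁ : Cube σ₁ σ₁') (e : bot c₀ = top c₁) :
    bot (cubeV c₀ c₁ e) = bot c₁
  cubeV_tid {A B C D E F h k l v₀ w₀ v₁ w₁} (σ₀ : @Sq A B C D h v₀ w₀ k)
    (σ₁ : @Sq C D E F k v₁ w₁ l) :
    cubeV (tid σ₀) (tid σ₁) (by rw [bot_tid, top_tid]) = tid (sqV σ₀ σ₁)
  cubeV_tcomp {A B C D E F h k l v₀ w₀ v₁ w₁} {A' B' C' D' E' F' h' k' l' v₀' w₀' v₁' w₁'}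
    {A'' B'' C'' D'' E'' F'' h'' k'' l'' v₀'' w₀'' v₁'' w₁''} {σ₀ : @Sq A B C D h v₀ w₀ k}
    {σ₁ : @Sq C D E F k v₁ w₁ l} {σ₀' : @Sq A' B' C' D' h' v₀' w₀' k'}
    {σ₁' : @Sq C' D' E' F' k' v₁' w₁' l'} {σ₀'' : @Sq A'' B'' C'' D'' h'' v₀'' w₀'' k''}
    {σ₁'' : @Sq C'' D'' E'' F'' k'' v₁'' w₁'' l''} (c₀ : Cube σ₀ σ₀') (c₁ : Cube σ₁ σ₁')
    (c₀' : Cube σ₀' σ₀'') (c₁' : Cube σ₁' σ₁'') (e : bot c₀ = top c₁) (e' : bot c₀' = top c₁') :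
    cubeV (tcomp c₀ c₀') (tcomp c₁ c₁') (by rw [bot_tcomp, top_tcomp, e, e']) =
      tcomp (cubeV c₀ c₁ e) (cubeV c₀' c₁' e')
  -- vertical identities: a functor from horizontal arrows and cells to basic cells and cubes
  sqVid {A B} (h : hor.Arr A B) :
    Sq h (ver.idArr A) (ver.idArr B) h
  cubeVid {A B A' B'} {h : hor.Arr A B} {h' : hor.Arr A' B'} (φ : hor.Cell h h') :
    Cube (sqVid h) (sqVid h')
  left_cubeVid {A B A' B'} {h : hor.Arr A B} {h' : hor.Arr A' B'} (φ : hor.Cell h h') :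
    left (cubeVid φ) = ver.idCell (hor.src φ)
  right_cubeVid {A B A' B'} {h : hor.Arr A B} {h' : hor.Arr A' B'} (φ : hor.Cell h h') :
    right (cubeVid φ) = ver.idCell (hor.tgt φ)
  top_cubeVid {A B A' B'} {h : hor.Arr A B} {h' : hor.Arr A' B'} (φ : hor.Cell h h') :
    top (cubeVid φ) = φ
  bot_cubeVid {A B A' B'} {h : hor.Arr A B} {h' : hor.Arr A' B'} (φ : hor.Cell h h') :
    bot (cubeVid φ) = φ
  cubeVid_tid {A B} (h : hor.Arr A B) :
    cubeVid (hor.tid h) = tid (sqVid h)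
  cubeVid_tcomp {A B A' B' A'' B''} {h : hor.Arr A B} {h' : hor.Arr A' B'}
    {h'' : hor.Arr A'' B''} (φ : hor.Cell h h') (ψ : hor.Cell h' h'') :
    cubeVid (hor.tcomp φ ψ) = tcomp (cubeVid φ) (cubeVid ψ)
  -- vertical associativity and unit cubes: natural, invertible, coherent
  vAssoc {A B C D E F G H h k l n v₀ w₀ v₁ w₁ v₂ w₂} (σ₀ : @Sq A B C D h v₀ w₀ k)
    (σ₁ : @Sq C D E F k v₁ w₁ l) (σ₂ : @Sq E F G H l v₂ w₂ n) :
    Cube (sqV (sqV σ₀ σ₁) σ₂) (sqV σ₀ (sqV σ₁ σ₂))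
  left_vAssoc {A B C D E F G H h k l n v₀ w₀ v₁ w₁ v₂ w₂} (σ₀ : @Sq A B C D h v₀ w₀ k)
    (σ₁ : @Sq C D E F k v₁ w₁ l) (σ₂ : @Sq E F G H l v₂ w₂ n) :
    left (vAssoc σ₀ σ₁ σ₂) = ver.assoc v₀ v₁ v₂
  right_vAssoc {A B C D E F G H h k l n v₀ w₀ v₁ w₁ v₂ w₂} (σ₀ : @Sq A B C D h v₀ w₀ k)
    (σ₁ : @Sq C D E F k v₁ w₁ l) (σ₂ : @Sq E F G H l v₂ w₂ n) :
    right (vAssoc σ₀ σ₁ σ₂) = ver.assoc w₀ w₁ w₂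
  top_vAssoc {A B C D E F G H h k l n v₀ w₀ v₁ w₁ v₂ w₂} (σ₀ : @Sq A B C D h v₀ w₀ k)
    (σ₁ : @Sq C D E F k v₁ w₁ l) (σ₂ : @Sq E F G H l v₂ w₂ n) :
    top (vAssoc σ₀ σ₁ σ₂) = hor.tid h
  bot_vAssoc {A B C D E F G H h k l n v₀ w₀ v₁ w₁ v₂ w₂} (σ₀ : @Sq A B C D h v₀ w₀ k)
    (σ₁ : @Sq C D E F k v₁ w₁ l) (σ₂ : @Sq E F G H l v₂ w₂ n) :
    bot (vAssoc σ₀ σ₁ σ₂) = hor.tid n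
  vAssoc_iso {A B C D E F G H h k l n v₀ w₀ v₁ w₁ v₂ w₂} (σ₀ : @Sq A B C D h v₀ w₀ k)
    (σ₁ : @Sq C D E F k v₁ w₁ l) (σ₂ : @Sq E F G H l v₂ w₂ n) :
    ∃ z : Cube (sqV σ₀ (sqV σ₁ σ₂)) (sqV (sqV σ₀ σ₁) σ₂),
      tcomp (vAssoc σ₀ σ₁ σ₂) z = tid _ ∧ tcomp z (vAssoc σ₀ σ₁ σ₂) = tid _
  vAssoc_nat {A B C D E F G H h k l n v₀ w₀ v₁ w₁ v₂ w₂}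
    {A' B' C' D' E' F' G' H' h' k' l' n' v₀' w₀' v₁' w₁' v₂' w₂'} {σ₀ : @Sq A B C D h v₀ w₀ k}
    {σ₁ : @Sq C D E F k v₁ w₁ l} {σ₂ : @Sq E F G H l v₂ w₂ n}
    {σ₀' : @Sq A' B' C' D' h' v₀' w₀' k'} {σ₁' : @Sq C' D' E' F' k' v₁' w₁' l'}
    {σ₂' : @Sq E' F' G' H' l' v₂' w₂' n'} (c₀ : Cube σ₀ σ₀') (c₁ : Cube σ₁ σ₁')
    (c₂ : Cube σ₂ σ₂') (e₁ : bot c₀ = top c₁) (e₂ : bot c₁ = top c₂) :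
    tcomp (cubeV (cubeV c₀ c₁ e₁) c₂ (by rw [bot_cubeV, e₂])) (vAssoc σ₀' σ₁' σ₂') =
      tcomp (vAssoc σ₀ σ₁ σ₂) (cubeV c₀ (cubeV c₁ c₂ e₂) (by rw [top_cubeV, e₁]))
  vLunit {A B C D h k v w} (σ : @Sq A B C D h v w k) :
    Cube (sqV (sqVid h) σ) σ
  left_vLunit {A B C D h k v w} (σ : @Sq A B C D h v w k) :
    left (vLunit σ) = ver.lunit v
  right_vLunit {A B C D h k v w} (σ : @Sq A B C D h v w k) :
    right (vLunit σ) = ver.lunit w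
  top_vLunit {A B C D h k v w} (σ : @Sq A B C D h v w k) :
    top (vLunit σ) = hor.tid h
  bot_vLunit {A B C D h k v w} (σ : @Sq A B C D h v w k) :
    bot (vLunit σ) = hor.tid k
  vLunit_iso {A B C D h k v w} (σ : @Sq A B C D h v w k) :
    ∃ z : Cube σ (sqV (sqVid h) σ), tcomp (vLunit σ) z = tid _ ∧ tcomp z (vLunit σ) = tid _
  vLunit_nat {A B C D h k v w} {A' B' C' D' h' k' v' w'} {σ : @Sq A B C D h v w k}
    {σ' : @Sq A' B' C' D' h' v' w' k'} (c : Cube σ σ') :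
    tcomp (cubeV (cubeVid (top c)) c (by rw [bot_cubeVid])) (vLunit σ') =
      tcomp (vLunit σ) c
  vRunit {A B C D h k v w} (σ : @Sq A B C D h v w k) :
    Cube (sqV σ (sqVid k)) σ
  left_vRunit {A B C D h k v w} (σ : @Sq A B C D h v w k) :
    left (vRunit σ) = ver.runit v
  right_vRunit {A B C D h k v w} (σ : @Sq A B C D h v w k) :
    right (vRunit σ) = ver.runit w
  top_vRunit {A B C D h k v w} (σ : @Sq A B C D h v w k) :
    top (vRunit σ) = hor.tid h
  bot_vRunit {A B C D h k v w} (σ : @Sq A B C D h v w k) :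
    bot (vRunit σ) = hor.tid k
  vRunit_iso {A B C D h k v w} (σ : @Sq A B C D h v w k) :
    ∃ z : Cube σ (sqV σ (sqVid k)), tcomp (vRunit σ) z = tid _ ∧ tcomp z (vRunit σ) = tid _
  vRunit_nat {A B C D h k v w} {A' B' C' D' h' k' v' w'} {σ : @Sq A B C D h v w k}
    {σ' : @Sq A' B' C' D' h' v' w' k'} (c : Cube σ σ') :
    tcomp (cubeV c (cubeVid (bot c)) (by rw [top_cubeVid])) (vRunit σ') =
      tcomp (vRunit σ) c
  vPentagon {A B C D E F G H I J h₀ h₁ h₂ h₃ h₄ v₁ v₂ v₃ v₄ w₁ w₂ w₃ w₄}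
    (σ₁ : @Sq A F B G h₀ v₁ w₁ h₁) (σ₂ : @Sq B G C H h₁ v₂ w₂ h₂) (σ₃ : @Sq C H D I h₂ v₃ w₃ h₃)
    (σ₄ : @Sq D I E J h₃ v₄ w₄ h₄) :
    tcomp (tcomp (cubeV (vAssoc σ₁ σ₂ σ₃) (tid σ₄) (by rw [bot_vAssoc, top_tid]))
        (vAssoc σ₁ (sqV σ₂ σ₃) σ₄))
        (cubeV (tid σ₁) (vAssoc σ₂ σ₃ σ₄) (by rw [bot_tid, top_vAssoc])) =
      tcomp (vAssoc (sqV σ₁ σ₂) σ₃ σ₄) (vAssoc σ₁ σ₂ (sqV σ₃ σ₄))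
  vTriangle {A B C D E F h k l v₀ w₀ v₁ w₁} (σ₀ : @Sq A B C D h v₀ w₀ k)
    (σ₁ : @Sq C D E F k v₁ w₁ l) :
    tcomp (vAssoc σ₀ (sqVid k) σ₁) (cubeV (tid σ₀) (vLunit σ₁) (by rw [bot_tid, top_vLunit])) =
      cubeV (vRunit σ₀) (tid σ₁) (by rw [bot_vRunit, top_tid])

/-- An intercategory, presented as a double pseudocategory in the 2-category of categories.  The
horizontal and vertical structures are related by the interchangers `chi`, `mu`, `delta`, `tau`,
which are natural special cubes making horizontal composition and horizontal identities into lax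
functors, and the horizontal constraints into transformations of lax functors. -/
structure Intercategory extends CubeComp.{u, v, w} where
  -- the interchangers
  chi {A B C D E F G H I h₀ h₁ k₀ k₁ l₀ l₁ v₀ w₀ x₀ v₁ w₁ x₁} (σ₀ : @Sq A B D E h₀ v₀ w₀ k₀)
    (ρ₀ : @Sq B C E F h₁ w₀ x₀ k₁) (σ₁ : @Sq D E G H k₀ v₁ w₁ l₀) (ρ₁ : @Sq E F H I k₁ w₁ x₁ l₁) :
    Cube (sqV (sqH σ₀ ρ₀) (sqH σ₁ ρ₁)) (sqH (sqV σ₀ σ₁) (sqV ρ₀ ρ₁))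
  top_chi {A B C D E F G H I h₀ h₁ k₀ k₁ l₀ l₁ v₀ w₀ x₀ v₁ w₁ x₁} (σ₀ : @Sq A B D E h₀ v₀ w₀ k₀)
    (ρ₀ : @Sq B C E F h₁ w₀ x₀ k₁) (σ₁ : @Sq D E G H k₀ v₁ w₁ l₀) (ρ₁ : @Sq E F H I k₁ w₁ x₁ l₁) :
    top (chi σ₀ ρ₀ σ₁ ρ₁) = hor.tid _
  left_chi {A B C D E F G H I h₀ h₁ k₀ k₁ l₀ l₁ v₀ w₀ x₀ v₁ w₁ x₁} (σ₀ : @Sq A B D E h₀ v₀ w₀ k₀)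
    (ρ₀ : @Sq B C E F h₁ w₀ x₀ k₁) (σ₁ : @Sq D E G H k₀ v₁ w₁ l₀) (ρ₁ : @Sq E F H I k₁ w₁ x₁ l₁) :
    left (chi σ₀ ρ₀ σ₁ ρ₁) = ver.tid _
  right_chi {A B C D E F G H I h₀ h₁ k₀ k₁ l₀ l₁ v₀ w₀ x₀ v₁ w₁ x₁}
    (σ₀ : @Sq A B D E h₀ v₀ w₀ k₀) (ρ₀ : @Sq B C E F h₁ w₀ x₀ k₁) (σ₁ : @Sq D E G H k₀ v₁ w₁ l₀)
    (ρ₁ : @Sq E F H I k₁ w₁ x₁ l₁) :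
    right (chi σ₀ ρ₀ σ₁ ρ₁) = ver.tid _
  bot_chi {A B C D E F G H I h₀ h₁ k₀ k₁ l₀ l₁ v₀ w₀ x₀ v₁ w₁ x₁} (σ₀ : @Sq A B D E h₀ v₀ w₀ k₀)
    (ρ₀ : @Sq B C E F h₁ w₀ x₀ k₁) (σ₁ : @Sq D E G H k₀ v₁ w₁ l₀) (ρ₁ : @Sq E F H I k₁ w₁ x₁ l₁) :
    bot (chi σ₀ ρ₀ σ₁ ρ₁) = hor.tid _
  chi_nat {A B C D E F G H I h₀ h₁ k₀ k₁ l₀ l₁ v₀ w₀ x₀ v₁ w₁ x₁}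
    {A' B' C' D' E' F' G' H' I' h₀' h₁' k₀' k₁' l₀' l₁' v₀' w₀' x₀' v₁' w₁' x₁'}
    {σ₀ : @Sq A B D E h₀ v₀ w₀ k₀} {ρ₀ : @Sq B C E F h₁ w₀ x₀ k₁} {σ₁ : @Sq D E G H k₀ v₁ w₁ l₀}
    {ρ₁ : @Sq E F H I k₁ w₁ x₁ l₁} {σ₀' : @Sq A' B' D' E' h₀' v₀' w₀' k₀'}
    {ρ₀' : @Sq B' C' E' F' h₁' w₀' x₀' k₁'} {σ₁' : @Sq D' E' G' H' k₀' v₁' w₁' l₀'}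
    {ρ₁' : @Sq E' F' H' I' k₁' w₁' x₁' l₁'} (c₀ : Cube σ₀ σ₀') (d₀ : Cube ρ₀ ρ₀')
    (c₁ : Cube σ₁ σ₁') (d₁ : Cube ρ₁ ρ₁') (e₁ : right c₀ = left d₀) (e₂ : right c₁ = left d₁)
    (e₃ : bot c₀ = top c₁) (e₄ : bot d₀ = top d₁) :
    tcomp (cubeV (cubeH c₀ d₀ e₁) (cubeH c₁ d₁ e₂) (by simp only [bot_cubeH, top_cubeH, e₃, e₄]))
        (chi σ₀' ρ₀' σ₁' ρ₁') =
      tcomp (chi σ₀ ρ₀ σ₁ ρ₁)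
        (cubeH (cubeV c₀ c₁ e₃) (cubeV d₀ d₁ e₄) (by simp only [right_cubeV, left_cubeV, e₁, e₂]))
  mu {A B C} (v : ver.Arr A B) (w : ver.Arr B C) :
    Cube (sqV (sqHid v) (sqHid w)) (sqHid (ver.comp v w))
  top_mu {A B C} (v : ver.Arr A B) (w : ver.Arr B C) :
    top (mu v w) = hor.tid _
  left_mu {A B C} (v : ver.Arr A B) (w : ver.Arr B C) :
    left (mu v w) = ver.tid _
  right_mu {A B C} (v : ver.Arr A B) (w : ver.Arr B C) :
    right (mu v w) = ver.tid _
  bot_mu {A B C} (v : ver.Arr A B) (w : ver.Arr B C) :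
    bot (mu v w) = hor.tid _
  mu_nat {A B C A' B' C'} {v : ver.Arr A B} {w : ver.Arr B C} {v' : ver.Arr A' B'}
    {w' : ver.Arr B' C'} (φ : ver.Cell v v') (ψ : ver.Cell w w') (e : ver.tgt φ = ver.src ψ) :
    tcomp (cubeV (cubeHid φ) (cubeHid ψ) (by rw [bot_cubeHid, top_cubeHid, e])) (mu v' w') =
      tcomp (mu v w) (cubeHid (ver.compCell φ ψ e))
  delta {A B C} (h : hor.Arr A B) (k : hor.Arr B C) :
    Cube (sqVid (hor.comp h k)) (sqH (sqVid h) (sqVid k))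
  top_delta {A B C} (h : hor.Arr A B) (k : hor.Arr B C) :
    top (delta h k) = hor.tid _
  left_delta {A B C} (h : hor.Arr A B) (k : hor.Arr B C) :
    left (delta h k) = ver.tid _
  right_delta {A B C} (h : hor.Arr A B) (k : hor.Arr B C) :
    right (delta h k) = ver.tid _
  bot_delta {A B C} (h : hor.Arr A B) (k : hor.Arr B C) :
    bot (delta h k) = hor.tid _
  delta_nat {A B C A' B' C'} {h : hor.Arr A B} {k : hor.Arr B C} {h' : hor.Arr A' B'}
    {k' : hor.Arr B' C'} (φ : hor.Cell h h') (ψ : hor.Cell k k') (e : hor.tgt φ = hor.src ψ) :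
    tcomp (cubeVid (hor.compCell φ ψ e)) (delta h' k') =
      tcomp (delta h k) (cubeH (cubeVid φ) (cubeVid ψ) (by rw [right_cubeVid, left_cubeVid, e]))
  tau (A : Obj) :
    Cube (sqVid (hor.idArr A)) (sqHid (ver.idArr A))
  top_tau (A : Obj) :
    top (tau A) = hor.tid _
  left_tau (A : Obj) :
    left (tau A) = ver.tid _
  right_tau (A : Obj) :
    right (tau A) = ver.tid _
  bot_tau (A : Obj) :
    bot (tau A) = hor.tid _
  tau_nat {A A' : Obj} (t : A ⟶ A') :
    tcomp (cubeVid (hor.idCell t)) (tau A') = tcomp (tau A) (cubeHid (ver.idCell t))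
  -- horizontal composition is a lax functor for the vertical structures
  chi_assoc {A B C D E F G H I J K L h₀ h₁ k₀ k₁ l₀ l₁ n₀ n₁ v₀ w₀ x₀ v₁ w₁ x₁ v₂ w₂ x₂}
    (σ₀ : @Sq A B D E h₀ v₀ w₀ k₀) (ρ₀ : @Sq B C E F h₁ w₀ x₀ k₁) (σ₁ : @Sq D E G H k₀ v₁ w₁ l₀)
    (ρ₁ : @Sq E F H I k₁ w₁ x₁ l₁) (σ₂ : @Sq G H J K l₀ v₂ w₂ n₀) (ρ₂ : @Sq H I K L l₁ w₂ x₂ n₁) :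
    tcomp (tcomp (cubeV (chi σ₀ ρ₀ σ₁ ρ₁) (tid (sqH σ₂ ρ₂)) (by rw [bot_chi, top_tid]))
        (chi (sqV σ₀ σ₁) (sqV ρ₀ ρ₁) σ₂ ρ₂))
        (cubeH (vAssoc σ₀ σ₁ σ₂) (vAssoc ρ₀ ρ₁ ρ₂) (by rw [right_vAssoc, left_vAssoc])) =
      tcomp (tcomp (vAssoc (sqH σ₀ ρ₀) (sqH σ₁ ρ₁) (sqH σ₂ ρ₂))
        (cubeV (tid (sqH σ₀ ρ₀)) (chi σ₁ ρ₁ σ₂ ρ₂) (by rw [bot_tid, top_chi])))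
        (chi σ₀ ρ₀ (sqV σ₁ σ₂) (sqV ρ₁ ρ₂))
  chi_lunit {A B C D E F h₀ h₁ k₀ k₁ v w x} (σ : @Sq A B D E h₀ v w k₀)
    (ρ : @Sq B C E F h₁ w x k₁) :
    tcomp (tcomp (cubeV (delta h₀ h₁) (tid (sqH σ ρ)) (by rw [bot_delta, top_tid]))
        (chi (sqVid h₀) (sqVid h₁) σ ρ))
        (cubeH (vLunit σ) (vLunit ρ) (by rw [right_vLunit, left_vLunit])) = vLunit (sqH σ ρ)
  chi_runit {A B C D E F h₀ h₁ k₀ k₁ v w x} (σ : @Sq A B D E h₀ v w k₀)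
    (ρ : @Sq B C E F h₁ w x k₁) :
    tcomp (tcomp (cubeV (tid (sqH σ ρ)) (delta k₀ k₁) (by rw [bot_tid, top_delta]))
        (chi σ ρ (sqVid k₀) (sqVid k₁)))
        (cubeH (vRunit σ) (vRunit ρ) (by rw [right_vRunit, left_vRunit])) = vRunit (sqH σ ρ)
  -- horizontal identities form a lax functor for the vertical structures
  mu_assoc {A B C D} (v : ver.Arr A B) (w : ver.Arr B C) (x : ver.Arr C D) :
    tcomp (tcomp (cubeV (mu v w) (tid (sqHid x)) (by rw [bot_mu, top_tid])) (mu (ver.comp v w) x))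
        (cubeHid (ver.assoc v w x)) =
      tcomp (tcomp (vAssoc (sqHid v) (sqHid w) (sqHid x))
        (cubeV (tid (sqHid v)) (mu w x) (by rw [bot_tid, top_mu]))) (mu v (ver.comp w x))
  mu_lunit {A B} (v : ver.Arr A B) :
    tcomp (tcomp (cubeV (tau A) (tid (sqHid v)) (by rw [bot_tau, top_tid])) (mu (ver.idArr A) v))
      (cubeHid (ver.lunit v)) = vLunit (sqHid v)
  mu_runit {A B} (v : ver.Arr A B) :
    tcomp (tcomp (cubeV (tid (sqHid v)) (tau B) (by rw [bot_tid, top_tau])) (mu v (ver.idArr B)))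
      (cubeHid (ver.runit v)) = vRunit (sqHid v)
  -- the horizontal constraints are transformations of lax functors
  chi_hAssoc {A B C D E F G H I J K L h₀ h₁ h₂ k₀ k₁ k₂ l₀ l₁ l₂ v₀ w₀ x₀ y₀ v₁ w₁ x₁ y₁}
    (σ₀ : @Sq A B E F h₀ v₀ w₀ k₀) (ρ₀ : @Sq B C F G h₁ w₀ x₀ k₁) (π₀ : @Sq C D G H h₂ x₀ y₀ k₂)
    (σ₁ : @Sq E F I J k₀ v₁ w₁ l₀) (ρ₁ : @Sq F G J K k₁ w₁ x₁ l₁) (π₁ : @Sq G H K L k₂ x₁ y₁ l₂) :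
    tcomp (tcomp (chi (sqH σ₀ ρ₀) π₀ (sqH σ₁ ρ₁) π₁)
        (cubeH (chi σ₀ ρ₀ σ₁ ρ₁) (tid (sqV π₀ π₁)) (by rw [right_chi, left_tid])))
        (hAssoc (sqV σ₀ σ₁) (sqV ρ₀ ρ₁) (sqV π₀ π₁)) =
      tcomp (tcomp (cubeV (hAssoc σ₀ ρ₀ π₀) (hAssoc σ₁ ρ₁ π₁)
          (by rw [bot_hAssoc, top_hAssoc])) (chi σ₀ (sqH ρ₀ π₀) σ₁ (sqH ρ₁ π₁)))
        (cubeH (tid (sqV σ₀ σ₁)) (chi ρ₀ π₀ ρ₁ π₁) (by rw [right_tid, left_chi]))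
  delta_hAssoc {A B C D} (h : hor.Arr A B) (k : hor.Arr B C) (l : hor.Arr C D) :
    tcomp (tcomp (delta (hor.comp h k) l)
        (cubeH (delta h k) (tid (sqVid l)) (by rw [right_delta, left_tid])))
        (hAssoc (sqVid h) (sqVid k) (sqVid l)) =
      tcomp (tcomp (cubeVid (hor.assoc h k l)) (delta h (hor.comp k l)))
        (cubeH (tid (sqVid h)) (delta k l) (by rw [right_tid, left_delta]))
  chi_hLunit {A B C D E F h k l v₀ w₀ v₁ w₁} (σ₀ : @Sq A B C D h v₀ w₀ k)
    (σ₁ : @Sq C D E F k v₁ w₁ l) :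
    tcomp (tcomp (chi (sqHid v₀) σ₀ (sqHid v₁) σ₁)
        (cubeH (mu v₀ v₁) (tid (sqV σ₀ σ₁)) (by rw [right_mu, left_tid]))) (hLunit (sqV σ₀ σ₁)) =
      cubeV (hLunit σ₀) (hLunit σ₁) (by rw [bot_hLunit, top_hLunit])
  delta_hLunit {A B} (h : hor.Arr A B) :
    tcomp (tcomp (delta (hor.idArr A) h)
        (cubeH (tau A) (tid (sqVid h)) (by rw [right_tau, left_tid]))) (hLunit (sqVid h)) =
      cubeVid (hor.lunit h)
  chi_hRunit {A B C D E F h k l v₀ w₀ v₁ w₁} (σ₀ : @Sq A B C D h v₀ w₀ k)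
    (σ₁ : @Sq C D E F k v₁ w₁ l) :
    tcomp (tcomp (chi σ₀ (sqHid w₀) σ₁ (sqHid w₁))
        (cubeH (tid (sqV σ₀ σ₁)) (mu w₀ w₁) (by rw [right_tid, left_mu]))) (hRunit (sqV σ₀ σ₁)) =
      cubeV (hRunit σ₀) (hRunit σ₁) (by rw [bot_hRunit, top_hRunit])
  delta_hRunit {A B} (h : hor.Arr A B) :
    tcomp (tcomp (delta h (hor.idArr B))
        (cubeH (tid (sqVid h)) (tau B) (by rw [right_tid, left_tau]))) (hRunit (sqVid h)) =
      cubeVid (hor.runit h)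

attribute [instance] CubeFrame.trans

/-- A strict functor of weak double categories over a functor `F` between the categories of objects:
it preserves all compositions, identities and constraints on the nose.  Equations between cells
whose boundaries agree only propositionally are heterogeneous equalities. -/
structure WeakDouble.StrictFunctor {A A' : Type u} [Category.{w} A] [Category.{w} A']
    (W : WeakDouble.{u, v, w} A) (W' : WeakDouble.{u, v, w} A') (F : A ⥤ A') where
  arr {a b : A} : W.Arr a b → W'.Arr (F.obj a) (F.obj b)
  cell {a b a' b' : A} {f : W.Arr a b} {f' : W.Arr a' b'} : W.Cell f f' → W'.Cell (arr f) (arr f')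
  src_cell {a b a' b' : A} {f : W.Arr a b} {f' : W.Arr a' b'} (φ : W.Cell f f') :
    W'.src (cell φ) = F.map (W.src φ)
  tgt_cell {a b a' b' : A} {f : W.Arr a b} {f' : W.Arr a' b'} (φ : W.Cell f f') :
    W'.tgt (cell φ) = F.map (W.tgt φ)
  cell_tid {a b : A} (f : W.Arr a b) : cell (W.tid f) = W'.tid (arr f)
  cell_tcomp {a b a' b' a'' b'' : A} {f : W.Arr a b} {f' : W.Arr a' b'} {f'' : W.Arr a'' b''}
    (φ : W.Cell f f') (ψ : W.Cell f' f'') : cell (W.tcomp φ ψ) = W'.tcomp (cell φ) (cell ψ)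
  arr_idArr (a : A) : arr (W.idArr a) = W'.idArr (F.obj a)
  cell_idCell {a a' : A} (t : a ⟶ a') : HEq (cell (W.idCell t)) (W'.idCell (F.map t))
  arr_comp {a b c : A} (f : W.Arr a b) (g : W.Arr b c) :
    arr (W.comp f g) = W'.comp (arr f) (arr g)
  cell_compCell {a b c a' b' c' : A} {f : W.Arr a b} {g : W.Arr b c} {f' : W.Arr a' b'}
    {g' : W.Arr b' c'} (φ : W.Cell f f') (ψ : W.Cell g g') (e : W.tgt φ = W.src ψ) :
    HEq (cell (W.compCell φ ψ e))
      (W'.compCell (cell φ) (cell ψ) (by rw [tgt_cell, src_cell, e]))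
  cell_assoc {a b c d : A} (f : W.Arr a b) (g : W.Arr b c) (k : W.Arr c d) :
    HEq (cell (W.assoc f g k)) (W'.assoc (arr f) (arr g) (arr k))
  cell_lunit {a b : A} (f : W.Arr a b) : HEq (cell (W.lunit f)) (W'.lunit (arr f))
  cell_runit {a b : A} (f : W.Arr a b) : HEq (cell (W.runit f)) (W'.runit (arr f))

/-- A strict functor of intercategories: it preserves all compositions, identities, constraints and
interchangers on the nose. -/
structure Intercategory.StrictFunctor (I J : Intercategory.{u, v, w}) where
  obj : I.Obj ⥤ J.Obj
  hor : WeakDouble.StrictFunctor I.hor J.hor obj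
  ver : WeakDouble.StrictFunctor I.ver J.ver obj
  sq {A B C D h v w k} : @I.Sq A B C D h v w k → J.Sq (hor.arr h) (ver.arr v) (ver.arr w) (hor.arr k)
  cube {A B C D A' B' C' D' h v w k h' v' w' k'}
    {σ : @I.Sq A B C D h v w k} {σ' : @I.Sq A' B' C' D' h' v' w' k'} :
    I.Cube σ σ' → J.Cube (sq σ) (sq σ')
  top_cube {A B C D A' B' C' D' h v w k h' v' w' k'}
    {σ : @I.Sq A B C D h v w k} {σ' : @I.Sq A' B' C' D' h' v' w' k'} (c : I.Cube σ σ') :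
    J.top (cube c) = hor.cell (I.top c)
  left_cube {A B C D A' B' C' D' h v w k h' v' w' k'}
    {σ : @I.Sq A B C D h v w k} {σ' : @I.Sq A' B' C' D' h' v' w' k'} (c : I.Cube σ σ') :
    J.left (cube c) = ver.cell (I.left c)
  right_cube {A B C D A' B' C' D' h v w k h' v' w' k'}
    {σ : @I.Sq A B C D h v w k} {σ' : @I.Sq A' B' C' D' h' v' w' k'} (c : I.Cube σ σ') :
    J.right (cube c) = ver.cell (I.right c)
  bot_cube {A B C D A' B' C' D' h v w k h' v' w' k'}
    {σ : @I.Sq A B C D h v w k} {σ' : @I.Sq A' B' C' D' h' v' w' k'} (c : I.Cube σ σ') :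
    J.bot (cube c) = hor.cell (I.bot c)
  cube_tid {A B C D h v w k} (σ : @I.Sq A B C D h v w k) : cube (I.tid σ) = J.tid (sq σ)
  cube_tcomp {A B C D A' B' C' D' A'' B'' C'' D'' h v w k h' v' w' k' h'' v'' w'' k''}
    {σ : @I.Sq A B C D h v w k} {σ' : @I.Sq A' B' C' D' h' v' w' k'}
    {σ'' : @I.Sq A'' B'' C'' D'' h'' v'' w'' k''} (c : I.Cube σ σ') (d : I.Cube σ' σ'') :
    cube (I.tcomp c d) = J.tcomp (cube c) (cube d)
  sq_sqH {A B C D E F h₀ h₁ k₀ k₁ v w x}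
    (σ : @I.Sq A B D E h₀ v w k₀) (ρ : @I.Sq B C E F h₁ w x k₁) :
    HEq (sq (I.sqH σ ρ)) (J.sqH (sq σ) (sq ρ))
  sq_sqV {A B C D E F h k l v₀ v₁ w₀ w₁}
    (σ : @I.Sq A B C D h v₀ w₀ k) (ρ : @I.Sq C D E F k v₁ w₁ l) :
    HEq (sq (I.sqV σ ρ)) (J.sqV (sq σ) (sq ρ))
  sq_sqHid {A B} (v : I.ver.Arr A B) : HEq (sq (I.sqHid v)) (J.sqHid (ver.arr v))
  sq_sqVid {A B} (h : I.hor.Arr A B) : HEq (sq (I.sqVid h)) (J.sqVid (hor.arr h))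
  cube_cubeH {A B C D E F h₀ h₁ k₀ k₁ v w x A' B' C' D' E' F' h₀' h₁' k₀' k₁' v' w' x'}
    {σ : @I.Sq A B D E h₀ v w k₀} {ρ : @I.Sq B C E F h₁ w x k₁}
    {σ' : @I.Sq A' B' D' E' h₀' v' w' k₀'} {ρ' : @I.Sq B' C' E' F' h₁' w' x' k₁'}
    (c : I.Cube σ σ') (d : I.Cube ρ ρ') (e : I.right c = I.left d) :
    HEq (cube (I.cubeH c d e)) (J.cubeH (cube c) (cube d) (by rw [right_cube, left_cube, e]))
  cube_cubeV {A B C D E F h k l v₀ v₁ w₀ w₁ A' B' C' D' E' F' h' k' l' v₀' v₁' w₀' w₁'}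
    {σ : @I.Sq A B C D h v₀ w₀ k} {ρ : @I.Sq C D E F k v₁ w₁ l}
    {σ' : @I.Sq A' B' C' D' h' v₀' w₀' k'} {ρ' : @I.Sq C' D' E' F' k' v₁' w₁' l'}
    (c : I.Cube σ σ') (d : I.Cube ρ ρ') (e : I.bot c = I.top d) :
    HEq (cube (I.cubeV c d e)) (J.cubeV (cube c) (cube d) (by rw [bot_cube, top_cube, e]))
  cube_cubeHid {A B A' B'} {v : I.ver.Arr A B} {v' : I.ver.Arr A' B'} (φ : I.ver.Cell v v') :
    HEq (cube (I.cubeHid φ)) (J.cubeHid (ver.cell φ))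
  cube_cubeVid {A B A' B'} {h : I.hor.Arr A B} {h' : I.hor.Arr A' B'} (φ : I.hor.Cell h h') :
    HEq (cube (I.cubeVid φ)) (J.cubeVid (hor.cell φ))
  cube_hAssoc {A B C D E F G H h₀ h₁ h₂ k₀ k₁ k₂ v w x y} (σ : @I.Sq A B E F h₀ v w k₀)
    (ρ : @I.Sq B C F G h₁ w x k₁) (π : @I.Sq C D G H h₂ x y k₂) :
    HEq (cube (I.hAssoc σ ρ π)) (J.hAssoc (sq σ) (sq ρ) (sq π))
  cube_hLunit {A B C D h v w k} (σ : @I.Sq A B C D h v w k) :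
    HEq (cube (I.hLunit σ)) (J.hLunit (sq σ))
  cube_hRunit {A B C D h v w k} (σ : @I.Sq A B C D h v w k) :
    HEq (cube (I.hRunit σ)) (J.hRunit (sq σ))
  cube_vAssoc {A B C D E F G H h k l n v₀ v₁ v₂ w₀ w₁ w₂} (σ : @I.Sq A B C D h v₀ w₀ k)
    (ρ : @I.Sq C D E F k v₁ w₁ l) (π : @I.Sq E F G H l v₂ w₂ n) :
    HEq (cube (I.vAssoc σ ρ π)) (J.vAssoc (sq σ) (sq ρ) (sq π))
  cube_vLunit {A B C D h v w k} (σ : @I.Sq A B C D h v w k) :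
    HEq (cube (I.vLunit σ)) (J.vLunit (sq σ))
  cube_vRunit {A B C D h v w k} (σ : @I.Sq A B C D h v w k) :
    HEq (cube (I.vRunit σ)) (J.vRunit (sq σ))
  cube_chi {A B C D E F G H K h₀ h₁ k₀ k₁ l₀ l₁ v₀ v₁ w₀ w₁ x₀ x₁}
    (σ₀ : @I.Sq A B D E h₀ v₀ w₀ k₀) (ρ₀ : @I.Sq B C E F h₁ w₀ x₀ k₁)
    (σ₁ : @I.Sq D E G H k₀ v₁ w₁ l₀) (ρ₁ : @I.Sq E F H K k₁ w₁ x₁ l₁) :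
    HEq (cube (I.chi σ₀ ρ₀ σ₁ ρ₁)) (J.chi (sq σ₀) (sq ρ₀) (sq σ₁) (sq ρ₁))
  cube_mu {A B C} (v : I.ver.Arr A B) (w : I.ver.Arr B C) :
    HEq (cube (I.mu v w)) (J.mu (ver.arr v) (ver.arr w))
  cube_delta {A B C} (h : I.hor.Arr A B) (k : I.hor.Arr B C) :
    HEq (cube (I.delta h k)) (J.delta (hor.arr h) (hor.arr k))
  cube_tau (A : I.Obj) : HEq (cube (I.tau A)) (J.tau (obj.obj A))

namespace WeakDouble

variable {A A' A'' : Type u} [Category.{w} A] [Category.{w} A'] [Category.{w} A'']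
  {W : WeakDouble.{u, v, w} A} {W' : WeakDouble.{u, v, w} A'} {W'' : WeakDouble.{u, v, w} A''}

theorem StrictFunctor.heq_cell {F : A ⥤ A'} (P : StrictFunctor W W' F) {a b c d : A}
    {f f₁ : W.Arr a b} {g g₁ : W.Arr c d} {φ : W.Cell f g} {ψ : W.Cell f₁ g₁}
    (hf : f = f₁) (hg : g = g₁) (h : HEq φ ψ) : HEq (P.cell φ) (P.cell ψ) := by
  subst hf hg; cases h; rfl

def StrictFunctor.id (W : WeakDouble.{u, v, w} A) : StrictFunctor W W (𝟭 A) where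
  arr f := f
  cell φ := φ
  src_cell _ := rfl
  tgt_cell _ := rfl
  cell_tid _ := rfl
  cell_tcomp _ _ := rfl
  arr_idArr _ := rfl
  cell_idCell _ := HEq.rfl
  arr_comp _ _ := rfl
  cell_compCell _ _ _ := HEq.rfl
  cell_assoc _ _ _ := HEq.rfl
  cell_lunit _ := HEq.rfl
  cell_runit _ := HEq.rfl

def StrictFunctor.comp {F : A ⥤ A'} {G : A' ⥤ A''} (P : StrictFunctor W W' F)
    (Q : StrictFunctor W' W'' G) : StrictFunctor W W'' (F ⋙ G) where
  arr f := Q.arr (P.arr f)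
  cell φ := Q.cell (P.cell φ)
  src_cell φ := by rw [Q.src_cell, P.src_cell]; rfl
  tgt_cell φ := by rw [Q.tgt_cell, P.tgt_cell]; rfl
  cell_tid f := by rw [P.cell_tid, Q.cell_tid]
  cell_tcomp φ ψ := by rw [P.cell_tcomp, Q.cell_tcomp]
  arr_idArr a := by rw [P.arr_idArr, Q.arr_idArr]; rfl
  cell_idCell t :=
    (Q.heq_cell (P.arr_idArr _) (P.arr_idArr _) (P.cell_idCell t)).trans (Q.cell_idCell _)
  arr_comp f g := by rw [P.arr_comp, Q.arr_comp]
  cell_compCell φ ψ e :=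
    (Q.heq_cell (P.arr_comp _ _) (P.arr_comp _ _) (P.cell_compCell φ ψ e)).trans
      (Q.cell_compCell _ _ _)
  cell_assoc f g k :=
    (Q.heq_cell (by simp only [P.arr_comp]) (by simp only [P.arr_comp]) (P.cell_assoc f g k)).trans
      (Q.cell_assoc _ _ _)
  cell_lunit f :=
    (Q.heq_cell (by simp only [P.arr_comp, P.arr_idArr]) rfl (P.cell_lunit f)).trans
      (Q.cell_lunit _)
  cell_runit f :=
    (Q.heq_cell (by simp only [P.arr_comp, P.arr_idArr]) rfl (P.cell_runit f)).trans
      (Q.cell_runit _)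

end WeakDouble

namespace Intercategory

theorem StrictFunctor.heq_sq {I J : Intercategory.{u, v, w}} (P : StrictFunctor I J) {A B C D : I.Obj}
    {h h₁ : I.hor.Arr A B} {v v₁ : I.ver.Arr A C} {w w₁ : I.ver.Arr B D} {k k₁ : I.hor.Arr C D}
    {σ : I.Sq h v w k} {σ₁ : I.Sq h₁ v₁ w₁ k₁}
    (eh : h = h₁) (ev : v = v₁) (ew : w = w₁) (ek : k = k₁) (e : HEq σ σ₁) :
    HEq (P.sq σ) (P.sq σ₁) := by
  subst eh ev ew ek; cases e; rfl

theorem StrictFunctor.heq_cube {I J : Intercategory.{u, v, w}} (P : StrictFunctor I J)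
    {A B C D A' B' C' D' : I.Obj}
    {h h₁ : I.hor.Arr A B} {v v₁ : I.ver.Arr A C} {w w₁ : I.ver.Arr B D} {k k₁ : I.hor.Arr C D}
    {h' h₁' : I.hor.Arr A' B'} {v' v₁' : I.ver.Arr A' C'} {w' w₁' : I.ver.Arr B' D'}
    {k' k₁' : I.hor.Arr C' D'}
    {σ : I.Sq h v w k} {σ₁ : I.Sq h₁ v₁ w₁ k₁} {σ' : I.Sq h' v' w' k'} {σ₁' : I.Sq h₁' v₁' w₁' k₁'}
    {c : I.Cube σ σ'} {c₁ : I.Cube σ₁ σ₁'}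
    (e : h = h₁ ∧ v = v₁ ∧ w = w₁ ∧ k = k₁) (es : HEq σ σ₁)
    (e' : h' = h₁' ∧ v' = v₁' ∧ w' = w₁' ∧ k' = k₁') (es' : HEq σ' σ₁') (ec : HEq c c₁) :
    HEq (P.cube c) (P.cube c₁) := by
  obtain ⟨rfl, rfl, rfl, rfl⟩ := e
  obtain ⟨rfl, rfl, rfl, rfl⟩ := e'
  cases es; cases es'; cases ec; rfl

theorem heq_sqH (J : Intercategory.{u, v, w}) {A B C D E F : J.Obj}
    {h h' : J.hor.Arr A B} {l l' : J.hor.Arr B C} {k k' : J.hor.Arr D E} {n n' : J.hor.Arr E F}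
    {v v' : J.ver.Arr A D} {w w' : J.ver.Arr B E} {x x' : J.ver.Arr C F}
    {σ : J.Sq h v w k} {ρ : J.Sq l w x n} {σ' : J.Sq h' v' w' k'} {ρ' : J.Sq l' w' x' n'}
    (e : h = h' ∧ l = l' ∧ k = k' ∧ n = n' ∧ v = v' ∧ w = w' ∧ x = x')
    (es : HEq σ σ') (er : HEq ρ ρ') : HEq (J.sqH σ ρ) (J.sqH σ' ρ') := by
  obtain ⟨rfl, rfl, rfl, rfl, rfl, rfl, rfl⟩ := e
  cases es; cases er; rfl

theorem heq_sqV (J : Intercategory.{u, v, w}) {A B C D E F : J.Obj}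
    {h h' : J.hor.Arr A B} {k k' : J.hor.Arr C D} {l l' : J.hor.Arr E F}
    {v v' : J.ver.Arr A C} {w w' : J.ver.Arr B D} {x x' : J.ver.Arr C E} {y y' : J.ver.Arr D F}
    {σ : J.Sq h v w k} {ρ : J.Sq k x y l} {σ' : J.Sq h' v' w' k'} {ρ' : J.Sq k' x' y' l'}
    (e : h = h' ∧ k = k' ∧ l = l' ∧ v = v' ∧ w = w' ∧ x = x' ∧ y = y')
    (es : HEq σ σ') (er : HEq ρ ρ') : HEq (J.sqV σ ρ) (J.sqV σ' ρ') := by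
  obtain ⟨rfl, rfl, rfl, rfl, rfl, rfl, rfl⟩ := e
  cases es; cases er; rfl

theorem heq_sqHid (J : Intercategory.{u, v, w}) {A B : J.Obj} {v v' : J.ver.Arr A B}
    (e : v = v') : HEq (J.sqHid v) (J.sqHid v') := by
  subst e; rfl

theorem heq_sqVid (J : Intercategory.{u, v, w}) {A B : J.Obj} {h h' : J.hor.Arr A B}
    (e : h = h') : HEq (J.sqVid h) (J.sqVid h') := by
  subst e; rfl

def StrictFunctor.id (I : Intercategory.{u, v, w}) : StrictFunctor I I where
  obj := 𝟭 _
  hor := .id _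
  ver := .id _
  sq σ := σ
  cube c := c
  top_cube _ := rfl
  left_cube _ := rfl
  right_cube _ := rfl
  bot_cube _ := rfl
  cube_tid _ := rfl
  cube_tcomp _ _ := rfl
  sq_sqH _ _ := HEq.rfl
  sq_sqV _ _ := HEq.rfl
  sq_sqHid _ := HEq.rfl
  sq_sqVid _ := HEq.rfl
  cube_cubeH _ _ _ := HEq.rfl
  cube_cubeV _ _ _ := HEq.rfl
  cube_cubeHid _ := HEq.rfl
  cube_cubeVid _ := HEq.rfl
  cube_hAssoc _ _ _ := HEq.rfl
  cube_hLunit _ := HEq.rfl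
  cube_hRunit _ := HEq.rfl
  cube_vAssoc _ _ _ := HEq.rfl
  cube_vLunit _ := HEq.rfl
  cube_vRunit _ := HEq.rfl
  cube_chi _ _ _ _ := HEq.rfl
  cube_mu _ _ := HEq.rfl
  cube_delta _ _ := HEq.rfl
  cube_tau _ := HEq.rfl

section
variable {I J K : Intercategory.{u, v, w}} (P : StrictFunctor I J) (Q : StrictFunctor J K)

def StrictFunctor.comp : StrictFunctor I K where
  obj := P.obj ⋙ Q.obj
  hor := P.hor.comp Q.hor
  ver := P.ver.comp Q.ver
  sq σ := Q.sq (P.sq σ)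
  cube c := Q.cube (P.cube c)
  top_cube c := (Q.top_cube _).trans (congrArg Q.hor.cell (P.top_cube c))
  left_cube c := (Q.left_cube _).trans (congrArg Q.ver.cell (P.left_cube c))
  right_cube c := (Q.right_cube _).trans (congrArg Q.ver.cell (P.right_cube c))
  bot_cube c := (Q.bot_cube _).trans (congrArg Q.hor.cell (P.bot_cube c))
  cube_tid σ := (congrArg Q.cube (P.cube_tid σ)).trans (Q.cube_tid _)
  cube_tcomp c d := (congrArg Q.cube (P.cube_tcomp c d)).trans (Q.cube_tcomp _ _)
  sq_sqH σ ρ := (Q.heq_sq (P.hor.arr_comp _ _) rfl rfl (P.hor.arr_comp _ _) (P.sq_sqH σ ρ)).trans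
    (Q.sq_sqH _ _)
  sq_sqV σ ρ := (Q.heq_sq rfl (P.ver.arr_comp _ _) (P.ver.arr_comp _ _) rfl (P.sq_sqV σ ρ)).trans
    (Q.sq_sqV _ _)
  sq_sqHid v := (Q.heq_sq (P.hor.arr_idArr _) rfl rfl (P.hor.arr_idArr _) (P.sq_sqHid v)).trans
    (Q.sq_sqHid _)
  sq_sqVid h := (Q.heq_sq rfl (P.ver.arr_idArr _) (P.ver.arr_idArr _) rfl (P.sq_sqVid h)).trans
    (Q.sq_sqVid _)
  cube_cubeH c d e := (Q.heq_cube (by simp [P.hor.arr_comp]) (P.sq_sqH _ _)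
    (by simp [P.hor.arr_comp]) (P.sq_sqH _ _) (P.cube_cubeH c d e)).trans (Q.cube_cubeH _ _ _)
  cube_cubeV c d e := (Q.heq_cube (by simp [P.ver.arr_comp]) (P.sq_sqV _ _)
    (by simp [P.ver.arr_comp]) (P.sq_sqV _ _) (P.cube_cubeV c d e)).trans (Q.cube_cubeV _ _ _)
  cube_cubeHid φ := (Q.heq_cube (by simp [P.hor.arr_idArr]) (P.sq_sqHid _)
    (by simp [P.hor.arr_idArr]) (P.sq_sqHid _) (P.cube_cubeHid φ)).trans (Q.cube_cubeHid _)
  cube_cubeVid φ := (Q.heq_cube (by simp [P.ver.arr_idArr]) (P.sq_sqVid _)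
    (by simp [P.ver.arr_idArr]) (P.sq_sqVid _) (P.cube_cubeVid φ)).trans (Q.cube_cubeVid _)
  cube_hAssoc σ ρ π := (Q.heq_cube (by simp [P.hor.arr_comp])
    ((P.sq_sqH _ _).trans (J.heq_sqH (by simp [P.hor.arr_comp]) (P.sq_sqH _ _) HEq.rfl))
    (by simp [P.hor.arr_comp])
    ((P.sq_sqH _ _).trans (J.heq_sqH (by simp [P.hor.arr_comp]) HEq.rfl (P.sq_sqH _ _)))
    (P.cube_hAssoc σ ρ π)).trans (Q.cube_hAssoc _ _ _)
  cube_hLunit σ := (Q.heq_cube (by simp [P.hor.arr_comp, P.hor.arr_idArr])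
    ((P.sq_sqH _ _).trans (J.heq_sqH (by simp [P.hor.arr_idArr]) (P.sq_sqHid _) HEq.rfl))
    (by simp) HEq.rfl (P.cube_hLunit σ)).trans (Q.cube_hLunit _)
  cube_hRunit σ := (Q.heq_cube (by simp [P.hor.arr_comp, P.hor.arr_idArr])
    ((P.sq_sqH _ _).trans (J.heq_sqH (by simp [P.hor.arr_idArr]) HEq.rfl (P.sq_sqHid _)))
    (by simp) HEq.rfl (P.cube_hRunit σ)).trans (Q.cube_hRunit _)
  cube_vAssoc σ ρ π := (Q.heq_cube (by simp [P.ver.arr_comp])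
    ((P.sq_sqV _ _).trans (J.heq_sqV (by simp [P.ver.arr_comp]) (P.sq_sqV _ _) HEq.rfl))
    (by simp [P.ver.arr_comp])
    ((P.sq_sqV _ _).trans (J.heq_sqV (by simp [P.ver.arr_comp]) HEq.rfl (P.sq_sqV _ _)))
    (P.cube_vAssoc σ ρ π)).trans (Q.cube_vAssoc _ _ _)
  cube_vLunit σ := (Q.heq_cube (by simp [P.ver.arr_comp, P.ver.arr_idArr])
    ((P.sq_sqV _ _).trans (J.heq_sqV (by simp [P.ver.arr_idArr]) (P.sq_sqVid _) HEq.rfl))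
    (by simp) HEq.rfl (P.cube_vLunit σ)).trans (Q.cube_vLunit _)
  cube_vRunit σ := (Q.heq_cube (by simp [P.ver.arr_comp, P.ver.arr_idArr])
    ((P.sq_sqV _ _).trans (J.heq_sqV (by simp [P.ver.arr_idArr]) HEq.rfl (P.sq_sqVid _)))
    (by simp) HEq.rfl (P.cube_vRunit σ)).trans (Q.cube_vRunit _)
  cube_chi σ₀ ρ₀ σ₁ ρ₁ := (Q.heq_cube (by simp [P.ver.arr_comp, P.hor.arr_comp])
    ((P.sq_sqV _ _).trans
      (J.heq_sqV (by simp [P.hor.arr_comp]) (P.sq_sqH _ _) (P.sq_sqH _ _)))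
    (by simp [P.ver.arr_comp, P.hor.arr_comp])
    ((P.sq_sqH _ _).trans
      (J.heq_sqH (by simp [P.ver.arr_comp]) (P.sq_sqV _ _) (P.sq_sqV _ _)))
    (P.cube_chi σ₀ ρ₀ σ₁ ρ₁)).trans (Q.cube_chi _ _ _ _)
  cube_mu v w := (Q.heq_cube (by simp [P.ver.arr_comp, P.hor.arr_idArr])
    ((P.sq_sqV _ _).trans
      (J.heq_sqV (by simp [P.hor.arr_idArr]) (P.sq_sqHid _) (P.sq_sqHid _)))
    (by simp [P.ver.arr_comp, P.hor.arr_idArr])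
    ((P.sq_sqHid _).trans (J.heq_sqHid (P.ver.arr_comp _ _)))
    (P.cube_mu v w)).trans (Q.cube_mu _ _)
  cube_delta h k := (Q.heq_cube (by simp [P.hor.arr_comp, P.ver.arr_idArr])
    ((P.sq_sqVid _).trans (J.heq_sqVid (P.hor.arr_comp _ _)))
    (by simp [P.hor.arr_comp, P.ver.arr_idArr])
    ((P.sq_sqH _ _).trans
      (J.heq_sqH (by simp [P.ver.arr_idArr]) (P.sq_sqVid _) (P.sq_sqVid _)))
    (P.cube_delta h k)).trans (Q.cube_delta _ _)
  cube_tau A := (Q.heq_cube (by simp [P.hor.arr_idArr, P.ver.arr_idArr])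
    ((P.sq_sqVid _).trans (J.heq_sqVid (P.hor.arr_idArr _)))
    (by simp [P.hor.arr_idArr, P.ver.arr_idArr])
    ((P.sq_sqHid _).trans (J.heq_sqHid (P.ver.arr_idArr _)))
    (P.cube_tau A)).trans (Q.cube_tau _)

end

/-- The category of intercategories and strict functors. -/
instance : Category Intercategory.{u, v, w} where
  Hom := StrictFunctor
  id := StrictFunctor.id
  comp P Q := P.comp Q

end Intercategory

/-! ### The condition `(*)` -/

/-- A span of functors `P : E ⥤ B`, `Q : E ⥤ C` is a discrete bifibration (two-sided discrete
fibration), contravariant in `B` and covariant in `C`: arrows of `B` into `P e` lift uniquely to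
arrows into `e` over an identity of `C`, arrows of `C` out of `Q e` lift uniquely to arrows out of
`e` over an identity of `B`, and every arrow of `E` is the composite of one of the second kind
followed by one of the first kind. -/
structure IsDiscreteBifibration {E B C : Type*} [Category* E] [Category* B] [Category* C]
    (P : E ⥤ B) (Q : E ⥤ C) : Prop where
  lift_left (e : E) {b : B} (f : b ⟶ P.obj e) :
    ∃! g : (Σ e' : E, e' ⟶ e), P.IsHomLift f g.2 ∧ Q.IsHomLift (𝟙 (Q.obj e)) g.2
  lift_right (e : E) {c : C} (f : Q.obj e ⟶ c) :
    ∃! g : (Σ e' : E, e ⟶ e'), Q.IsHomLift f g.2 ∧ P.IsHomLift (𝟙 (P.obj e)) g.2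
  factor {e e' : E} (g : e ⟶ e') : ∃ (m : E) (l : e ⟶ m) (r : m ⟶ e'),
    P.IsHomLift (𝟙 (P.obj e)) l ∧ Q.IsHomLift (𝟙 (Q.obj e')) r ∧ l ≫ r = g

/-- The arrows of the weak direction, as objects of the category whose morphisms are the cells. -/
structure WeakDouble.ArrObj {A : Type u} [Category.{w} A] (W : WeakDouble.{u, v, w} A) where
  {s t : A}
  arr : W.Arr s t

instance {A : Type u} [Category.{w} A] (W : WeakDouble.{u, v, w} A) : Category W.ArrObj where
  Hom f g := W.Cell f.arr g.arr
  id f := W.tid f.arr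
  comp φ ψ := W.tcomp φ ψ
  id_comp _ := W.tid_tcomp _
  comp_id _ := W.tcomp_tid _
  assoc _ _ _ := W.tcomp_assoc _ _ _

namespace Intercategory

/-- The basic cells, as objects of the category **S** whose morphisms are the cubes. -/
structure SqObj (I : Intercategory.{u, v, w}) where
  {A B C D : I.Obj}
  {h : I.hor.Arr A B}
  {v : I.ver.Arr A C}
  {w : I.ver.Arr B D}
  {k : I.hor.Arr C D}
  sq : I.Sq h v w k

instance (I : Intercategory.{u, v, w}) : Category I.SqObj where
  Hom σ τ := I.Cube σ.sq τ.sq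
  id σ := I.tid σ.sq
  comp c d := I.tcomp c d
  id_comp _ := I.tid_tcomp _
  comp_id _ := I.tcomp_tid _
  assoc _ _ _ := I.tcomp_assoc _ _ _

/-- The functor `(∂₀, ∂₀) : S ⥤ V × H`, left side and top. -/
def boundary₀ (I : Intercategory.{u, v, w}) : I.SqObj ⥤ I.ver.ArrObj × I.hor.ArrObj where
  obj σ := (⟨σ.v⟩, ⟨σ.h⟩)
  map c := (I.left c, I.top c)
  map_id _ := Prod.ext (I.left_tid _) (I.top_tid _)
  map_comp _ _ := Prod.ext (I.left_tcomp _ _) (I.top_tcomp _ _)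

/-- The functor `(∂₁, ∂₁) : S ⥤ V × H`, right side and bottom. -/
def boundary₁ (I : Intercategory.{u, v, w}) : I.SqObj ⥤ I.ver.ArrObj × I.hor.ArrObj where
  obj σ := (⟨σ.w⟩, ⟨σ.k⟩)
  map c := (I.right c, I.bot c)
  map_id _ := Prod.ext (I.right_tid _) (I.bot_tid _)
  map_comp _ _ := Prod.ext (I.right_tcomp _ _) (I.bot_tcomp _ _)

/-- The condition `(*)`. -/
def Star (I : Intercategory.{u, v, w}) : Prop :=
  IsDiscreteBifibration I.boundary₀ I.boundary₁

/-- All transversal arrows are identities. -/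
def TransversalIdentities (I : Intercategory.{u, v, w}) : Prop :=
  IsDiscrete I.Obj

/-- All interchangers are identities: their domains and codomains are equal basic cells and the
cubes themselves are transversal identities. -/
def InterchangersIdentities (I : Intercategory.{u, v, w}) : Prop :=
  (∀ {A B C D E F G H K h₀ h₁ k₀ k₁ l₀ l₁ v₀ v₁ w₀ w₁ x₀ x₁}
    (σ₀ : @I.Sq A B D E h₀ v₀ w₀ k₀) (ρ₀ : @I.Sq B C E F h₁ w₀ x₀ k₁)
    (σ₁ : @I.Sq D E G H k₀ v₁ w₁ l₀) (ρ₁ : @I.Sq E F H K k₁ w₁ x₁ l₁),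
    I.sqV (I.sqH σ₀ ρ₀) (I.sqH σ₁ ρ₁) = I.sqH (I.sqV σ₀ σ₁) (I.sqV ρ₀ ρ₁) ∧
      HEq (I.chi σ₀ ρ₀ σ₁ ρ₁) (I.tid (I.sqV (I.sqH σ₀ ρ₀) (I.sqH σ₁ ρ₁)))) ∧
  (∀ {A B C} (v : I.ver.Arr A B) (w : I.ver.Arr B C),
    I.sqV (I.sqHid v) (I.sqHid w) = I.sqHid (I.ver.comp v w) ∧
      HEq (I.mu v w) (I.tid (I.sqV (I.sqHid v) (I.sqHid w)))) ∧
  (∀ {A B C} (h : I.hor.Arr A B) (k : I.hor.Arr B C),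
    I.sqVid (I.hor.comp h k) = I.sqH (I.sqVid h) (I.sqVid k) ∧
      HEq (I.delta h k) (I.tid (I.sqVid (I.hor.comp h k)))) ∧
  ∀ A : I.Obj, I.sqVid (I.hor.idArr A) = I.sqHid (I.ver.idArr A) ∧
    HEq (I.tau A) (I.tid (I.sqVid (I.hor.idArr A)))

end Intercategory

/-- The objects of the category of intercategories in which all transversal arrows are identities
and `(*)` holds. -/
def starProperty : ObjectProperty Intercategory.{u, v, w} :=
  fun I => I.TransversalIdentities ∧ I.Star

/-! ### Verity double bicategories -/

/-- The objects of a bicategory given as a term. -/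
def Carrier {X : Type u} (_ : Bicategory.{w, v} X) : Type u := X

instance {X : Type u} (B : Bicategory.{w, v} X) : Bicategory.{w, v} (Carrier B) := B

/-- An object, regarded as an object of the bicategory `B`. -/
def Carrier.of {X : Type u} (B : Bicategory.{w, v} X) (a : X) : Carrier B := a

/-- The arrows of a bicategory given as a term. -/
abbrev BArr {X : Type u} (B : Bicategory.{w, v} X) (a b : X) : Type v :=
  Carrier.of B a ⟶ Carrier.of B b

/-- The identity arrows of a bicategory given as a term. -/
abbrev bid {X : Type u} (B : Bicategory.{w, v} X) (a : X) : BArr B a a :=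
  𝟙 (Carrier.of B a)

open Bicategory

/-- A Verity double bicategory: two bicategories `hor`, `ver` with the same objects, a class of
squares (`Sq h v w k` has top `h`, left side `v`, right side `w` and bottom `k`), actions of the
2-cells of `hor` on the top and bottom and of those of `ver` on the left and right of squares, and
horizontal and vertical pasting and identities of squares, the pasting being associative and unitary
modulo the constraints of the two bicategories, and the interchange law holding strictly. -/
structure DoubleBicategory where
  Obj : Type u
  hor : Bicategory.{w, v} Obj
  ver : Bicategory.{w, v} Obj
  Sq {a b c d : Obj} : BArr hor a b → BArr ver a c → BArr ver b d → BArr hor c d → Type v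
  -- the four actions
  actT {a b c d h h' v w k} : (h' ⟶ h) → @Sq a b c d h v w k → Sq h' v w k
  actL {a b c d h v v' w k} : (v' ⟶ v) → @Sq a b c d h v w k → Sq h v' w k
  actR {a b c d h v w w' k} : @Sq a b c d h v w k → (w ⟶ w') → Sq h v w' k
  actB {a b c d h v w k k'} : @Sq a b c d h v w k → (k ⟶ k') → Sq h v w k'
  actT_id {a b c d h v w k} (σ : @Sq a b c d h v w k) : actT (𝟙 h) σ = σ
  actL_id {a b c d h v w k} (σ : @Sq a b c d h v w k) : actL (𝟙 v) σ = σ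
  actR_id {a b c d h v w k} (σ : @Sq a b c d h v w k) : actR σ (𝟙 w) = σ
  actB_id {a b c d h v w k} (σ : @Sq a b c d h v w k) : actB σ (𝟙 k) = σ
  actT_comp {a b c d h h' h'' v w k} (α' : h'' ⟶ h') (α : h' ⟶ h) (σ : @Sq a b c d h v w k) :
    actT (α' ≫ α) σ = actT α' (actT α σ)
  actL_comp {a b c d h v v' v'' w k} (β' : v'' ⟶ v') (β : v' ⟶ v) (σ : @Sq a b c d h v w k) :
    actL (β' ≫ β) σ = actL β' (actL β σ)
  actR_comp {a b c d h v w w' w'' k} (σ : @Sq a b c d h v w k) (β : w ⟶ w') (β' : w' ⟶ w'') :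
    actR σ (β ≫ β') = actR (actR σ β) β'
  actB_comp {a b c d h v w k k' k''} (σ : @Sq a b c d h v w k) (α : k ⟶ k') (α' : k' ⟶ k'') :
    actB σ (α ≫ α') = actB (actB σ α) α'
  actT_actL {a b c d h h' v v' w k} (α : h' ⟶ h) (β : v' ⟶ v) (σ : @Sq a b c d h v w k) :
    actT α (actL β σ) = actL β (actT α σ)
  actT_actR {a b c d h h' v w w' k} (α : h' ⟶ h) (σ : @Sq a b c d h v w k) (β : w ⟶ w') :
    actT α (actR σ β) = actR (actT α σ) β
  actT_actB {a b c d h h' v w k k'} (α : h' ⟶ h) (σ : @Sq a b c d h v w k) (γ : k ⟶ k') :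
    actT α (actB σ γ) = actB (actT α σ) γ
  actL_actR {a b c d h v v' w w' k} (β : v' ⟶ v) (σ : @Sq a b c d h v w k) (γ : w ⟶ w') :
    actL β (actR σ γ) = actR (actL β σ) γ
  actL_actB {a b c d h v v' w k k'} (β : v' ⟶ v) (σ : @Sq a b c d h v w k) (α : k ⟶ k') :
    actL β (actB σ α) = actB (actL β σ) α
  actR_actB {a b c d h v w w' k k'} (σ : @Sq a b c d h v w k) (β : w ⟶ w') (α : k ⟶ k') :
    actB (actR σ β) α = actR (actB σ α) β
  -- horizontal pasting
  hc {a b c d e f h h' k k' v w x} :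
    @Sq a b d e h v w k → @Sq b c e f h' w x k' → Sq (h ≫ h') v x (k ≫ k')
  hc_actL {a b c d e f h h' k k' v v' w x} (β : v' ⟶ v) (σ : @Sq a b d e h v w k)
    (ρ : @Sq b c e f h' w x k') : hc (actL β σ) ρ = actL β (hc σ ρ)
  hc_actR {a b c d e f h h' k k' v w x x'} (σ : @Sq a b d e h v w k)
    (ρ : @Sq b c e f h' w x k') (β : x ⟶ x') : hc σ (actR ρ β) = actR (hc σ ρ) β
  hc_mid {a b c d e f h h' k k' v w w' x} (σ : @Sq a b d e h v w k) (β : w ⟶ w')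
    (ρ : @Sq b c e f h' w' x k') : hc (actR σ β) ρ = hc σ (actL β ρ)
  hc_actT_left {a b c d e f h₁ h h' k k' v w x} (α : h₁ ⟶ h) (σ : @Sq a b d e h v w k)
    (ρ : @Sq b c e f h' w x k') : hc (actT α σ) ρ = actT (α ▷ h') (hc σ ρ)
  hc_actT_right {a b c d e f h h₁ h' k k' v w x} (σ : @Sq a b d e h v w k) (α : h₁ ⟶ h')
    (ρ : @Sq b c e f h' w x k') : hc σ (actT α ρ) = actT (h ◁ α) (hc σ ρ)
  hc_actB_left {a b c d e f h h' k k₁ k' v w x} (σ : @Sq a b d e h v w k) (α : k ⟶ k₁)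
    (ρ : @Sq b c e f h' w x k') : hc (actB σ α) ρ = actB (hc σ ρ) (α ▷ k')
  hc_actB_right {a b c d e f h h' k k' k₁ v w x} (σ : @Sq a b d e h v w k)
    (ρ : @Sq b c e f h' w x k') (α : k' ⟶ k₁) : hc σ (actB ρ α) = actB (hc σ ρ) (k ◁ α)
  hc_assoc {a b c d a' b' c' d' h₁ h₂ h₃ k₁ k₂ k₃ v w x y} (σ : @Sq a b a' b' h₁ v w k₁)
    (ρ : @Sq b c b' c' h₂ w x k₂) (π : @Sq c d c' d' h₃ x y k₃) :
    actB (hc (hc σ ρ) π) (α_ k₁ k₂ k₃).hom = actT (α_ h₁ h₂ h₃).hom (hc σ (hc ρ π))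
  -- horizontal identities
  hi {a b} (v : BArr ver a b) : Sq (bid hor a) v v (bid hor b)
  hi_nat {a b} {v v' : BArr ver a b} (β : v ⟶ v') : actR (hi v) β = actL β (hi v')
  hc_hi_left {a b c d h v w k} (σ : @Sq a b c d h v w k) :
    actB (hc (hi v) σ) (λ_ k).hom = actT (λ_ h).hom σ
  hc_hi_right {a b c d h v w k} (σ : @Sq a b c d h v w k) :
    actB (hc σ (hi w)) (ρ_ k).hom = actT (ρ_ h).hom σ
  -- vertical pasting
  vc {a b c d e f h k l v v' w w'} :
    @Sq a b c d h v w k → @Sq c d e f k v' w' l → Sq h (v ≫ v') (w ≫ w') l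
  vc_actT {a b c d e f h h' k l v v' w w'} (α : h' ⟶ h) (σ : @Sq a b c d h v w k)
    (ρ : @Sq c d e f k v' w' l) : vc (actT α σ) ρ = actT α (vc σ ρ)
  vc_actB {a b c d e f h k l l' v v' w w'} (σ : @Sq a b c d h v w k)
    (ρ : @Sq c d e f k v' w' l) (α : l ⟶ l') : vc σ (actB ρ α) = actB (vc σ ρ) α
  vc_mid {a b c d e f h k k' l v v' w w'} (σ : @Sq a b c d h v w k) (α : k ⟶ k')
    (ρ : @Sq c d e f k' v' w' l) : vc (actB σ α) ρ = vc σ (actT α ρ)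
  vc_actL_top {a b c d e f h k l v₁ v v' w w'} (β : v₁ ⟶ v) (σ : @Sq a b c d h v w k)
    (ρ : @Sq c d e f k v' w' l) : vc (actL β σ) ρ = actL (β ▷ v') (vc σ ρ)
  vc_actL_bot {a b c d e f h k l v v₁ v' w w'} (σ : @Sq a b c d h v w k) (β : v₁ ⟶ v')
    (ρ : @Sq c d e f k v' w' l) : vc σ (actL β ρ) = actL (v ◁ β) (vc σ ρ)
  vc_actR_top {a b c d e f h k l v v' w w₁ w'} (σ : @Sq a b c d h v w k) (β : w ⟶ w₁)
    (ρ : @Sq c d e f k v' w' l) : vc (actR σ β) ρ = actR (vc σ ρ) (β ▷ w')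
  vc_actR_bot {a b c d e f h k l v v' w w' w₁} (σ : @Sq a b c d h v w k)
    (ρ : @Sq c d e f k v' w' l) (β : w' ⟶ w₁) : vc σ (actR ρ β) = actR (vc σ ρ) (w ◁ β)
  vc_assoc {a b c d a' b' c' d' h k l n v₁ v₂ v₃ w₁ w₂ w₃} (σ : @Sq a a' b b' h v₁ w₁ k)
    (ρ : @Sq b b' c c' k v₂ w₂ l) (π : @Sq c c' d d' l v₃ w₃ n) :
    actR (vc (vc σ ρ) π) (α_ w₁ w₂ w₃).hom = actL (α_ v₁ v₂ v₃).hom (vc σ (vc ρ π))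
  -- vertical identities
  vi {a b} (h : BArr hor a b) : Sq h (bid ver a) (bid ver b) h
  vi_nat {a b} {h h' : BArr hor a b} (α : h ⟶ h') : actB (vi h) α = actT α (vi h')
  vc_vi_top {a b c d h v w k} (σ : @Sq a b c d h v w k) :
    actR (vc (vi h) σ) (λ_ w).hom = actL (λ_ v).hom σ
  vc_vi_bot {a b c d h v w k} (σ : @Sq a b c d h v w k) :
    actR (vc σ (vi k)) (ρ_ w).hom = actL (ρ_ v).hom σ
  -- strict interchange
  interchange {a b c d e f a' b' c' h₁ h₂ k₁ k₂ l₁ l₂ v₁ v₂ w₁ w₂ x₁ x₂}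
    (σ₁ : @Sq a b d e h₁ v₁ w₁ k₁) (ρ₁ : @Sq b c e f h₂ w₁ x₁ k₂)
    (σ₂ : @Sq d e a' b' k₁ v₂ w₂ l₁) (ρ₂ : @Sq e f b' c' k₂ w₂ x₂ l₂) :
    vc (hc σ₁ ρ₁) (hc σ₂ ρ₂) = hc (vc σ₁ σ₂) (vc ρ₁ ρ₂)
  vc_hi {a b c} (v : BArr ver a b) (w : BArr ver b c) : vc (hi v) (hi w) = hi (v ≫ w)
  hc_vi {a b c} (h : BArr hor a b) (k : BArr hor b c) : hc (vi h) (vi k) = vi (h ≫ k)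
  hi_bid (a : Obj) : hi (bid ver a) = vi (bid hor a)

/-! ### From a bicategory to a weak double category with identity strict arrows -/

/-- The category with objects `X` and only identity arrows. -/
abbrev trivCat (X : Type u) : Category.{w} X where
  Hom a b := ULift.{w} (PLift (a = b))
  id _ := ⟨⟨rfl⟩⟩
  comp f g := ⟨⟨f.down.down.trans g.down.down⟩⟩

/-- Transport of an arrow along equalities of its domain and codomain. -/
def castArr {X : Type u} (B : Bicategory.{w, v} X) {a b a' b' : X} (ea : a = a') (eb : b = b')
    (f : BArr B a b) : BArr B a' b' :=
  ea ▸ eb ▸ f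

/-- The cells with identity sides: the 2-cells of `B`. -/
structure GCell {X : Type u} (B : Bicategory.{w, v} X) {a b a' b' : X} (f : BArr B a b)
    (f' : BArr B a' b') : Type w where
  ea : a = a'
  eb : b = b'
  cell : castArr B ea eb f ⟶ f'

namespace GCell

variable {X : Type u} {B : Bicategory.{w, v} X}

/-- A 2-cell as a cell with identity sides. -/
def of {a b : X} {f g : BArr B a b} (α : f ⟶ g) : GCell B f g := ⟨rfl, rfl, α⟩

theorem exists_of {a b : X} {f g : BArr B a b} (φ : GCell B f g) : ∃ α : f ⟶ g, φ = of α :=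
  ⟨φ.cell, rfl⟩

def tcomp {a b a' b' a'' b'' : X} {f : BArr B a b} {f' : BArr B a' b'} {f'' : BArr B a'' b''}
    (φ : GCell B f f') (ψ : GCell B f' f'') : GCell B f f'' := by
  obtain ⟨rfl, rfl, α⟩ := φ
  obtain ⟨rfl, rfl, β⟩ := ψ
  change f ⟶ f' at α
  change f' ⟶ f'' at β
  exact of (α ≫ β)

def compCell {a b c a' b' c' : X} {f : BArr B a b} {g : BArr B b c} {f' : BArr B a' b'}
    {g' : BArr B b' c'} (φ : GCell B f f') (ψ : GCell B g g') : GCell B (f ≫ g) (f' ≫ g') := by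
  obtain ⟨rfl, rfl, α⟩ := φ
  obtain ⟨_, rfl, β⟩ := ψ
  change f ⟶ f' at α
  change g ⟶ g' at β
  exact of (α ▷ g ≫ f' ◁ β)

def idCell {a a' : X} (e : a = a') : GCell B (bid B a) (bid B a') :=
  match e with | rfl => of (𝟙 _)

theorem of_tcomp {a b : X} {f g h : BArr B a b} (α : f ⟶ g) (β : g ⟶ h) :
    tcomp (of α) (of β) = of (α ≫ β) := rfl

theorem of_compCell {a b c : X} {f f' : BArr B a b} {g g' : BArr B b c} (α : f ⟶ f')
    (β : g ⟶ g') : compCell (of α) (of β) = of (α ▷ g ≫ f' ◁ β) := rfl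

theorem idCell_rfl (a : X) (e : a = a) : idCell (B := B) e = of (𝟙 _) := rfl

theorem of_inj {a b : X} {f g : BArr B a b} {α β : f ⟶ g} (h : of α = of β) : α = β := by
  injection h

theorem heq_of {a b : X} {f g f' g' : BArr B a b} {α : f ⟶ g} {β : f' ⟶ g'}
    (hf : f = f') (hg : g = g') (h : HEq α β) : HEq (of α) (of β) := by
  subst hf hg; cases h; rfl

end GCell

/-- A bicategory as a weak double category with identity strict arrows. -/
def WeakDouble.ofBicategory {X : Type u} (B : Bicategory.{w, v} X) :
    @WeakDouble.{u, v, w} X (trivCat X) :=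
  letI : Category.{w} X := trivCat X
  { Arr := BArr B
    Cell := GCell B
    src := fun φ => ⟨⟨φ.ea⟩⟩
    tgt := fun φ => ⟨⟨φ.eb⟩⟩
    tid := fun {a b} (f : BArr B a b) => GCell.of (𝟙 f)
    tcomp := GCell.tcomp
    tid_tcomp := by
      rintro a b a' b' f f' ⟨rfl, rfl, φ⟩
      exact congrArg GCell.of (Category.id_comp _)
    tcomp_tid := by
      rintro a b a' b' f f' ⟨rfl, rfl, φ⟩
      exact congrArg GCell.of (Category.comp_id _)
    tcomp_assoc := by
      rintro a b a' b' a'' b'' c d f f' f'' g ⟨rfl, rfl, φ⟩ ⟨rfl, rfl, ψ⟩ ⟨rfl, rfl, θ⟩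
      exact congrArg GCell.of (Category.assoc _ _ _)
    src_tid := fun _ => rfl
    tgt_tid := fun _ => rfl
    src_tcomp := fun _ _ => rfl
    tgt_tcomp := fun _ _ => rfl
    idArr := bid B
    idCell := fun t => GCell.idCell t.down.down
    src_idCell := fun _ => rfl
    tgt_idCell := fun _ => rfl
    idCell_id := fun _ => rfl
    idCell_comp := by
      rintro a a' a'' ⟨⟨rfl⟩⟩ ⟨⟨rfl⟩⟩
      exact (congrArg GCell.of (Category.comp_id _)).symm
    comp := fun f g => f ≫ g
    compCell := fun φ ψ _ => GCell.compCell φ ψ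
    src_compCell := fun _ _ _ => rfl
    tgt_compCell := fun _ _ _ => rfl
    compCell_tid := fun {a b c} f g => congrArg GCell.of
      (show 𝟙 f ▷ g ≫ f ◁ 𝟙 g = 𝟙 (f ≫ g) by simp)
    compCell_tcomp := by
      rintro a b c a' b' c' a'' b'' c'' f g f' g' f'' g'' ⟨rfl, rfl, φ⟩ ⟨_, rfl, ψ⟩
        ⟨rfl, rfl, φ'⟩ ⟨_, rfl, ψ'⟩ _ _
      change f ⟶ f' at φ
      change f' ⟶ f'' at φ'
      change g ⟶ g' at ψ
      change g' ⟶ g'' at ψ'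
      refine congrArg GCell.of
        (show (φ ≫ φ') ▷ g ≫ f'' ◁ (ψ ≫ ψ') = (φ ▷ g ≫ f' ◁ ψ) ≫ φ' ▷ g' ≫ f'' ◁ ψ' from ?_)
      simp [whisker_exchange_assoc]
    assoc := fun f g k => GCell.of (α_ f g k).hom
    src_assoc := fun _ _ _ => rfl
    tgt_assoc := fun _ _ _ => rfl
    assoc_iso := fun f g k => ⟨GCell.of (α_ f g k).inv, congrArg GCell.of (Iso.hom_inv_id _),
      congrArg GCell.of (Iso.inv_hom_id _)⟩
    assoc_nat := by
      rintro a b c d a' b' c' d' f g k f' g' k' ⟨rfl, rfl, φ⟩ ⟨_, rfl, ψ⟩ ⟨_, rfl, θ⟩ _ _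
      change f ⟶ f' at φ
      change g ⟶ g' at ψ
      change k ⟶ k' at θ
      refine congrArg GCell.of
        (show ((φ ▷ g ≫ f' ◁ ψ) ▷ k ≫ (f' ≫ g') ◁ θ) ≫ (α_ f' g' k').hom =
          (α_ f g k).hom ≫ φ ▷ (g ≫ k) ≫ f' ◁ (ψ ▷ k ≫ g' ◁ θ) from ?_)
      simp
    lunit := fun f => GCell.of (λ_ f).hom
    src_lunit := fun _ => rfl
    tgt_lunit := fun _ => rfl
    lunit_iso := fun f => ⟨GCell.of (λ_ f).inv, congrArg GCell.of (Iso.hom_inv_id _),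
      congrArg GCell.of (Iso.inv_hom_id _)⟩
    lunit_nat := by
      rintro a b a' b' f f' ⟨rfl, rfl, φ⟩
      change f ⟶ f' at φ
      refine congrArg GCell.of
        (show (𝟙 (bid B a) ▷ f ≫ bid B a ◁ φ) ≫ (λ_ f').hom = (λ_ f).hom ≫ φ from ?_)
      simp
    runit := fun f => GCell.of (ρ_ f).hom
    src_runit := fun _ => rfl
    tgt_runit := fun _ => rfl
    runit_iso := fun f => ⟨GCell.of (ρ_ f).inv, congrArg GCell.of (Iso.hom_inv_id _),
      congrArg GCell.of (Iso.inv_hom_id _)⟩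
    runit_nat := by
      rintro a b a' b' f f' ⟨rfl, rfl, φ⟩
      change f ⟶ f' at φ
      refine congrArg GCell.of
        (show (φ ▷ bid B b ≫ f' ◁ 𝟙 (bid B b)) ≫ (ρ_ f').hom = (ρ_ f).hom ≫ φ from ?_)
      simp
    pentagon := fun f g k l => congrArg GCell.of
      (show (((α_ f g k).hom ▷ l ≫ (f ≫ g ≫ k) ◁ 𝟙 l) ≫ (α_ f (g ≫ k) l).hom) ≫
          𝟙 f ▷ ((g ≫ k) ≫ l) ≫ f ◁ (α_ g k l).hom =
        (α_ (f ≫ g) k l).hom ≫ (α_ f g (k ≫ l)).hom by simp)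
    triangle := fun {a b c} f g => congrArg GCell.of
      (show (α_ f (bid B b) g).hom ≫ 𝟙 f ▷ (bid B b ≫ g) ≫ f ◁ (λ_ g).hom =
        (ρ_ f).hom ▷ g ≫ f ◁ 𝟙 g by simp) }

/-! ### The intercategory of a double bicategory -/

namespace DoubleBicategory

variable (D : DoubleBicategory.{u, v, w})

/-- The condition for a quadruple of 2-cells to be a morphism from the square `σ` to `σ'`. -/
def Rel {a b c d : D.Obj} {h h' : BArr D.hor a b} {v v' : BArr D.ver a c} {w w' : BArr D.ver b d}
    {k k' : BArr D.hor c d} (σ : D.Sq h v w k) (σ' : D.Sq h' v' w' k')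
    (α : h ⟶ h') (β : v ⟶ v') (β' : w ⟶ w') (γ : k ⟶ k') : Prop :=
  D.actB (D.actR σ β') γ = D.actT α (D.actL β σ')

/-- The condition `Rel`, for 2-cells regarded as cells with identity sides. -/
def Cond {a b c d a' b' c' d' : D.Obj} {h : BArr D.hor a b} {v : BArr D.ver a c}
    {w : BArr D.ver b d} {k : BArr D.hor c d} {h' : BArr D.hor a' b'} {v' : BArr D.ver a' c'}
    {w' : BArr D.ver b' d'} {k' : BArr D.hor c' d'} (σ : D.Sq h v w k) (σ' : D.Sq h' v' w' k')
    (t : GCell D.hor h h') (l : GCell D.ver v v') (r : GCell D.ver w w') (s : GCell D.hor k k') :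
    Prop := by
  obtain ⟨rfl, rfl, α⟩ := t
  obtain ⟨_, rfl, β⟩ := l
  obtain ⟨_, rfl, β'⟩ := r
  obtain ⟨_, _, γ⟩ := s
  exact D.Rel σ σ' α β β' γ

/-- The cubes: there is a single cube with given boundary if the boundary satisfies `Cond`, and
none otherwise. -/
@[ext]
structure DCube {a b c d a' b' c' d' : D.Obj} {h : BArr D.hor a b} {v : BArr D.ver a c}
    {w : BArr D.ver b d} {k : BArr D.hor c d} {h' : BArr D.hor a' b'} {v' : BArr D.ver a' c'}
    {w' : BArr D.ver b' d'} {k' : BArr D.hor c' d'} (σ : D.Sq h v w k) (σ' : D.Sq h' v' w' k') :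
    Type w where
  top : GCell D.hor h h'
  left : GCell D.ver v v'
  right : GCell D.ver w w'
  bot : GCell D.hor k k'
  cond : D.Cond σ σ' top left right bot

variable {D}

theorem rel_id {a b c d h v w k} (σ : @D.Sq a b c d h v w k) :
    D.Rel σ σ (𝟙 h) (𝟙 v) (𝟙 w) (𝟙 k) := by
  simp only [Rel, D.actB_id, D.actR_id, D.actT_id, D.actL_id]

theorem rel_comp {a b c d h v w k h' v' w' k' h'' v'' w'' k''} {σ : @D.Sq a b c d h v w k}
    {σ' : @D.Sq a b c d h' v' w' k'} {σ'' : @D.Sq a b c d h'' v'' w'' k''} {α β β' γ α₁ β₁ β₁' γ₁}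
    (H : D.Rel σ σ' α β β' γ) (H' : D.Rel σ' σ'' α₁ β₁ β₁' γ₁) :
    D.Rel σ σ'' (α ≫ α₁) (β ≫ β₁) (β' ≫ β₁') (γ ≫ γ₁) := by
  simp only [Rel] at *
  rw [D.actB_comp, D.actR_comp, D.actR_actB (D.actR σ β'), H, ← D.actT_actR, ← D.actT_actB,
    ← D.actL_actR, ← D.actL_actB, H', D.actT_comp, D.actL_comp, D.actT_actL α₁ β]

theorem rel_symm {a b c d h v w k h' v' w' k'} {σ : @D.Sq a b c d h v w k}
    {σ' : @D.Sq a b c d h' v' w' k'} {α : h ≅ h'} {β : v ≅ v'} {β' : w ≅ w'} {γ : k ≅ k'}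
    (H : D.Rel σ σ' α.hom β.hom β'.hom γ.hom) : D.Rel σ' σ α.inv β.inv β'.inv γ.inv := by
  simp only [Rel] at *
  have e : σ = D.actB (D.actR (D.actT α.hom (D.actL β.hom σ')) β'.inv) γ.inv := by
    rw [← H, ← D.actR_actB, ← D.actR_comp, ← D.actB_comp]
    simp only [Iso.hom_inv_id, D.actR_id, D.actB_id]
  rw [e, ← D.actT_actR, ← D.actT_actB, ← D.actL_actR, ← D.actL_actB, D.actT_actL α.hom,
    ← D.actL_comp, Iso.inv_hom_id, D.actL_id, ← D.actT_comp, Iso.inv_hom_id, D.actT_id]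

theorem rel_hc {a b c d e f h₀ h₁ k₀ k₁ v w x h₀' h₁' k₀' k₁' v' w' x'}
    {σ : @D.Sq a b d e h₀ v w k₀} {ρ : @D.Sq b c e f h₁ w x k₁} {σ' : @D.Sq a b d e h₀' v' w' k₀'}
    {ρ' : @D.Sq b c e f h₁' w' x' k₁'} {α₀ α₁ β β' β'' γ₀ γ₁}
    (H : D.Rel σ σ' α₀ β β' γ₀) (H' : D.Rel ρ ρ' α₁ β' β'' γ₁) :
    D.Rel (D.hc σ ρ) (D.hc σ' ρ') (α₀ ▷ h₁ ≫ h₀' ◁ α₁) β β'' (γ₀ ▷ k₁ ≫ k₀' ◁ γ₁) := by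
  simp only [Rel] at *
  rw [D.actB_comp, ← D.hc_actR, ← D.hc_actB_left, ← D.hc_actB_right, H', D.actT_actL,
    ← D.hc_mid, ← D.actR_actB, H, D.hc_actT_left, D.hc_actL, D.hc_actT_right, D.actT_comp,
    D.actT_actL (h₀' ◁ α₁)]

theorem rel_vc {a b c d e f h k l v₀ v₁ w₀ w₁ h' k' l' v₀' v₁' w₀' w₁'}
    {σ : @D.Sq a b c d h v₀ w₀ k} {ρ : @D.Sq c d e f k v₁ w₁ l}
    {σ' : @D.Sq a b c d h' v₀' w₀' k'} {ρ' : @D.Sq c d e f k' v₁' w₁' l'}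
    {α γ δ β₀ β₁ β₀' β₁'}
    (H : D.Rel σ σ' α β₀ β₀' γ) (H' : D.Rel ρ ρ' γ β₁ β₁' δ) :
    D.Rel (D.vc σ ρ) (D.vc σ' ρ') α (β₀ ▷ v₁ ≫ v₀' ◁ β₁) (β₀' ▷ w₁ ≫ w₀' ◁ β₁') δ := by
  simp only [Rel] at *
  rw [D.actR_comp, D.actR_actB, D.actR_actB, ← D.vc_actB, ← D.vc_actR_top, ← D.vc_actR_bot,
    ← D.actR_actB, H', ← D.vc_mid, H, D.vc_actT, D.vc_actL_top, D.vc_actL_bot, D.actL_comp]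

theorem rel_hi {a b} {v v' : BArr D.ver a b} (β : v ⟶ v') :
    D.Rel (D.hi v) (D.hi v') (𝟙 _) β β (𝟙 _) := by
  simp only [Rel, D.actB_id, D.actT_id, D.hi_nat]

theorem rel_vi {a b} {h h' : BArr D.hor a b} (α : h ⟶ h') :
    D.Rel (D.vi h) (D.vi h') α (𝟙 _) (𝟙 _) α := by
  simp only [Rel, D.actR_id, D.actL_id, D.vi_nat]

theorem rel_of_eq {a b c d h v w k} {σ σ' : @D.Sq a b c d h v w k} (e : σ = σ') :
    D.Rel σ σ' (𝟙 h) (𝟙 v) (𝟙 w) (𝟙 k) := e ▸ rel_id σ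

namespace DCube

def of {a b c d h v w k h' v' w' k'} {σ : @D.Sq a b c d h v w k} {σ' : @D.Sq a b c d h' v' w' k'}
    {α β β' γ} (H : D.Rel σ σ' α β β' γ) : D.DCube σ σ' :=
  ⟨.of α, .of β, .of β', .of γ, H⟩

def tcomp {a b c d a' b' c' d' a'' b'' c'' d'' h v w k h' v' w' k' h'' v'' w'' k''}
    {σ : @D.Sq a b c d h v w k} {σ' : @D.Sq a' b' c' d' h' v' w' k'}
    {σ'' : @D.Sq a'' b'' c'' d'' h'' v'' w'' k''} (x : D.DCube σ σ') (y : D.DCube σ' σ'') :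
    D.DCube σ σ'' where
  top := x.top.tcomp y.top
  left := x.left.tcomp y.left
  right := x.right.tcomp y.right
  bot := x.bot.tcomp y.bot
  cond := by
    obtain ⟨⟨rfl, rfl, _⟩, ⟨_, rfl, _⟩, ⟨_, rfl, _⟩, ⟨_, _, _⟩, H⟩ := x
    obtain ⟨⟨rfl, rfl, _⟩, ⟨_, rfl, _⟩, ⟨_, rfl, _⟩, ⟨_, _, _⟩, H'⟩ := y
    exact rel_comp H H'

def hcomp {a b c d e f h₀ h₁ k₀ k₁ v w x a' b' c' d' e' f' h₀' h₁' k₀' k₁' v' w' x'}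
    {σ : @D.Sq a b d e h₀ v w k₀} {ρ : @D.Sq b c e f h₁ w x k₁}
    {σ' : @D.Sq a' b' d' e' h₀' v' w' k₀'} {ρ' : @D.Sq b' c' e' f' h₁' w' x' k₁'}
    (y : D.DCube σ σ') (z : D.DCube ρ ρ') (i : y.right = z.left) :
    D.DCube (D.hc σ ρ) (D.hc σ' ρ') where
  top := y.top.compCell z.top
  left := y.left
  right := z.right
  bot := y.bot.compCell z.bot
  cond := by
    obtain ⟨⟨rfl, rfl, _⟩, ⟨_, rfl, _⟩, ⟨_, rfl, _⟩, ⟨_, _, _⟩, H⟩ := y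
    obtain ⟨⟨_, rfl, _⟩, ⟨_, _, _⟩, ⟨_, rfl, _⟩, ⟨_, _, _⟩, H'⟩ := z
    cases i
    exact rel_hc H H'

def vcomp {a b c d e f h k l v₀ v₁ w₀ w₁ a' b' c' d' e' f' h' k' l' v₀' v₁' w₀' w₁'}
    {σ : @D.Sq a b c d h v₀ w₀ k} {ρ : @D.Sq c d e f k v₁ w₁ l}
    {σ' : @D.Sq a' b' c' d' h' v₀' w₀' k'} {ρ' : @D.Sq c' d' e' f' k' v₁' w₁' l'}
    (y : D.DCube σ σ') (z : D.DCube ρ ρ') (i : y.bot = z.top) :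
    D.DCube (D.vc σ ρ) (D.vc σ' ρ') where
  top := y.top
  left := y.left.compCell z.left
  right := y.right.compCell z.right
  bot := z.bot
  cond := by
    obtain ⟨⟨rfl, rfl, _⟩, ⟨_, rfl, _⟩, ⟨_, rfl, _⟩, ⟨_, _, _⟩, H⟩ := y
    obtain ⟨⟨_, _, _⟩, ⟨_, rfl, _⟩, ⟨_, rfl, _⟩, ⟨_, _, _⟩, H'⟩ := z
    cases i
    exact rel_vc H H'

def hid {a b a' b'} {v : BArr D.ver a b} {v' : BArr D.ver a' b'} (φ : GCell D.ver v v') :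
    D.DCube (D.hi v) (D.hi v') where
  top := .idCell φ.ea
  left := φ
  right := φ
  bot := .idCell φ.eb
  cond := by
    obtain ⟨rfl, rfl, φ⟩ := φ
    exact rel_hi (v := v) φ

def vid {a b a' b'} {h : BArr D.hor a b} {h' : BArr D.hor a' b'} (φ : GCell D.hor h h') :
    D.DCube (D.vi h) (D.vi h') where
  top := φ
  left := .idCell φ.ea
  right := .idCell φ.eb
  bot := φ
  cond := by
    obtain ⟨rfl, rfl, φ⟩ := φ
    exact rel_vi (h := h) φ

theorem rel_hAssoc {a b c d a' b' c' d' h₁ h₂ h₃ k₁ k₂ k₃ v w x y} (σ : @D.Sq a b a' b' h₁ v w k₁)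
    (ρ : @D.Sq b c b' c' h₂ w x k₂) (π : @D.Sq c d c' d' h₃ x y k₃) :
    D.Rel (D.hc (D.hc σ ρ) π) (D.hc σ (D.hc ρ π)) (α_ h₁ h₂ h₃).hom (Iso.refl v).hom
      (Iso.refl y).hom (α_ k₁ k₂ k₃).hom := by
  simp only [Rel, Iso.refl_hom, D.actR_id, D.actL_id, D.hc_assoc]

theorem rel_hLunit {a b c d h v w k} (σ : @D.Sq a b c d h v w k) :
    D.Rel (D.hc (D.hi v) σ) σ (λ_ h).hom (Iso.refl v).hom (Iso.refl w).hom (λ_ k).hom := by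
  simp only [Rel, Iso.refl_hom, D.actR_id, D.actL_id, D.hc_hi_left]

theorem rel_hRunit {a b c d h v w k} (σ : @D.Sq a b c d h v w k) :
    D.Rel (D.hc σ (D.hi w)) σ (ρ_ h).hom (Iso.refl v).hom (Iso.refl w).hom (ρ_ k).hom := by
  simp only [Rel, Iso.refl_hom, D.actR_id, D.actL_id, D.hc_hi_right]

theorem rel_vAssoc {a b c d a' b' c' d' h k l n v₁ v₂ v₃ w₁ w₂ w₃} (σ : @D.Sq a a' b b' h v₁ w₁ k)
    (ρ : @D.Sq b b' c c' k v₂ w₂ l) (π : @D.Sq c c' d d' l v₃ w₃ n) :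
    D.Rel (D.vc (D.vc σ ρ) π) (D.vc σ (D.vc ρ π)) (Iso.refl h).hom (α_ v₁ v₂ v₃).hom
      (α_ w₁ w₂ w₃).hom (Iso.refl n).hom := by
  simp only [Rel, Iso.refl_hom, D.actB_id, D.actT_id, D.vc_assoc]

theorem rel_vLunit {a b c d h v w k} (σ : @D.Sq a b c d h v w k) :
    D.Rel (D.vc (D.vi h) σ) σ (Iso.refl h).hom (λ_ v).hom (λ_ w).hom (Iso.refl k).hom := by
  simp only [Rel, Iso.refl_hom, D.actB_id, D.actT_id, D.vc_vi_top]

theorem rel_vRunit {a b c d h v w k} (σ : @D.Sq a b c d h v w k) :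
    D.Rel (D.vc σ (D.vi k)) σ (Iso.refl h).hom (ρ_ v).hom (ρ_ w).hom (Iso.refl k).hom := by
  simp only [Rel, Iso.refl_hom, D.actB_id, D.actT_id, D.vc_vi_bot]

theorem iso_of {a b c d h v w k h' v' w' k'} {σ : @D.Sq a b c d h v w k}
    {σ' : @D.Sq a b c d h' v' w' k'} {α : h ≅ h'} {β : v ≅ v'} {β' : w ≅ w'} {γ : k ≅ k'}
    (H : D.Rel σ σ' α.hom β.hom β'.hom γ.hom) :
    ∃ z : D.DCube σ' σ, tcomp (of H) z = of (rel_id σ) ∧ tcomp z (of H) = of (rel_id σ') :=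
  ⟨of (rel_symm H),
    DCube.ext (congrArg GCell.of α.hom_inv_id) (congrArg GCell.of β.hom_inv_id)
      (congrArg GCell.of β'.hom_inv_id) (congrArg GCell.of γ.hom_inv_id),
    DCube.ext (congrArg GCell.of α.inv_hom_id) (congrArg GCell.of β.inv_hom_id)
      (congrArg GCell.of β'.inv_hom_id) (congrArg GCell.of γ.inv_hom_id)⟩

end DCube

variable (D)

instance : Category.{w} D.Obj := trivCat D.Obj

/-- Objects, cells and cubes of the intercategory of a double bicategory. -/
def toCubeFrame : CubeFrame.{u, v, w} where
  Obj := D.Obj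
  trans := trivCat D.Obj
  hor := .ofBicategory D.hor
  ver := .ofBicategory D.ver
  Sq h v w k := D.Sq h v w k
  Cube σ σ' := D.DCube σ σ'
  top x := x.top
  left x := x.left
  right x := x.right
  bot x := x.bot
  src_top _ := rfl
  tgt_top _ := rfl
  src_bot _ := rfl
  tgt_bot _ := rfl
  tid σ := .of (rel_id σ)
  tcomp x y := x.tcomp y
  tid_tcomp x := DCube.ext ((WeakDouble.ofBicategory D.hor).tid_tcomp x.top)
    ((WeakDouble.ofBicategory D.ver).tid_tcomp x.left)
    ((WeakDouble.ofBicategory D.ver).tid_tcomp x.right)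
    ((WeakDouble.ofBicategory D.hor).tid_tcomp x.bot)
  tcomp_tid x := DCube.ext ((WeakDouble.ofBicategory D.hor).tcomp_tid x.top)
    ((WeakDouble.ofBicategory D.ver).tcomp_tid x.left)
    ((WeakDouble.ofBicategory D.ver).tcomp_tid x.right)
    ((WeakDouble.ofBicategory D.hor).tcomp_tid x.bot)
  tcomp_assoc x y z :=
    DCube.ext ((WeakDouble.ofBicategory D.hor).tcomp_assoc x.top y.top z.top)
      ((WeakDouble.ofBicategory D.ver).tcomp_assoc x.left y.left z.left)
      ((WeakDouble.ofBicategory D.ver).tcomp_assoc x.right y.right z.right)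
      ((WeakDouble.ofBicategory D.hor).tcomp_assoc x.bot y.bot z.bot)
  top_tid _ := rfl
  left_tid _ := rfl
  right_tid _ := rfl
  bot_tid _ := rfl
  top_tcomp _ _ := rfl
  left_tcomp _ _ := rfl
  right_tcomp _ _ := rfl
  bot_tcomp _ _ := rfl

/-- Horizontal and vertical compositions in the intercategory of a double bicategory. -/
def toCubeComp : CubeComp.{u, v, w} where
  toCubeFrame := D.toCubeFrame
  sqH σ ρ := D.hc σ ρ
  cubeH x y e := x.hcomp y e
  top_cubeH _ _ _ := rfl
  bot_cubeH _ _ _ := rfl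
  left_cubeH _ _ _ := rfl
  right_cubeH _ _ _ := rfl
  cubeH_tid _ _ := DCube.ext ((WeakDouble.ofBicategory D.hor).compCell_tid _ _)
    (rfl)
    (rfl)
    ((WeakDouble.ofBicategory D.hor).compCell_tid _ _)
  cubeH_tcomp x y x' y' _ _ := DCube.ext ((WeakDouble.ofBicategory D.hor).compCell_tcomp x.top y.top x'.top y'.top rfl rfl)
    (rfl)
    (rfl)
    ((WeakDouble.ofBicategory D.hor).compCell_tcomp x.bot y.bot x'.bot y'.bot rfl rfl)
  sqHid v := D.hi v
  cubeHid φ := DCube.hid φ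
  top_cubeHid _ := rfl
  bot_cubeHid _ := rfl
  left_cubeHid _ := rfl
  right_cubeHid _ := rfl
  cubeHid_tid _ := rfl
  cubeHid_tcomp φ ψ := DCube.ext ((WeakDouble.ofBicategory D.hor).idCell_comp ⟨⟨φ.ea⟩⟩ ⟨⟨ψ.ea⟩⟩)
    (rfl)
    (rfl)
    ((WeakDouble.ofBicategory D.hor).idCell_comp ⟨⟨φ.eb⟩⟩ ⟨⟨ψ.eb⟩⟩)
  hAssoc σ ρ π := DCube.of (DCube.rel_hAssoc σ ρ π)
  top_hAssoc _ _ _ := rfl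
  bot_hAssoc _ _ _ := rfl
  left_hAssoc _ _ _ := rfl
  right_hAssoc _ _ _ := rfl
  hAssoc_iso σ ρ π := DCube.iso_of (DCube.rel_hAssoc σ ρ π)
  hAssoc_nat x y z _ _ := DCube.ext ((WeakDouble.ofBicategory D.hor).assoc_nat x.top y.top z.top rfl rfl)
    (((WeakDouble.ofBicategory D.ver).tcomp_tid _).trans ((WeakDouble.ofBicategory D.ver).tid_tcomp _).symm)
    (((WeakDouble.ofBicategory D.ver).tcomp_tid _).trans ((WeakDouble.ofBicategory D.ver).tid_tcomp _).symm)
    ((WeakDouble.ofBicategory D.hor).assoc_nat x.bot y.bot z.bot rfl rfl)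
  hLunit σ := DCube.of (DCube.rel_hLunit σ)
  top_hLunit _ := rfl
  bot_hLunit _ := rfl
  left_hLunit _ := rfl
  right_hLunit _ := rfl
  hLunit_iso σ := DCube.iso_of (DCube.rel_hLunit σ)
  hLunit_nat x := DCube.ext ((WeakDouble.ofBicategory D.hor).lunit_nat x.top)
    (((WeakDouble.ofBicategory D.ver).tcomp_tid _).trans ((WeakDouble.ofBicategory D.ver).tid_tcomp _).symm)
    (((WeakDouble.ofBicategory D.ver).tcomp_tid _).trans ((WeakDouble.ofBicategory D.ver).tid_tcomp _).symm)
    ((WeakDouble.ofBicategory D.hor).lunit_nat x.bot)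
  hRunit σ := DCube.of (DCube.rel_hRunit σ)
  top_hRunit _ := rfl
  bot_hRunit _ := rfl
  left_hRunit _ := rfl
  right_hRunit _ := rfl
  hRunit_iso σ := DCube.iso_of (DCube.rel_hRunit σ)
  hRunit_nat x := DCube.ext ((WeakDouble.ofBicategory D.hor).runit_nat x.top)
    (((WeakDouble.ofBicategory D.ver).tcomp_tid _).trans ((WeakDouble.ofBicategory D.ver).tid_tcomp _).symm)
    (((WeakDouble.ofBicategory D.ver).tcomp_tid _).trans ((WeakDouble.ofBicategory D.ver).tid_tcomp _).symm)
    ((WeakDouble.ofBicategory D.hor).runit_nat x.bot)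
  hPentagon _ _ _ _ := DCube.ext ((WeakDouble.ofBicategory D.hor).pentagon _ _ _ _)
    ((WeakDouble.ofBicategory D.ver).tcomp_tid _)
    ((WeakDouble.ofBicategory D.ver).tcomp_tid _)
    ((WeakDouble.ofBicategory D.hor).pentagon _ _ _ _)
  hTriangle _ _ := DCube.ext ((WeakDouble.ofBicategory D.hor).triangle _ _)
    ((WeakDouble.ofBicategory D.ver).tcomp_tid _)
    ((WeakDouble.ofBicategory D.ver).tcomp_tid _)
    ((WeakDouble.ofBicategory D.hor).triangle _ _)
  sqV σ ρ := D.vc σ ρ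
  cubeV x y e := x.vcomp y e
  left_cubeV _ _ _ := rfl
  right_cubeV _ _ _ := rfl
  top_cubeV _ _ _ := rfl
  bot_cubeV _ _ _ := rfl
  cubeV_tid _ _ := DCube.ext (rfl)
    ((WeakDouble.ofBicategory D.ver).compCell_tid _ _)
    ((WeakDouble.ofBicategory D.ver).compCell_tid _ _)
    (rfl)
  cubeV_tcomp x y x' y' _ _ := DCube.ext (rfl)
    ((WeakDouble.ofBicategory D.ver).compCell_tcomp x.left y.left x'.left y'.left rfl rfl)
    ((WeakDouble.ofBicategory D.ver).compCell_tcomp x.right y.right x'.right y'.right rfl rfl)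
    (rfl)
  sqVid v := D.vi v
  cubeVid φ := DCube.vid φ
  left_cubeVid _ := rfl
  right_cubeVid _ := rfl
  top_cubeVid _ := rfl
  bot_cubeVid _ := rfl
  cubeVid_tid _ := rfl
  cubeVid_tcomp φ ψ := DCube.ext (rfl)
    ((WeakDouble.ofBicategory D.ver).idCell_comp ⟨⟨φ.ea⟩⟩ ⟨⟨ψ.ea⟩⟩)
    ((WeakDouble.ofBicategory D.ver).idCell_comp ⟨⟨φ.eb⟩⟩ ⟨⟨ψ.eb⟩⟩)
    (rfl)
  vAssoc σ ρ π := DCube.of (DCube.rel_vAssoc σ ρ π)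
  left_vAssoc _ _ _ := rfl
  right_vAssoc _ _ _ := rfl
  top_vAssoc _ _ _ := rfl
  bot_vAssoc _ _ _ := rfl
  vAssoc_iso σ ρ π := DCube.iso_of (DCube.rel_vAssoc σ ρ π)
  vAssoc_nat x y z _ _ := DCube.ext (((WeakDouble.ofBicategory D.hor).tcomp_tid _).trans ((WeakDouble.ofBicategory D.hor).tid_tcomp _).symm)
    ((WeakDouble.ofBicategory D.ver).assoc_nat x.left y.left z.left rfl rfl)
    ((WeakDouble.ofBicategory D.ver).assoc_nat x.right y.right z.right rfl rfl)
    (((WeakDouble.ofBicategory D.hor).tcomp_tid _).trans ((WeakDouble.ofBicategory D.hor).tid_tcomp _).symm)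
  vLunit σ := DCube.of (DCube.rel_vLunit σ)
  left_vLunit _ := rfl
  right_vLunit _ := rfl
  top_vLunit _ := rfl
  bot_vLunit _ := rfl
  vLunit_iso σ := DCube.iso_of (DCube.rel_vLunit σ)
  vLunit_nat x := DCube.ext (((WeakDouble.ofBicategory D.hor).tcomp_tid _).trans ((WeakDouble.ofBicategory D.hor).tid_tcomp _).symm)
    ((WeakDouble.ofBicategory D.ver).lunit_nat x.left)
    ((WeakDouble.ofBicategory D.ver).lunit_nat x.right)
    (((WeakDouble.ofBicategory D.hor).tcomp_tid _).trans ((WeakDouble.ofBicategory D.hor).tid_tcomp _).symm)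
  vRunit σ := DCube.of (DCube.rel_vRunit σ)
  left_vRunit _ := rfl
  right_vRunit _ := rfl
  top_vRunit _ := rfl
  bot_vRunit _ := rfl
  vRunit_iso σ := DCube.iso_of (DCube.rel_vRunit σ)
  vRunit_nat x := DCube.ext (((WeakDouble.ofBicategory D.hor).tcomp_tid _).trans ((WeakDouble.ofBicategory D.hor).tid_tcomp _).symm)
    ((WeakDouble.ofBicategory D.ver).runit_nat x.left)
    ((WeakDouble.ofBicategory D.ver).runit_nat x.right)
    (((WeakDouble.ofBicategory D.hor).tcomp_tid _).trans ((WeakDouble.ofBicategory D.hor).tid_tcomp _).symm)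
  vPentagon _ _ _ _ := DCube.ext ((WeakDouble.ofBicategory D.hor).tcomp_tid _)
    ((WeakDouble.ofBicategory D.ver).pentagon _ _ _ _)
    ((WeakDouble.ofBicategory D.ver).pentagon _ _ _ _)
    ((WeakDouble.ofBicategory D.hor).tcomp_tid _)
  vTriangle _ _ := DCube.ext ((WeakDouble.ofBicategory D.hor).tcomp_tid _)
    ((WeakDouble.ofBicategory D.ver).triangle _ _)
    ((WeakDouble.ofBicategory D.ver).triangle _ _)
    ((WeakDouble.ofBicategory D.hor).tcomp_tid _)

/-- The interchangers of the intercategory of a double bicategory are identities. -/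
def idCube {A B C E h v w k} {σ σ' : @D.toCubeComp.Sq A B C E h v w k}
    (e : σ = σ') :
    D.toCubeComp.Cube σ σ' :=
  DCube.of (rel_of_eq e)

theorem top_idCube {A B C E h v w k} {σ σ' : @D.toCubeComp.Sq A B C E h v w k}
    (e : σ = σ') :
    D.toCubeComp.top (D.idCube e) = D.toCubeComp.hor.tid h := rfl

theorem left_idCube {A B C E h v w k} {σ σ' : @D.toCubeComp.Sq A B C E h v w k}
    (e : σ = σ') :
    D.toCubeComp.left (D.idCube e) = D.toCubeComp.ver.tid v := rfl

theorem right_idCube {A B C E h v w k} {σ σ' : @D.toCubeComp.Sq A B C E h v w k}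
    (e : σ = σ') :
    D.toCubeComp.right (D.idCube e) = D.toCubeComp.ver.tid w := rfl

theorem bot_idCube {A B C E h v w k} {σ σ' : @D.toCubeComp.Sq A B C E h v w k}
    (e : σ = σ') :
    D.toCubeComp.bot (D.idCube e) = D.toCubeComp.hor.tid k := rfl

variable {D} in
theorem cube_ext {A B C E A' B' C' E' h v w k h' v' w' k'}
    {σ : @D.toCubeComp.Sq A B C E h v w k} {σ' : @D.toCubeComp.Sq A' B' C' E' h' v' w' k'}
    {x y : D.toCubeComp.Cube σ σ'}
    (et : D.toCubeComp.top x = D.toCubeComp.top y) (el : D.toCubeComp.left x = D.toCubeComp.left y)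
    (er : D.toCubeComp.right x = D.toCubeComp.right y)
    (eb : D.toCubeComp.bot x = D.toCubeComp.bot y) : x = y :=
  DCube.ext et el er eb

theorem chi_eq {A B C E F G H I J h₀ h₁ k₀ k₁ l₀ l₁ v₀ v₁ w₀ w₁ x₀ x₁}
    (σ₀ : @D.toCubeComp.Sq A B E F h₀ v₀ w₀ k₀) (ρ₀ : @D.toCubeComp.Sq B C F G h₁ w₀ x₀ k₁)
    (σ₁ : @D.toCubeComp.Sq E F H I k₀ v₁ w₁ l₀) (ρ₁ : @D.toCubeComp.Sq F G I J k₁ w₁ x₁ l₁) :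
    D.toCubeComp.sqV (D.toCubeComp.sqH σ₀ ρ₀) (D.toCubeComp.sqH σ₁ ρ₁) =
      D.toCubeComp.sqH (D.toCubeComp.sqV σ₀ σ₁) (D.toCubeComp.sqV ρ₀ ρ₁) :=
  D.interchange _ _ _ _

theorem mu_eq {A B C} (v : D.toCubeComp.ver.Arr A B) (w : D.toCubeComp.ver.Arr B C) :
    D.toCubeComp.sqV (D.toCubeComp.sqHid v) (D.toCubeComp.sqHid w) =
      D.toCubeComp.sqHid (D.toCubeComp.ver.comp v w) :=
  D.vc_hi _ _

theorem delta_eq {A B C} (h : D.toCubeComp.hor.Arr A B) (k : D.toCubeComp.hor.Arr B C) :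
    D.toCubeComp.sqVid (D.toCubeComp.hor.comp h k) =
      D.toCubeComp.sqH (D.toCubeComp.sqVid h) (D.toCubeComp.sqVid k) :=
  (D.hc_vi _ _).symm

theorem tau_eq (A : D.toCubeComp.Obj) :
    D.toCubeComp.sqVid (D.toCubeComp.hor.idArr A) =
      D.toCubeComp.sqHid (D.toCubeComp.ver.idArr A) :=
  (D.hi_bid _).symm

section

attribute [local simp] top_idCube left_idCube right_idCube bot_idCube
  CubeFrame.top_tid CubeFrame.left_tid CubeFrame.right_tid CubeFrame.bot_tid
  CubeFrame.top_tcomp CubeFrame.left_tcomp CubeFrame.right_tcomp CubeFrame.bot_tcomp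
  CubeComp.top_cubeH CubeComp.left_cubeH CubeComp.right_cubeH CubeComp.bot_cubeH
  CubeComp.top_cubeV CubeComp.left_cubeV CubeComp.right_cubeV CubeComp.bot_cubeV
  CubeComp.top_cubeHid CubeComp.left_cubeHid CubeComp.right_cubeHid CubeComp.bot_cubeHid
  CubeComp.top_cubeVid CubeComp.left_cubeVid CubeComp.right_cubeVid CubeComp.bot_cubeVid
  CubeComp.top_hAssoc CubeComp.left_hAssoc CubeComp.right_hAssoc CubeComp.bot_hAssoc
  CubeComp.top_vAssoc CubeComp.left_vAssoc CubeComp.right_vAssoc CubeComp.bot_vAssoc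
  CubeComp.top_hLunit CubeComp.left_hLunit CubeComp.right_hLunit CubeComp.bot_hLunit
  CubeComp.top_vLunit CubeComp.left_vLunit CubeComp.right_vLunit CubeComp.bot_vLunit
  CubeComp.top_hRunit CubeComp.left_hRunit CubeComp.right_hRunit CubeComp.bot_hRunit
  CubeComp.top_vRunit CubeComp.left_vRunit CubeComp.right_vRunit CubeComp.bot_vRunit
  WeakDouble.tcomp_tid WeakDouble.tid_tcomp WeakDouble.compCell_tid WeakDouble.idCell_id
  WeakDouble.src_assoc WeakDouble.tgt_assoc WeakDouble.src_lunit WeakDouble.tgt_lunit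
  WeakDouble.src_runit WeakDouble.tgt_runit WeakDouble.src_compCell WeakDouble.tgt_compCell
  WeakDouble.src_idCell WeakDouble.tgt_idCell

/-- The intercategory of a double bicategory: the transversal arrows are identities, the arrows and
cells are the arrows and 2-cells of the two bicategories, the basic cells are the squares, there is
a single cube with given boundary if the boundary satisfies `Cond` and none otherwise, and all
interchangers are identities. -/
def toIntercategory : Intercategory.{u, v, w} where
  toCubeComp := D.toCubeComp
  chi σ₀ ρ₀ σ₁ ρ₁ := D.idCube (D.chi_eq σ₀ ρ₀ σ₁ ρ₁)
  top_chi _ _ _ _ := rfl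
  left_chi _ _ _ _ := rfl
  right_chi _ _ _ _ := rfl
  bot_chi _ _ _ _ := rfl
  chi_nat _ _ _ _ _ _ _ _ := by apply cube_ext <;> simp
  mu v w := D.idCube (D.mu_eq v w)
  top_mu _ _ := rfl
  left_mu _ _ := rfl
  right_mu _ _ := rfl
  bot_mu _ _ := rfl
  mu_nat _ _ _ := by apply cube_ext <;> simp
  delta h k := D.idCube (D.delta_eq h k)
  top_delta _ _ := rfl
  left_delta _ _ := rfl
  right_delta _ _ := rfl
  bot_delta _ _ := rfl
  delta_nat _ _ _ := by apply cube_ext <;> simp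
  tau A := D.idCube (D.tau_eq A)
  top_tau _ := rfl
  left_tau _ := rfl
  right_tau _ := rfl
  bot_tau _ := rfl
  tau_nat _ := by apply cube_ext <;> simp
  chi_assoc _ _ _ _ _ _ := by apply cube_ext <;> simp
  chi_lunit _ _ := by apply cube_ext <;> simp
  chi_runit _ _ := by apply cube_ext <;> simp
  mu_assoc _ _ _ := by apply cube_ext <;> simp
  mu_lunit _ := by apply cube_ext <;> simp
  mu_runit _ := by apply cube_ext <;> simp
  chi_hAssoc _ _ _ _ _ _ := by apply cube_ext <;> simp
  delta_hAssoc _ _ _ := by apply cube_ext <;> simp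
  chi_hLunit _ _ := by apply cube_ext <;> simp
  delta_hLunit _ := by apply cube_ext <;> simp
  chi_hRunit _ _ := by apply cube_ext <;> simp
  delta_hRunit _ := by apply cube_ext <;> simp

end

variable {D} in
theorem rel_lift_left {a b c d h h' v v' w k} (σ : @D.Sq a b c d h v w k) (α : h' ⟶ h)
    (β : v' ⟶ v) : D.Rel (D.actT α (D.actL β σ)) σ α β (𝟙 w) (𝟙 k) := by
  simp only [Rel, D.actR_id, D.actB_id]

variable {D} in
theorem rel_lift_right {a b c d h v w w' k k'} (σ : @D.Sq a b c d h v w k) (β : w ⟶ w')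
    (γ : k ⟶ k') : D.Rel σ (D.actB (D.actR σ β) γ) (𝟙 h) (𝟙 v) β γ := by
  simp only [Rel, D.actT_id, D.actL_id]

variable {D} in
theorem eq_of_rel_left {a b c d h h' v v' w k} {σ : @D.Sq a b c d h v w k} {τ : D.Sq h' v' w k}
    {α : h' ⟶ h} {β : v' ⟶ v} {β' γ} (H : D.Rel τ σ α β β' γ) (e₁ : GCell.of β' = .of (𝟙 w))
    (e₂ : GCell.of γ = .of (𝟙 k)) : τ = D.actT α (D.actL β σ) := by
  rw [← H, GCell.of_inj e₁, GCell.of_inj e₂, D.actR_id, D.actB_id]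

variable {D} in
theorem eq_of_rel_right {a b c d h v w w' k k'} {σ : @D.Sq a b c d h v w k} {τ : D.Sq h v w' k'}
    {α β} {β' : w ⟶ w'} {γ : k ⟶ k'} (H : D.Rel σ τ α β β' γ) (e₁ : GCell.of β = .of (𝟙 v))
    (e₂ : GCell.of α = .of (𝟙 h)) : τ = D.actB (D.actR σ β') γ := by
  rw [H, GCell.of_inj e₁, GCell.of_inj e₂, D.actL_id, D.actT_id]

theorem _root_.Intercat.isHomLift_of_eq {E B : Type*} [Category* E] [Category* B] (P : E ⥤ B)
    {e e' : E} (g : e ⟶ e') (f : P.obj e ⟶ P.obj e') (h : P.map g = f) : P.IsHomLift f g :=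
  h ▸ .map g

theorem lift_left (e : D.toIntercategory.SqObj)
    {b : D.toIntercategory.ver.ArrObj × D.toIntercategory.hor.ArrObj}
    (f : b ⟶ D.toIntercategory.boundary₀.obj e) :
    ∃! g : (Σ e' : D.toIntercategory.SqObj, e' ⟶ e),
      D.toIntercategory.boundary₀.IsHomLift f g.2 ∧
      D.toIntercategory.boundary₁.IsHomLift (𝟙 (D.toIntercategory.boundary₁.obj e)) g.2 := by
  obtain ⟨⟨v'⟩, ⟨h'⟩⟩ := b
  obtain @⟨A, B, C, E, h, v, w, k, σ⟩ := e
  obtain ⟨f₁, f₂⟩ := f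
  change GCell D.ver v' v at f₁
  change GCell D.hor h' h at f₂
  obtain ⟨rfl, rfl, β⟩ := f₁
  obtain ⟨rfl, rfl, α⟩ := f₂
  have H := rel_lift_left (h' := h') (v' := v') σ α β
  refine ⟨⟨⟨D.actT (h' := h') α (D.actL (v' := v') β σ)⟩, DCube.of H⟩,
    ⟨isHomLift_of_eq _ _ _ rfl, isHomLift_of_eq _ _ _ rfl⟩, ?_⟩
  rintro ⟨@⟨_, _, _, _, h'', v'', w'', k'', τ⟩, x⟩ ⟨h₁, h₂⟩
  have d₁ :
      ((⟨v''⟩, ⟨h''⟩) : D.toIntercategory.ver.ArrObj × D.toIntercategory.hor.ArrObj) = (⟨v'⟩, ⟨h'⟩)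
      := @IsHomLift.domain_eq _ _ _ _ D.toIntercategory.boundary₀ _ _ _ _ _ _ h₁
  have d₂ :
      ((⟨w''⟩, ⟨k''⟩) : D.toIntercategory.ver.ArrObj × D.toIntercategory.hor.ArrObj) = (⟨w⟩, ⟨k⟩)
      := @IsHomLift.domain_eq _ _ _ _ D.toIntercategory.boundary₁ _ _ _ _ _ _ h₂
  cases d₁
  cases d₂
  change D.DCube τ σ at x
  obtain ⟨⟨_, _, α'⟩, ⟨_, _, β'⟩, ⟨_, _, γ'⟩, ⟨_, _, δ'⟩, c⟩ := x
  have q₁ := @IsHomLift.eq_of_isHomLift _ _ _ _ D.toIntercategory.boundary₀ _ _ _ _ h₁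
  have q₂ := @IsHomLift.eq_of_isHomLift _ _ _ _ D.toIntercategory.boundary₁ _ _ _ _ h₂
  obtain ⟨q₃, q₄⟩ := Prod.ext_iff.mp q₁
  obtain ⟨q₅, q₆⟩ := Prod.ext_iff.mp q₂
  obtain rfl := GCell.of_inj q₃
  obtain rfl := GCell.of_inj q₄
  have e : τ = D.actT (h' := h') _ (D.actL (v' := v') _ σ) := eq_of_rel_left c q₅.symm q₆.symm
  subst e
  obtain rfl := GCell.of_inj q₅
  obtain rfl := GCell.of_inj q₆
  rfl

theorem lift_right (e : D.toIntercategory.SqObj)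
    {b : D.toIntercategory.ver.ArrObj × D.toIntercategory.hor.ArrObj}
    (f : D.toIntercategory.boundary₁.obj e ⟶ b) :
    ∃! g : (Σ e' : D.toIntercategory.SqObj, e ⟶ e'),
      D.toIntercategory.boundary₁.IsHomLift f g.2 ∧
      D.toIntercategory.boundary₀.IsHomLift (𝟙 (D.toIntercategory.boundary₀.obj e)) g.2 := by
  obtain ⟨⟨w'⟩, ⟨k'⟩⟩ := b
  obtain @⟨A, B, C, E, h, v, w, k, σ⟩ := e
  obtain ⟨f₁, f₂⟩ := f
  change GCell D.ver w w' at f₁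
  change GCell D.hor k k' at f₂
  obtain ⟨rfl, rfl, β⟩ := f₁
  obtain ⟨rfl, rfl, γ⟩ := f₂
  have H := rel_lift_right (w' := w') (k' := k') σ β γ
  refine ⟨⟨⟨D.actB (k' := k') (D.actR (w' := w') σ β) γ⟩, DCube.of H⟩,
    ⟨isHomLift_of_eq _ _ _ rfl, isHomLift_of_eq _ _ _ rfl⟩, ?_⟩
  rintro ⟨@⟨_, _, _, _, h'', v'', w'', k'', τ⟩, x⟩ ⟨h₁, h₂⟩
  have d₁ :
      ((⟨w''⟩, ⟨k''⟩) : D.toIntercategory.ver.ArrObj × D.toIntercategory.hor.ArrObj) = (⟨w'⟩, ⟨k'⟩)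
      := @IsHomLift.codomain_eq _ _ _ _ D.toIntercategory.boundary₁ _ _ _ _ _ _ h₁
  have d₂ :
      ((⟨v''⟩, ⟨h''⟩) : D.toIntercategory.ver.ArrObj × D.toIntercategory.hor.ArrObj) = (⟨v⟩, ⟨h⟩)
      := @IsHomLift.codomain_eq _ _ _ _ D.toIntercategory.boundary₀ _ _ _ _ _ _ h₂
  cases d₁
  cases d₂
  change D.DCube σ τ at x
  obtain ⟨⟨_, _, α'⟩, ⟨_, _, β'⟩, ⟨_, _, γ'⟩, ⟨_, _, δ'⟩, c⟩ := x
  have q₁ := @IsHomLift.eq_of_isHomLift _ _ _ _ D.toIntercategory.boundary₁ _ _ _ _ h₁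
  have q₂ := @IsHomLift.eq_of_isHomLift _ _ _ _ D.toIntercategory.boundary₀ _ _ _ _ h₂
  obtain ⟨q₃, q₄⟩ := Prod.ext_iff.mp q₁
  obtain ⟨q₅, q₆⟩ := Prod.ext_iff.mp q₂
  obtain rfl := GCell.of_inj q₃
  obtain rfl := GCell.of_inj q₄
  have e : τ = D.actB (k' := k') (D.actR (w' := w') σ _) _ := eq_of_rel_right c q₅.symm q₆.symm
  subst e
  obtain rfl := GCell.of_inj q₅
  obtain rfl := GCell.of_inj q₆
  rfl

/-- The intercategory of a double bicategory satisfies `(*)`. -/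
theorem toIntercategory_star : D.toIntercategory.Star where
  lift_left := D.lift_left
  lift_right := D.lift_right
  factor := by
    rintro @⟨_, _, _, _, h, v, w, k, σ⟩ @⟨_, _, _, _, h', v', w', k', σ'⟩ g
    change D.DCube σ σ' at g
    obtain ⟨⟨rfl, rfl, α⟩, ⟨_, rfl, β⟩, ⟨_, rfl, γ⟩, ⟨_, _, δ⟩, c⟩ := g
    change D.Rel (h := h) (h' := h') (v := v) (v' := v') (w := w) (w' := w') (k := k) (k' := k')
      σ σ' α β γ δ at c
    have H := rel_lift_left (h' := h) (v' := v) σ' α β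
    rw [← c] at H
    refine ⟨⟨D.actB (k' := k') (D.actR (w' := w') σ γ) δ⟩,
      DCube.of (rel_lift_right (w' := w') (k' := k') σ γ δ), DCube.of H,
      isHomLift_of_eq _ _ _ rfl, isHomLift_of_eq _ _ _ rfl, ?_⟩
    exact DCube.ext (congrArg GCell.of (Category.id_comp _)) (congrArg GCell.of (Category.id_comp _))
      (congrArg GCell.of (Category.comp_id _)) (congrArg GCell.of (Category.comp_id _))

/-- The transversal arrows of the intercategory of a double bicategory are identities. -/
theorem toIntercategory_transversalIdentities : D.toIntercategory.TransversalIdentities where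
  subsingleton a b := inferInstanceAs (Subsingleton (ULift (PLift (a = b))))
  eq_of_hom f := f.down.down

end DoubleBicategory

/-! ### Strict functors of double bicategories -/

/-- A strict functor of bicategories with given function on objects. -/
structure BicatFunctor {X Y : Type u} (B : Bicategory.{w, v} X) (C : Bicategory.{w, v} Y)
    (obj : X → Y) where
  map {a b : X} : BArr B a b → BArr C (obj a) (obj b)
  map₂ {a b : X} {f g : BArr B a b} : (f ⟶ g) → (map f ⟶ map g)
  map₂_id {a b : X} (f : BArr B a b) : map₂ (𝟙 f) = 𝟙 (map f)
  map₂_comp {a b : X} {f g h : BArr B a b} (α : f ⟶ g) (β : g ⟶ h) :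
    map₂ (α ≫ β) = map₂ α ≫ map₂ β
  map_bid (a : X) : map (bid B a) = bid C (obj a)
  map_comp {a b c : X} (f : BArr B a b) (g : BArr B b c) : map (f ≫ g) = map f ≫ map g
  map₂_whiskerLeft {a b c : X} (f : BArr B a b) {g h : BArr B b c} (α : g ⟶ h) :
    HEq (map₂ (f ◁ α)) (map f ◁ map₂ α)
  map₂_whiskerRight {a b c : X} {f g : BArr B a b} (α : f ⟶ g) (h : BArr B b c) :
    HEq (map₂ (α ▷ h)) (map₂ α ▷ map h)
  map₂_associator {a b c d : X} (f : BArr B a b) (g : BArr B b c) (h : BArr B c d) :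
    HEq (map₂ (α_ f g h).hom) (α_ (map f) (map g) (map h)).hom
  map₂_leftUnitor {a b : X} (f : BArr B a b) : HEq (map₂ (λ_ f).hom) (λ_ (map f)).hom
  map₂_rightUnitor {a b : X} (f : BArr B a b) : HEq (map₂ (ρ_ f).hom) (ρ_ (map f)).hom

/-- A strict functor of double bicategories: it preserves all the structure on the nose. -/
structure DoubleBicategory.StrictFunctor (D E : DoubleBicategory.{u, v, w}) where
  obj : D.Obj → E.Obj
  hor : BicatFunctor D.hor E.hor obj
  ver : BicatFunctor D.ver E.ver obj
  sq {a b c d h v w k} : @D.Sq a b c d h v w k → E.Sq (hor.map h) (ver.map v) (ver.map w) (hor.map k)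
  sq_actT {a b c d h h' v w k} (α : h' ⟶ h) (σ : @D.Sq a b c d h v w k) :
    sq (D.actT α σ) = E.actT (hor.map₂ α) (sq σ)
  sq_actL {a b c d h v v' w k} (β : v' ⟶ v) (σ : @D.Sq a b c d h v w k) :
    sq (D.actL β σ) = E.actL (ver.map₂ β) (sq σ)
  sq_actR {a b c d h v w w' k} (σ : @D.Sq a b c d h v w k) (β : w ⟶ w') :
    sq (D.actR σ β) = E.actR (sq σ) (ver.map₂ β)
  sq_actB {a b c d h v w k k'} (σ : @D.Sq a b c d h v w k) (α : k ⟶ k') :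
    sq (D.actB σ α) = E.actB (sq σ) (hor.map₂ α)
  sq_hc {a b c d e f h h' k k' v w x} (σ : @D.Sq a b d e h v w k) (ρ : @D.Sq b c e f h' w x k') :
    HEq (sq (D.hc σ ρ)) (E.hc (sq σ) (sq ρ))
  sq_vc {a b c d e f h k l v v' w w'} (σ : @D.Sq a b c d h v w k) (ρ : @D.Sq c d e f k v' w' l) :
    HEq (sq (D.vc σ ρ)) (E.vc (sq σ) (sq ρ))
  sq_hi {a b} (v : BArr D.ver a b) : HEq (sq (D.hi v)) (E.hi (ver.map v))
  sq_vi {a b} (h : BArr D.hor a b) : HEq (sq (D.vi h)) (E.vi (hor.map h))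

namespace BicatFunctor

variable {X Y Z : Type u} {B : Bicategory.{w, v} X} {C : Bicategory.{w, v} Y}
  {E : Bicategory.{w, v} Z} {o : X → Y} {p : Y → Z}

theorem heq_map₂ (F : BicatFunctor B C o) {a b : X} {f g f' g' : BArr B a b} {α : f ⟶ g}
    {β : f' ⟶ g'} (hf : f = f') (hg : g = g') (h : HEq α β) : HEq (F.map₂ α) (F.map₂ β) := by
  subst hf hg; cases h; rfl

theorem map_comp_comp (F : BicatFunctor B C o) {a b c d : X} (f : BArr B a b) (g : BArr B b c)
    (h : BArr B c d) : F.map ((f ≫ g) ≫ h) = (F.map f ≫ F.map g) ≫ F.map h := by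
  rw [F.map_comp, F.map_comp]

theorem map_comp_comp' (F : BicatFunctor B C o) {a b c d : X} (f : BArr B a b) (g : BArr B b c)
    (h : BArr B c d) : F.map (f ≫ g ≫ h) = F.map f ≫ F.map g ≫ F.map h := by
  rw [F.map_comp, F.map_comp]

theorem map_bid_comp (F : BicatFunctor B C o) {a b : X} (f : BArr B a b) :
    F.map (bid B a ≫ f) = bid C (o a) ≫ F.map f :=
  (F.map_comp _ _).trans (congrArg (· ≫ F.map f) (F.map_bid a))

theorem map_comp_bid (F : BicatFunctor B C o) {a b : X} (f : BArr B a b) :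
    F.map (f ≫ bid B b) = F.map f ≫ bid C (o b) :=
  (F.map_comp _ _).trans (congrArg (F.map f ≫ ·) (F.map_bid b))

def id (B : Bicategory.{w, v} X) : BicatFunctor B B _root_.id where
  map f := f
  map₂ α := α
  map₂_id _ := rfl
  map₂_comp _ _ := rfl
  map_bid _ := rfl
  map_comp _ _ := rfl
  map₂_whiskerLeft _ _ _ _ := HEq.rfl
  map₂_whiskerRight _ _ := HEq.rfl
  map₂_associator _ _ _ := HEq.rfl
  map₂_leftUnitor _ := HEq.rfl
  map₂_rightUnitor _ := HEq.rfl

def comp (F : BicatFunctor B C o) (G : BicatFunctor C E p) : BicatFunctor B E (p ∘ o) where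
  map f := G.map (F.map f)
  map₂ α := G.map₂ (F.map₂ α)
  map₂_id f := (congrArg G.map₂ (F.map₂_id f)).trans (G.map₂_id _)
  map₂_comp α β := (congrArg G.map₂ (F.map₂_comp α β)).trans (G.map₂_comp _ _)
  map_bid a := (congrArg G.map (F.map_bid a)).trans (G.map_bid _)
  map_comp f g := (congrArg G.map (F.map_comp f g)).trans (G.map_comp _ _)
  map₂_whiskerLeft f _ _ α := (G.heq_map₂ (F.map_comp _ _) (F.map_comp _ _)
    (F.map₂_whiskerLeft f α)).trans (G.map₂_whiskerLeft _ _)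
  map₂_whiskerRight α h := (G.heq_map₂ (F.map_comp _ _) (F.map_comp _ _)
    (F.map₂_whiskerRight α h)).trans (G.map₂_whiskerRight _ _)
  map₂_associator f g h := (G.heq_map₂ (F.map_comp_comp f g h) (F.map_comp_comp' f g h)
    (F.map₂_associator f g h)).trans (G.map₂_associator _ _ _)
  map₂_leftUnitor f := (G.heq_map₂ (F.map_bid_comp f) rfl
    (F.map₂_leftUnitor f)).trans (G.map₂_leftUnitor _)
  map₂_rightUnitor f := (G.heq_map₂ (F.map_comp_bid f) rfl
    (F.map₂_rightUnitor f)).trans (G.map₂_rightUnitor _)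

end BicatFunctor

namespace DoubleBicategory

theorem StrictFunctor.heq_sq {D E : DoubleBicategory.{u, v, w}} (F : StrictFunctor D E)
    {a b c d : D.Obj} {h h₁ : BArr D.hor a b} {v v₁ : BArr D.ver a c} {w w₁ : BArr D.ver b d}
    {k k₁ : BArr D.hor c d} {σ : D.Sq h v w k} {σ₁ : D.Sq h₁ v₁ w₁ k₁}
    (eh : h = h₁) (ev : v = v₁) (ew : w = w₁) (ek : k = k₁) (e : HEq σ σ₁) :
    HEq (F.sq σ) (F.sq σ₁) := by
  subst eh ev ew ek; cases e; rfl

/-- The category of double bicategories and strict functors. -/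
instance : Category DoubleBicategory.{u, v, w} where
  Hom := StrictFunctor
  id D :=
    { obj := _root_.id
      hor := .id _
      ver := .id _
      sq := fun σ => σ
      sq_actT := fun _ _ => rfl
      sq_actL := fun _ _ => rfl
      sq_actR := fun _ _ => rfl
      sq_actB := fun _ _ => rfl
      sq_hc := fun _ _ => HEq.rfl
      sq_vc := fun _ _ => HEq.rfl
      sq_hi := fun _ => HEq.rfl
      sq_vi := fun _ => HEq.rfl }
  comp F G :=
    { obj := G.obj ∘ F.obj
      hor := F.hor.comp G.hor
      ver := F.ver.comp G.ver
      sq := fun σ => G.sq (F.sq σ)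
      sq_actT := fun α σ => (congrArg G.sq (F.sq_actT α σ)).trans (G.sq_actT _ _)
      sq_actL := fun α σ => (congrArg G.sq (F.sq_actL α σ)).trans (G.sq_actL _ _)
      sq_actR := fun σ α => (congrArg G.sq (F.sq_actR σ α)).trans (G.sq_actR _ _)
      sq_actB := fun σ α => (congrArg G.sq (F.sq_actB σ α)).trans (G.sq_actB _ _)
      sq_hc := fun σ ρ => (G.heq_sq (F.hor.map_comp _ _) rfl rfl (F.hor.map_comp _ _)
        (F.sq_hc σ ρ)).trans (G.sq_hc _ _)
      sq_vc := fun σ ρ => (G.heq_sq rfl (F.ver.map_comp _ _) (F.ver.map_comp _ _) rfl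
        (F.sq_vc σ ρ)).trans (G.sq_vc _ _)
      sq_hi := fun v => (G.heq_sq (F.hor.map_bid _) rfl rfl (F.hor.map_bid _)
        (F.sq_hi v)).trans (G.sq_hi _)
      sq_vi := fun h => (G.heq_sq rfl (F.ver.map_bid _) (F.ver.map_bid _) rfl
        (F.sq_vi h)).trans (G.sq_vi _) }

end DoubleBicategory

/-! ### The functor from double bicategories to intercategories -/

section
variable {X Y : Type u} {B : Bicategory.{w, v} X} {C : Bicategory.{w, v} Y} {o : X → Y}

def GCell.map (F : BicatFunctor B C o) {a b a' b' : X} {f : BArr B a b} {f' : BArr B a' b'}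
    (φ : GCell B f f') : GCell C (F.map f) (F.map f') := by
  obtain ⟨rfl, rfl, α⟩ := φ
  exact .of (F.map₂ (f := f) α)

theorem GCell.map_of (F : BicatFunctor B C o) {a b : X} {f f' : BArr B a b} (α : f ⟶ f') :
    GCell.map F (GCell.of α) = GCell.of (F.map₂ α) := rfl

theorem heq_comp₂ {a b : X} {f g h f' g' h' : BArr B a b} {α : f ⟶ g} {β : g ⟶ h} {α' : f' ⟶ g'}
    {β' : g' ⟶ h'} (ef : f = f') (eg : g = g') (eh : h = h') (e : HEq α α') (e' : HEq β β') :
    HEq (α ≫ β) (α' ≫ β') := by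
  subst ef eg eh; cases e; cases e'; rfl

theorem GCell.heq_of_id {a b : X} {f g : BArr B a b} (e : f = g) :
    HEq (GCell.of (𝟙 f)) (GCell.of (𝟙 g)) := by
  subst e; rfl

/-- The functor of objects induced by a function. -/
abbrev trivFunctor (o : X → Y) :
    @CategoryTheory.Functor X (trivCat.{u, w} X) Y (trivCat.{u, w} Y) :=
  letI := trivCat.{u, w} X
  letI := trivCat.{u, w} Y
  { obj := o
    map := fun f => ⟨⟨congrArg o f.down.down⟩⟩ }

/-- A strict functor of bicategories as a strict functor of weak double categories. -/
def WeakDouble.StrictFunctor.ofBicatFunctor (F : BicatFunctor B C o) :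
    @WeakDouble.StrictFunctor X Y (trivCat X) (trivCat Y) (.ofBicategory B) (.ofBicategory C)
      (trivFunctor o) :=
  letI := trivCat.{u, w} X
  letI := trivCat.{u, w} Y
  { arr := fun f => F.map f
    cell := fun φ => GCell.map F φ
    src_cell := fun _ => rfl
    tgt_cell := fun _ => rfl
    cell_tid := fun f => congrArg GCell.of (F.map₂_id f)
    cell_tcomp := by
      rintro a b a' b' a'' b'' f f' f'' ⟨rfl, rfl, φ⟩ ⟨rfl, rfl, ψ⟩
      exact congrArg GCell.of (F.map₂_comp (f := f) (g := f') φ ψ)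
    arr_idArr := F.map_bid
    cell_idCell := by
      rintro a a' ⟨⟨rfl⟩⟩
      exact (heq_of_eq (congrArg GCell.of (F.map₂_id _))).trans (GCell.heq_of_id (F.map_bid a))
    arr_comp := F.map_comp
    cell_compCell := by
      rintro a b c a' b' c' f g f' g' ⟨rfl, rfl, φ⟩ ⟨_, rfl, ψ⟩ _
      refine GCell.heq_of (F.map_comp f g) (F.map_comp f' g') ?_
      exact (heq_of_eq (F.map₂_comp _ _)).trans (heq_comp₂ (F.map_comp _ _) (F.map_comp _ _)
        (F.map_comp _ _) (F.map₂_whiskerRight _ _) (F.map₂_whiskerLeft _ _))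
    cell_assoc := fun f g k => GCell.heq_of (F.map_comp_comp f g k)
      (F.map_comp_comp' f g k) (F.map₂_associator f g k)
    cell_lunit := fun f => GCell.heq_of (F.map_bid_comp f) rfl
      (F.map₂_leftUnitor f)
    cell_runit := fun f => GCell.heq_of (F.map_comp_bid f) rfl
      (F.map₂_rightUnitor f) }

end

namespace DoubleBicategory

variable {D E : DoubleBicategory.{u, v, w}} (F : StrictFunctor D E)

theorem rel_map {a b c d h v w k h' v' w' k'} {σ : @D.Sq a b c d h v w k}
    {σ' : @D.Sq a b c d h' v' w' k'} {α : h ⟶ h'} {β : v ⟶ v'} {β' : w ⟶ w'} {γ : k ⟶ k'}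
    (H : D.Rel σ σ' α β β' γ) : E.Rel (F.sq σ) (F.sq σ') (F.hor.map₂ α) (F.ver.map₂ β)
      (F.ver.map₂ β') (F.hor.map₂ γ) := by
  simp only [Rel] at *
  rw [← F.sq_actR, ← F.sq_actB, H, F.sq_actT, F.sq_actL]

def DCube.map {a b c d a' b' c' d' h v w k h' v' w' k'}
    {σ : @D.Sq a b c d h v w k} {σ' : @D.Sq a' b' c' d' h' v' w' k'} (x : D.DCube σ σ') :
    E.DCube (F.sq σ) (F.sq σ') where
  top := x.top.map F.hor
  left := x.left.map F.ver
  right := x.right.map F.ver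
  bot := x.bot.map F.hor
  cond := by
    obtain ⟨⟨rfl, rfl, _⟩, ⟨_, rfl, _⟩, ⟨_, rfl, _⟩, ⟨_, _, _⟩, H⟩ := x
    exact rel_map F H

theorem DCube.heq {a b c d a' b' c' d' : E.Obj}
    {h h₁ : BArr E.hor a b} {v v₁ : BArr E.ver a c} {w w₁ : BArr E.ver b d} {k k₁ : BArr E.hor c d}
    {h' h₁' : BArr E.hor a' b'} {v' v₁' : BArr E.ver a' c'} {w' w₁' : BArr E.ver b' d'}
    {k' k₁' : BArr E.hor c' d'} {σ : E.Sq h v w k} {σ₁ : E.Sq h₁ v₁ w₁ k₁}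
    {σ' : E.Sq h' v' w' k'} {σ₁' : E.Sq h₁' v₁' w₁' k₁'} {x : E.DCube σ σ'} {y : E.DCube σ₁ σ₁'}
    (e : h = h₁ ∧ v = v₁ ∧ w = w₁ ∧ k = k₁) (es : HEq σ σ₁)
    (e' : h' = h₁' ∧ v' = v₁' ∧ w' = w₁' ∧ k' = k₁') (es' : HEq σ' σ₁')
    (et : HEq x.top y.top) (el : HEq x.left y.left) (er : HEq x.right y.right)
    (eb : HEq x.bot y.bot) : HEq x y := by
  obtain ⟨rfl, rfl, rfl, rfl⟩ := e
  obtain ⟨rfl, rfl, rfl, rfl⟩ := e'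
  cases es
  cases es'
  exact heq_of_eq (DCube.ext (eq_of_heq et) (eq_of_heq el) (eq_of_heq er) (eq_of_heq eb))

theorem GCell.heq_map_id {X Y : Type u} {B : Bicategory.{w, v} X} {C : Bicategory.{w, v} Y}
    {o : X → Y} (G : BicatFunctor B C o) {a b : X} {f : BArr B a b} {g : BArr C (o a) (o b)}
    (e : G.map f = g) : HEq (GCell.map G (GCell.of (𝟙 f))) (GCell.of (𝟙 g)) := by
  subst e
  exact heq_of_eq (congrArg GCell.of (G.map₂_id f))

/-- The strict functor of intercategories induced by a strict functor of double bicategories. -/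
def StrictFunctor.toIntercategory :
    Intercategory.StrictFunctor D.toIntercategory E.toIntercategory :=
  let H := WeakDouble.StrictFunctor.ofBicatFunctor F.hor
  let V := WeakDouble.StrictFunctor.ofBicatFunctor F.ver
  have hh {a b c : D.Obj} (f : D.toIntercategory.hor.Arr a b)
      (g : D.toIntercategory.hor.Arr b c) :
      F.hor.map (D.toIntercategory.hor.comp f g) =
        E.toIntercategory.hor.comp (F.hor.map f) (F.hor.map g) :=
    F.hor.map_comp (a := a) (b := b) (c := c) f g
  have vv {a b c : D.Obj} (f : D.toIntercategory.ver.Arr a b)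
      (g : D.toIntercategory.ver.Arr b c) :
      F.ver.map (D.toIntercategory.ver.comp f g) =
        E.toIntercategory.ver.comp (F.ver.map f) (F.ver.map g) :=
    F.ver.map_comp (a := a) (b := b) (c := c) f g
  have hi := F.hor.map_bid
  have vi := F.ver.map_bid
  let J := E.toIntercategory
  { obj := trivFunctor F.obj
    hor := H
    ver := V
    sq := fun σ => F.sq σ
    cube := fun x => DCube.map F x
    top_cube := fun _ => rfl
    left_cube := fun _ => rfl
    right_cube := fun _ => rfl
    bot_cube := fun _ => rfl
    cube_tid := fun _ => DCube.ext (H.cell_tid _) (V.cell_tid _) (V.cell_tid _) (H.cell_tid _)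
    cube_tcomp := fun x y => DCube.ext (H.cell_tcomp x.top y.top) (V.cell_tcomp x.left y.left)
      (V.cell_tcomp x.right y.right) (H.cell_tcomp x.bot y.bot)
    sq_sqH := fun σ ρ => F.sq_hc σ ρ
    sq_sqV := fun σ ρ => F.sq_vc σ ρ
    sq_sqHid := fun v => F.sq_hi v
    sq_sqVid := fun h => F.sq_vi h
    cube_cubeH := fun x y _ => DCube.heq ⟨hh _ _, rfl, rfl, hh _ _⟩ (F.sq_hc _ _)
      ⟨hh _ _, rfl, rfl, hh _ _⟩ (F.sq_hc _ _) (H.cell_compCell x.top y.top rfl) HEq.rfl HEq.rfl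
      (H.cell_compCell x.bot y.bot rfl)
    cube_cubeV := fun x y _ => DCube.heq ⟨rfl, vv _ _, vv _ _, rfl⟩ (F.sq_vc _ _)
      ⟨rfl, vv _ _, vv _ _, rfl⟩ (F.sq_vc _ _) HEq.rfl (V.cell_compCell x.left y.left rfl)
      (V.cell_compCell x.right y.right rfl) HEq.rfl
    cube_cubeHid := fun φ => DCube.heq ⟨hi _, rfl, rfl, hi _⟩ (F.sq_hi _)
      ⟨hi _, rfl, rfl, hi _⟩ (F.sq_hi _) (H.cell_idCell ⟨⟨φ.ea⟩⟩) HEq.rfl HEq.rfl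
      (H.cell_idCell ⟨⟨φ.eb⟩⟩)
    cube_cubeVid := fun φ => DCube.heq ⟨rfl, vi _, vi _, rfl⟩ (F.sq_vi _)
      ⟨rfl, vi _, vi _, rfl⟩ (F.sq_vi _) HEq.rfl (V.cell_idCell ⟨⟨φ.ea⟩⟩)
      (V.cell_idCell ⟨⟨φ.eb⟩⟩) HEq.rfl
    cube_hAssoc := fun _ _ _ => DCube.heq
      ⟨F.hor.map_comp_comp _ _ _, rfl, rfl, F.hor.map_comp_comp _ _ _⟩
      ((F.sq_hc _ _).trans (J.heq_sqH ⟨hh _ _, rfl, hh _ _, rfl, rfl, rfl, rfl⟩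
        (F.sq_hc _ _) HEq.rfl))
      ⟨F.hor.map_comp_comp' _ _ _, rfl, rfl, F.hor.map_comp_comp' _ _ _⟩
      ((F.sq_hc _ _).trans (J.heq_sqH ⟨rfl, hh _ _, rfl, hh _ _, rfl, rfl, rfl⟩
        HEq.rfl (F.sq_hc _ _)))
      (H.cell_assoc _ _ _) (heq_of_eq (V.cell_tid _)) (heq_of_eq (V.cell_tid _))
      (H.cell_assoc _ _ _)
    cube_hLunit := fun _ => DCube.heq ⟨F.hor.map_bid_comp _, rfl, rfl, F.hor.map_bid_comp _⟩
      ((F.sq_hc _ _).trans (J.heq_sqH ⟨hi _, rfl, hi _, rfl, rfl, rfl, rfl⟩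
        (F.sq_hi _) HEq.rfl))
      ⟨rfl, rfl, rfl, rfl⟩ HEq.rfl
      (H.cell_lunit _) (heq_of_eq (V.cell_tid _)) (heq_of_eq (V.cell_tid _)) (H.cell_lunit _)
    cube_hRunit := fun _ => DCube.heq ⟨F.hor.map_comp_bid _, rfl, rfl, F.hor.map_comp_bid _⟩
      ((F.sq_hc _ _).trans (J.heq_sqH ⟨rfl, hi _, rfl, hi _, rfl, rfl, rfl⟩
        HEq.rfl (F.sq_hi _)))
      ⟨rfl, rfl, rfl, rfl⟩ HEq.rfl
      (H.cell_runit _) (heq_of_eq (V.cell_tid _)) (heq_of_eq (V.cell_tid _)) (H.cell_runit _)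
    cube_vAssoc := fun _ _ _ => DCube.heq
      ⟨rfl, F.ver.map_comp_comp _ _ _, F.ver.map_comp_comp _ _ _, rfl⟩
      ((F.sq_vc _ _).trans (J.heq_sqV ⟨rfl, rfl, rfl, vv _ _, vv _ _, rfl, rfl⟩
        (F.sq_vc _ _) HEq.rfl))
      ⟨rfl, F.ver.map_comp_comp' _ _ _, F.ver.map_comp_comp' _ _ _, rfl⟩
      ((F.sq_vc _ _).trans (J.heq_sqV ⟨rfl, rfl, rfl, rfl, rfl, vv _ _, vv _ _⟩
        HEq.rfl (F.sq_vc _ _)))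
      (heq_of_eq (H.cell_tid _)) (V.cell_assoc _ _ _) (V.cell_assoc _ _ _)
      (heq_of_eq (H.cell_tid _))
    cube_vLunit := fun _ => DCube.heq ⟨rfl, F.ver.map_bid_comp _, F.ver.map_bid_comp _, rfl⟩
      ((F.sq_vc _ _).trans (J.heq_sqV ⟨rfl, rfl, rfl, vi _, vi _, rfl, rfl⟩
        (F.sq_vi _) HEq.rfl))
      ⟨rfl, rfl, rfl, rfl⟩ HEq.rfl
      (heq_of_eq (H.cell_tid _)) (V.cell_lunit _) (V.cell_lunit _) (heq_of_eq (H.cell_tid _))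
    cube_vRunit := fun _ => DCube.heq ⟨rfl, F.ver.map_comp_bid _, F.ver.map_comp_bid _, rfl⟩
      ((F.sq_vc _ _).trans (J.heq_sqV ⟨rfl, rfl, rfl, rfl, rfl, vi _, vi _⟩
        HEq.rfl (F.sq_vi _)))
      ⟨rfl, rfl, rfl, rfl⟩ HEq.rfl
      (heq_of_eq (H.cell_tid _)) (V.cell_runit _) (V.cell_runit _) (heq_of_eq (H.cell_tid _))
    cube_chi := fun {_ _ _ _ _ _ _ _ _ h₀ h₁ k₀ k₁ l₀ l₁ v₀ v₁ w₀ w₁ x₀ x₁} _ _ _ _ =>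
      DCube.heq ⟨hh h₀ h₁, vv v₀ v₁, vv x₀ x₁, hh l₀ l₁⟩
      ((F.sq_vc _ _).trans (J.heq_sqV ⟨hh h₀ h₁, hh k₀ k₁, hh l₀ l₁, rfl, rfl, rfl, rfl⟩
        (F.sq_hc _ _) (F.sq_hc _ _)))
      ⟨hh h₀ h₁, vv v₀ v₁, vv x₀ x₁, hh l₀ l₁⟩
      ((F.sq_hc _ _).trans (J.heq_sqH ⟨rfl, rfl, rfl, rfl, vv v₀ v₁, vv w₀ w₁, vv x₀ x₁⟩
        (F.sq_vc _ _) (F.sq_vc _ _)))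
      (GCell.heq_map_id F.hor (hh h₀ h₁)) (GCell.heq_map_id F.ver (vv v₀ v₁))
      (GCell.heq_map_id F.ver (vv x₀ x₁)) (GCell.heq_map_id F.hor (hh l₀ l₁))
    cube_mu := fun v w => DCube.heq ⟨hi _, vv v w, vv v w, hi _⟩
      ((F.sq_vc _ _).trans (J.heq_sqV ⟨hi _, hi _, hi _, rfl, rfl, rfl, rfl⟩
        (F.sq_hi _) (F.sq_hi _)))
      ⟨hi _, vv v w, vv v w, hi _⟩
      ((F.sq_hi _).trans (J.heq_sqHid (vv v w)))
      (GCell.heq_map_id _ (hi _)) (GCell.heq_map_id _ (vv v w)) (GCell.heq_map_id _ (vv v w))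
      (GCell.heq_map_id _ (hi _))
    cube_delta := fun h k => DCube.heq ⟨hh h k, vi _, vi _, hh h k⟩
      ((F.sq_vi _).trans (J.heq_sqVid (hh h k)))
      ⟨hh h k, vi _, vi _, hh h k⟩
      ((F.sq_hc _ _).trans (J.heq_sqH ⟨rfl, rfl, rfl, rfl, vi _, vi _, vi _⟩
        (F.sq_vi _) (F.sq_vi _)))
      (GCell.heq_map_id _ (hh h k)) (GCell.heq_map_id _ (vi _)) (GCell.heq_map_id _ (vi _))
      (GCell.heq_map_id _ (hh h k))
    cube_tau := fun A => DCube.heq ⟨hi _, vi _, vi _, hi _⟩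
      ((F.sq_vi _).trans (J.heq_sqVid (hi _)))
      ⟨hi _, vi _, vi _, hi _⟩
      ((F.sq_hi _).trans (J.heq_sqHid (vi _)))
      (GCell.heq_map_id _ (hi _)) (GCell.heq_map_id _ (vi _)) (GCell.heq_map_id _ (vi _))
      (GCell.heq_map_id _ (hi _)) }

end DoubleBicategory

theorem Intercategory.strictFunctor_ext {I J : Intercategory.{u, v, w}} {P Q : I.StrictFunctor J}
    (obj : P.obj = Q.obj) (hor : HEq P.hor Q.hor) (ver : HEq P.ver Q.ver)
    (sq : HEq (@P.sq) (@Q.sq)) (cube : HEq (@P.cube) (@Q.cube)) : P = Q := by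
  cases P; cases Q
  cases obj; cases hor; cases ver; cases sq; cases cube
  rfl

theorem WeakDouble.strictFunctor_ext {A A' : Type u} [Category.{w} A] [Category.{w} A']
    {W : WeakDouble.{u, v, w} A} {W' : WeakDouble.{u, v, w} A'} {F : A ⥤ A'}
    {P Q : WeakDouble.StrictFunctor W W' F} (arr : @P.arr = @Q.arr)
    (cell : HEq (@P.cell) (@Q.cell)) : P = Q := by
  cases P; cases Q
  cases arr; cases cell
  rfl

namespace GCell

theorem map_id {X : Type u} (B : Bicategory.{w, v} X) {a b a' b' : X} {f : BArr B a b}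
    {f' : BArr B a' b'} (φ : GCell B f f') : GCell.map (.id B) φ = φ := by
  obtain ⟨rfl, rfl, α⟩ := φ
  rfl

theorem map_comp {X Y Z : Type u} {B : Bicategory.{w, v} X} {C : Bicategory.{w, v} Y}
    {E : Bicategory.{w, v} Z} {o : X → Y} {p : Y → Z} (F : BicatFunctor B C o)
    (G : BicatFunctor C E p) {a b a' b' : X} {f : BArr B a b} {f' : BArr B a' b'}
    (φ : GCell B f f') : GCell.map (F.comp G) φ = GCell.map G (GCell.map F φ) := by
  obtain ⟨rfl, rfl, α⟩ := φ
  rfl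

end GCell

namespace DoubleBicategory

/-- The functor sending a double bicategory to its intercategory. -/
def toIntercategoryFunctor : DoubleBicategory.{u, v, w} ⥤ Intercategory.{u, v, w} where
  obj D := D.toIntercategory
  map F := StrictFunctor.toIntercategory F
  map_id D := by
    refine Intercategory.strictFunctor_ext rfl (heq_of_eq (WeakDouble.strictFunctor_ext rfl
      (heq_of_eq ?_))) (heq_of_eq (WeakDouble.strictFunctor_ext rfl (heq_of_eq ?_))) HEq.rfl
      (heq_of_eq ?_)
    · funext a b a' b' f f' φ
      exact GCell.map_id D.hor φ
    · funext a b a' b' f f' φ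
      exact GCell.map_id D.ver φ
    · funext _ _ _ _ _ _ _ _ _ _ _ _ _ _ _ _ _ _ x
      exact DCube.ext (GCell.map_id D.hor x.top) (GCell.map_id D.ver x.left)
        (GCell.map_id D.ver x.right) (GCell.map_id D.hor x.bot)
  map_comp F G := by
    refine Intercategory.strictFunctor_ext rfl (heq_of_eq (WeakDouble.strictFunctor_ext rfl
      (heq_of_eq ?_))) (heq_of_eq (WeakDouble.strictFunctor_ext rfl (heq_of_eq ?_))) HEq.rfl
      (heq_of_eq ?_)
    · funext a b a' b' f f' φ
      exact GCell.map_comp F.hor G.hor φ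
    · funext a b a' b' f f' φ
      exact GCell.map_comp F.ver G.ver φ
    · funext _ _ _ _ _ _ _ _ _ _ _ _ _ _ _ _ _ _ x
      exact DCube.ext (GCell.map_comp F.hor G.hor x.top) (GCell.map_comp F.ver G.ver x.left)
        (GCell.map_comp F.ver G.ver x.right) (GCell.map_comp F.hor G.hor x.bot)

/-- The functor sending a double bicategory to its intercategory, with values in the category of
intercategories that satisfy `(*)` and have only identity transversal arrows. -/
def correspondence : DoubleBicategory.{u, v, w} ⥤ starProperty.{u, v, w}.FullSubcategory :=
  starProperty.lift toIntercategoryFunctor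
    fun D => ⟨D.toIntercategory_transversalIdentities, D.toIntercategory_star⟩

end DoubleBicategory

end Intercat

/-! Condition `(*)` says that a basic cell can be moved along cells of its boundary in exactly one
way. A pair of cells into its left side and top is the left and top of a unique cube into it whose
right and bottom faces are identities; `Star.pull` is the domain of that cube. Dually, a pair of
cells out of its right side and bottom gives a unique cube out of it with identities on the left and
top, with codomain `Star.push`. A special cube into a cell τ is therefore a lift of identities, as
is the identity cube of τ, and uniqueness makes the two coincide (`Star.special`). All interchangers
are special cubes, so the last assertion of the theorem follows at once.

The factorization clause of `(*)` makes every cube a lift of the second kind followed by a lift of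
the first kind. Hence a cube between cells with the same corners is determined by its four faces
(`Star.cube_ext`), and a cube from σ to σ' with given faces exists exactly when pushing σ along the
right and bottom faces gives the same cell as pulling σ' back along the top and left faces
(`Star.rel_iff`). If the four actions of a double bicategory are defined by pushing and pulling
along one cell and an identity, this equation is the condition that defines the cubes in the
intercategory of that double bicategory.

Essential surjectivity. When all transversal arrows are identities, horizontal and vertical cells
run between parallel arrows, and the two weak double categories are bicategories
(`WeakDouble.toBicategory`). Each axiom relating the actions to one another or to pasting has the
same proof: a cube with suitable faces is built by composing or pasting lifts, or is a constraint
cube, and uniqueness of lifts turns it into an equation of cells. Strict interchange holds because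
the interchangers are identities. The resulting double bicategory (`Star.toDoubleBicategory`) has
the original cells as squares and, by `Star.rel_iff`, the original cubes as cubes, so its
intercategory is isomorphic to the given one (`Star.iso`).

Full faithfulness. A strict functor of intercategories is not required to preserve actions, which
are not part of the structure. But in the intercategory of a double bicategory, the result of acting
on a square by a 2-cell is characterized as the end of a cube whose other three faces are
identities, and functors preserve cubes and their faces. Likewise whiskering is composition with an
identity cell. So the functor restricts to a strict functor of double bicategories
(`StrictFunctor.ofIntercategory`), from which it is recovered because cubes are determined by their
faces. -/

namespace Intercat

/-! ### Unique lifts of cubes and the triviality of special cubes -/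

namespace Intercategory

variable {I : Intercategory.{u, v, w}}

/-- Two basic cells are related by a quadruple of cells if it is the boundary of a cube. -/
def Rel {A B C D A' B' C' D'} {h : I.hor.Arr A B} {h' : I.hor.Arr A' B'} {v : I.ver.Arr A C}
    {v' : I.ver.Arr A' C'} {w : I.ver.Arr B D} {w' : I.ver.Arr B' D'} {k : I.hor.Arr C D}
    {k' : I.hor.Arr C' D'} (σ : I.Sq h v w k)
    (σ' : I.Sq h' v' w' k') (α : I.hor.Cell h h') (β : I.ver.Cell v v') (β' : I.ver.Cell w w')
    (γ : I.hor.Cell k k') : Prop :=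
  ∃ c : I.Cube σ σ', I.top c = α ∧ I.left c = β ∧ I.right c = β' ∧ I.bot c = γ

/-- Two cubes into `σ` with equal top and left faces and with identities as right and bottom faces
are equal, and so are their domains. -/
theorem Star.eq_of_left (hs : I.Star) {A B C D h v w k h' v'} {σ : @I.Sq A B C D h v w k}
    {τ τ' : @I.Sq A B C D h' v' w k} (c : I.Cube τ σ) (c' : I.Cube τ' σ)
    (ht : I.top c = I.top c') (hl : I.left c = I.left c') (hr : I.right c = I.ver.tid w)
    (hb : I.bot c = I.hor.tid k) (hr' : I.right c' = I.ver.tid w) (hb' : I.bot c' = I.hor.tid k) :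
    τ = τ' ∧ HEq c c' := by
  let e : I.SqObj := ⟨σ⟩
  let f : (⟨τ⟩ : I.SqObj) ⟶ e := c
  let f' : (⟨τ'⟩ : I.SqObj) ⟶ e := c'
  -- Both cubes lie over the same pair of left and top faces and over the identity of the right side
  -- and bottom, so they are two lifts of one arrow of V × H.
  have H := (hs.lift_left e (I.boundary₀.map f)).unique (y₁ := ⟨⟨τ⟩, f⟩) (y₂ := ⟨⟨τ'⟩, f'⟩)
    ⟨isHomLift_of_eq _ _ _ rfl, isHomLift_of_eq I.boundary₁ f _ (Prod.ext hr hb)⟩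
    ⟨isHomLift_of_eq I.boundary₀ f' _ (Prod.ext hl.symm ht.symm),
      isHomLift_of_eq I.boundary₁ f' _ (Prod.ext hr' hb')⟩
  obtain ⟨h₁, h₂⟩ := Sigma.mk.inj_iff.mp H
  exact ⟨by simpa using h₁, h₂⟩

/-- Two cubes out of `σ` with equal right and bottom faces and with identities as top and left faces
are equal, and so are their codomains. -/
theorem Star.eq_of_right (hs : I.Star) {A B C D h v w k w' k'} {σ : @I.Sq A B C D h v w k}
    {τ τ' : @I.Sq A B C D h v w' k'} (c : I.Cube σ τ) (c' : I.Cube σ τ')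
    (hr : I.right c = I.right c') (hb : I.bot c = I.bot c') (ht : I.top c = I.hor.tid h)
    (hl : I.left c = I.ver.tid v) (ht' : I.top c' = I.hor.tid h) (hl' : I.left c' = I.ver.tid v) :
    τ = τ' ∧ HEq c c' := by
  let e : I.SqObj := ⟨σ⟩
  let f : e ⟶ (⟨τ⟩ : I.SqObj) := c
  let f' : e ⟶ (⟨τ'⟩ : I.SqObj) := c'
  have H := (hs.lift_right e (I.boundary₁.map f)).unique (y₁ := ⟨⟨τ⟩, f⟩) (y₂ := ⟨⟨τ'⟩, f'⟩)
    ⟨isHomLift_of_eq _ _ _ rfl, isHomLift_of_eq I.boundary₀ f _ (Prod.ext hl ht)⟩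
    ⟨isHomLift_of_eq I.boundary₁ f' _ (Prod.ext hr.symm hb.symm),
      isHomLift_of_eq I.boundary₀ f' _ (Prod.ext hl' ht')⟩
  obtain ⟨h₁, h₂⟩ := Sigma.mk.inj_iff.mp H
  exact ⟨by simpa using h₁, h₂⟩

/-- Under the condition `(*)`, special cubes are identities. -/
theorem Star.special (hs : I.Star) {A B C D h v w k} {σ τ : @I.Sq A B C D h v w k}
    (c : I.Cube σ τ) (ht : I.top c = I.hor.tid h) (hl : I.left c = I.ver.tid v)
    (hr : I.right c = I.ver.tid w) (hb : I.bot c = I.hor.tid k) :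
    σ = τ ∧ HEq c (I.tid σ) := by
  -- The competitor of `c` is the identity cube of τ: both lift the identities of the left side and
  -- top.
  obtain ⟨rfl, H⟩ := hs.eq_of_left c (I.tid τ) (ht.trans (I.top_tid _).symm)
    (hl.trans (I.left_tid _).symm) hr hb (I.right_tid _) (I.bot_tid _)
  exact ⟨rfl, H⟩

/-- Under the condition `(*)`, the interchangers are identities. -/
theorem Star.interchangersIdentities (hs : I.Star) : I.InterchangersIdentities :=
  ⟨fun _ _ _ _ => hs.special _ (I.top_chi _ _ _ _) (I.left_chi _ _ _ _) (I.right_chi _ _ _ _)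
      (I.bot_chi _ _ _ _),
    fun _ _ => hs.special _ (I.top_mu _ _) (I.left_mu _ _) (I.right_mu _ _) (I.bot_mu _ _),
    fun _ _ => hs.special _ (I.top_delta _ _) (I.left_delta _ _) (I.right_delta _ _)
      (I.bot_delta _ _),
    fun _ => hs.special _ (I.top_tau _) (I.left_tau _) (I.right_tau _) (I.bot_tau _)⟩

/-- The lifts provided by `(*)` are objects of the category of basic cells, with arbitrary corners
and sides. The work here is to see that such a lift has the prescribed boundary on the nose, so that
it may be used as a cell of the expected type. -/
theorem Star.exists_left (hs : I.Star) {A B C D h v w k} {h' : I.hor.Arr A B} {v' : I.ver.Arr A C}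
    (σ : @I.Sq A B C D h v w k) (α : I.hor.Cell h' h) (β : I.ver.Cell v' v) :
    ∃ τ : I.Sq h' v' w k, Rel τ σ α β (I.ver.tid w) (I.hor.tid k) := by
  let e : I.SqObj := ⟨σ⟩
  let b : I.ver.ArrObj × I.hor.ArrObj := (⟨v'⟩, ⟨h'⟩)
  let f : b ⟶ I.boundary₀.obj e := (β, α)
  obtain ⟨⟨@⟨_, _, _, _, h'', v'', w'', k'', τ⟩, x⟩, ⟨h₁, h₂⟩, -⟩ := hs.lift_left e f
  -- Lying over `f` fixes the left side and top of the lifted cell, and lying over an identity fixes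
  -- its right side and bottom; the corners are fixed along with them.
  have d₁ : ((⟨v''⟩, ⟨h''⟩) : I.ver.ArrObj × I.hor.ArrObj) = (⟨v'⟩, ⟨h'⟩) :=
    @IsHomLift.domain_eq _ _ _ _ I.boundary₀ _ _ _ _ _ _ h₁
  have d₂ : ((⟨w''⟩, ⟨k''⟩) : I.ver.ArrObj × I.hor.ArrObj) = (⟨w⟩, ⟨k⟩) :=
    @IsHomLift.domain_eq _ _ _ _ I.boundary₁ _ _ _ _ _ _ h₂
  cases d₁
  cases d₂
  have q₁ := Prod.ext_iff.mp (@IsHomLift.eq_of_isHomLift _ _ _ _ I.boundary₀ _ _ _ _ h₁)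
  have q₂ := Prod.ext_iff.mp (@IsHomLift.eq_of_isHomLift _ _ _ _ I.boundary₁ _ _ _ _ h₂)
  exact ⟨τ, x, q₁.2.symm, q₁.1.symm, q₂.1.symm, q₂.2.symm⟩

theorem Star.exists_right (hs : I.Star) {A B C D h v w k} {w' : I.ver.Arr B D} {k' : I.hor.Arr C D}
    (σ : @I.Sq A B C D h v w k) (β : I.ver.Cell w w') (γ : I.hor.Cell k k') :
    ∃ τ : I.Sq h v w' k', Rel σ τ (I.hor.tid h) (I.ver.tid v) β γ := by
  let e : I.SqObj := ⟨σ⟩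
  let b : I.ver.ArrObj × I.hor.ArrObj := (⟨w'⟩, ⟨k'⟩)
  let f : I.boundary₁.obj e ⟶ b := (β, γ)
  obtain ⟨⟨@⟨_, _, _, _, h'', v'', w'', k'', τ⟩, x⟩, ⟨h₁, h₂⟩, -⟩ := hs.lift_right e f
  have d₁ : ((⟨w''⟩, ⟨k''⟩) : I.ver.ArrObj × I.hor.ArrObj) = (⟨w'⟩, ⟨k'⟩) :=
    @IsHomLift.codomain_eq _ _ _ _ I.boundary₁ _ _ _ _ _ _ h₁
  have d₂ : ((⟨v''⟩, ⟨h''⟩) : I.ver.ArrObj × I.hor.ArrObj) = (⟨v⟩, ⟨h⟩) :=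
    @IsHomLift.codomain_eq _ _ _ _ I.boundary₀ _ _ _ _ _ _ h₂
  cases d₁
  cases d₂
  have q₁ := Prod.ext_iff.mp (@IsHomLift.eq_of_isHomLift _ _ _ _ I.boundary₁ _ _ _ _ h₁)
  have q₂ := Prod.ext_iff.mp (@IsHomLift.eq_of_isHomLift _ _ _ _ I.boundary₀ _ _ _ _ h₂)
  exact ⟨τ, x, q₂.2.symm, q₂.1.symm, q₁.1.symm, q₁.2.symm⟩

/-- Every cube factors as a cube with identities as top and left faces followed by a cube with
identities as right and bottom faces. -/
theorem Star.factorization (hs : I.Star) {A B C D h v w k h' v' w' k'} {σ : @I.Sq A B C D h v w k}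
    {σ' : @I.Sq A B C D h' v' w' k'} (c : I.Cube σ σ') :
    ∃ (m : I.Sq h v w' k') (l : I.Cube σ m) (r : I.Cube m σ'),
      (I.top l = I.hor.tid h ∧ I.left l = I.ver.tid v ∧ I.right l = I.right c ∧ I.bot l = I.bot c) ∧
      (I.top r = I.top c ∧ I.left r = I.left c ∧ I.right r = I.ver.tid w' ∧
        I.bot r = I.hor.tid k') ∧ I.tcomp l r = c := by
  let e : I.SqObj := ⟨σ⟩
  let e' : I.SqObj := ⟨σ'⟩
  let f : e ⟶ e' := c
  obtain ⟨@⟨_, _, _, _, h'', v'', w'', k'', τ⟩, l, r, hl, hr, hc⟩ := hs.factor f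
  -- The first factor lies over an identity of the left side and top of σ, the second over an
  -- identity of the right side and bottom of σ'. Together these determine the whole boundary of the
  -- middle cell.
  have d₁ : ((⟨v''⟩, ⟨h''⟩) : I.ver.ArrObj × I.hor.ArrObj) = (⟨v⟩, ⟨h⟩) :=
    @IsHomLift.codomain_eq _ _ _ _ I.boundary₀ _ _ _ _ _ _ hl
  have d₂ : ((⟨w''⟩, ⟨k''⟩) : I.ver.ArrObj × I.hor.ArrObj) = (⟨w'⟩, ⟨k'⟩) :=
    @IsHomLift.domain_eq _ _ _ _ I.boundary₁ _ _ _ _ _ _ hr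
  cases d₁
  cases d₂
  have q₁ := Prod.ext_iff.mp (@IsHomLift.eq_of_isHomLift _ _ _ _ I.boundary₀ _ _ _ _ hl)
  have q₂ := Prod.ext_iff.mp (@IsHomLift.eq_of_isHomLift _ _ _ _ I.boundary₁ _ _ _ _ hr)
  have hc' : I.tcomp l r = c := hc
  have t₁ : I.top l = I.hor.tid h := q₁.2.symm
  have t₂ : I.left l = I.ver.tid v := q₁.1.symm
  have t₃ : I.right r = I.ver.tid w' := q₂.1.symm
  have t₄ : I.bot r = I.hor.tid k' := q₂.2.symm
  -- Each remaining face of a factor is composed in `c` with an identity face of the other factor,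
  -- so it equals the face of `c`.
  refine ⟨τ, l, r, ⟨t₁, t₂, ?_, ?_⟩, ⟨?_, ?_, t₃, t₄⟩, hc'⟩
  · rw [← hc', I.right_tcomp, t₃, I.ver.tcomp_tid]
  · rw [← hc', I.bot_tcomp, t₄, I.hor.tcomp_tid]
  · rw [← hc', I.top_tcomp, t₁, I.hor.tid_tcomp]
  · rw [← hc', I.left_tcomp, t₂, I.ver.tid_tcomp]

/-- Under the condition `(*)`, cubes between basic cells with the same corners are determined by
their boundaries. -/
theorem Star.cube_ext (hs : I.Star) {A B C D h v w k h' v' w' k'} {σ : @I.Sq A B C D h v w k}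
    {σ' : @I.Sq A B C D h' v' w' k'} {c d : I.Cube σ σ'} (ht : I.top c = I.top d)
    (hl : I.left c = I.left d) (hr : I.right c = I.right d) (hb : I.bot c = I.bot d) : c = d := by
  obtain ⟨m, l, r, ⟨a₁, a₂, a₃, a₄⟩, ⟨b₁, b₂, b₃, b₄⟩, rfl⟩ := hs.factorization c
  obtain ⟨m', l', r', ⟨a₁', a₂', a₃', a₄'⟩, ⟨b₁', b₂', b₃', b₄'⟩, rfl⟩ := hs.factorization d
  -- The second factors have the same codomain and the same faces, so uniqueness of lifts into σ'
  -- identifies the two middle cells as well. Only then are the first factors parallel, and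
  -- uniqueness of lifts out of σ compares them.
  obtain ⟨rfl, e⟩ := hs.eq_of_left r r' (by rw [b₁, b₁', ht]) (by rw [b₂, b₂', hl]) b₃ b₄ b₃' b₄'
  obtain ⟨-, e'⟩ := hs.eq_of_right l l' (by rw [a₃, a₃', hr]) (by rw [a₄, a₄', hb]) a₁ a₂ a₁' a₂'
  rw [eq_of_heq e, eq_of_heq e']

/-! ### Calculus of pulling and pushing cells along their boundary -/

section

variable {A B C D : I.Obj} {h h' h'' : I.hor.Arr A B} {v v' v'' : I.ver.Arr A C}
  {w w' w'' : I.ver.Arr B D} {k k' k'' : I.hor.Arr C D}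

theorem Rel.congr {σ : I.Sq h v w k} {σ' : I.Sq h' v' w' k'} {α α₁ β β₁ β' β₁' γ γ₁}
    (H : Rel σ σ' α β β' γ) (e₁ : α = α₁) (e₂ : β = β₁) (e₃ : β' = β₁') (e₄ : γ = γ₁) :
    Rel σ σ' α₁ β₁ β₁' γ₁ := by
  subst e₁ e₂ e₃ e₄
  exact H

theorem rel_tid (σ : I.Sq h v w k) :
    Rel σ σ (I.hor.tid h) (I.ver.tid v) (I.ver.tid w) (I.hor.tid k) :=
  ⟨I.tid σ, I.top_tid _, I.left_tid _, I.right_tid _, I.bot_tid _⟩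

theorem Rel.tcomp {σ : I.Sq h v w k} {σ' : I.Sq h' v' w' k'} {σ'' : I.Sq h'' v'' w'' k''}
    {α β β' γ α₁ β₁ β₁' γ₁} (H : Rel σ σ' α β β' γ) (H' : Rel σ' σ'' α₁ β₁ β₁' γ₁) :
    Rel σ σ'' (I.hor.tcomp α α₁) (I.ver.tcomp β β₁) (I.ver.tcomp β' β₁') (I.hor.tcomp γ γ₁) := by
  obtain ⟨c, rfl, rfl, rfl, rfl⟩ := H
  obtain ⟨c', rfl, rfl, rfl, rfl⟩ := H'
  exact ⟨I.tcomp c c', I.top_tcomp _ _, I.left_tcomp _ _, I.right_tcomp _ _, I.bot_tcomp _ _⟩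

theorem Star.eq_left (hs : I.Star) {σ : I.Sq h v w k} {τ τ' : I.Sq h' v' w k} {α β}
    (H : Rel τ σ α β (I.ver.tid w) (I.hor.tid k)) (H' : Rel τ' σ α β (I.ver.tid w) (I.hor.tid k)) :
    τ = τ' := by
  obtain ⟨c, rfl, rfl, h₁, h₂⟩ := H
  obtain ⟨c', h₃, h₄, h₅, h₆⟩ := H'
  exact (hs.eq_of_left c c' h₃.symm h₄.symm h₁ h₂ h₅ h₆).1

theorem Star.eq_right (hs : I.Star) {σ : I.Sq h v w k} {τ τ' : I.Sq h v w' k'} {β γ}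
    (H : Rel σ τ (I.hor.tid h) (I.ver.tid v) β γ) (H' : Rel σ τ' (I.hor.tid h) (I.ver.tid v) β γ) :
    τ = τ' := by
  obtain ⟨c, h₁, h₂, rfl, rfl⟩ := H
  obtain ⟨c', h₅, h₆, h₃, h₄⟩ := H'
  exact (hs.eq_of_right c c' h₃.symm h₄.symm h₁ h₂ h₅ h₆).1

/-- The special case of trivial faces: the identity cube of τ is also a lift of identities. It turns
special cubes obtained by pasting into equations. -/
theorem Star.eq_of_rel (hs : I.Star) {σ τ : I.Sq h v w k}
    (H : Rel σ τ (I.hor.tid h) (I.ver.tid v) (I.ver.tid w) (I.hor.tid k)) : σ = τ :=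
  hs.eq_left H (rel_tid τ)

theorem Star.factor_rel (hs : I.Star) {σ : I.Sq h v w k} {σ' : I.Sq h' v' w' k'} {α β β' γ}
    (H : Rel σ σ' α β β' γ) : ∃ m : I.Sq h v w' k',
      Rel σ m (I.hor.tid h) (I.ver.tid v) β' γ ∧ Rel m σ' α β (I.ver.tid w') (I.hor.tid k') := by
  obtain ⟨c, rfl, rfl, rfl, rfl⟩ := H
  obtain ⟨m, l, r, hl, hr, -⟩ := hs.factorization c
  exact ⟨m, ⟨l, hl⟩, ⟨r, hr⟩⟩

/-- The domain of the lift with given top and left faces. -/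
noncomputable def Star.pull (hs : I.Star) (α : I.hor.Cell h' h) (β : I.ver.Cell v' v)
    (σ : I.Sq h v w k) : I.Sq h' v' w k :=
  (hs.exists_left σ α β).choose

/-- The codomain of the lift with given right and bottom faces. -/
noncomputable def Star.push (hs : I.Star) (σ : I.Sq h v w k) (β : I.ver.Cell w w')
    (γ : I.hor.Cell k k') : I.Sq h v w' k' :=
  (hs.exists_right σ β γ).choose

theorem Star.rel_pull (hs : I.Star) (α : I.hor.Cell h' h) (β : I.ver.Cell v' v)
    (σ : I.Sq h v w k) : Rel (hs.pull α β σ) σ α β (I.ver.tid w) (I.hor.tid k) :=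
  (hs.exists_left σ α β).choose_spec

theorem Star.rel_push (hs : I.Star) (σ : I.Sq h v w k) (β : I.ver.Cell w w')
    (γ : I.hor.Cell k k') : Rel σ (hs.push σ β γ) (I.hor.tid h) (I.ver.tid v) β γ :=
  (hs.exists_right σ β γ).choose_spec

/-- Uniqueness of lifts in the form in which it is used: to compute a pulled back cell, it suffices
to exhibit a cube with the right faces. `Star.eq_push` is the dual. -/
theorem Star.eq_pull (hs : I.Star) {α : I.hor.Cell h' h} {β : I.ver.Cell v' v} {σ : I.Sq h v w k}
    {τ : I.Sq h' v' w k} (H : Rel τ σ α β (I.ver.tid w) (I.hor.tid k)) : τ = hs.pull α β σ :=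
  hs.eq_left H (hs.rel_pull α β σ)

theorem Star.eq_push (hs : I.Star) {σ : I.Sq h v w k} {β : I.ver.Cell w w'} {γ : I.hor.Cell k k'}
    {τ : I.Sq h v w' k'} (H : Rel σ τ (I.hor.tid h) (I.ver.tid v) β γ) : τ = hs.push σ β γ :=
  hs.eq_right H (hs.rel_push σ β γ)

/-- A cube with given boundary exists if and only if the lifts along its two halves agree. -/
theorem Star.rel_iff (hs : I.Star) {σ : I.Sq h v w k} {σ' : I.Sq h' v' w' k'} {α β β' γ} :
    Rel σ σ' α β β' γ ↔ hs.push σ β' γ = hs.pull α β σ' := by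
  constructor
  · intro H
    obtain ⟨m, h₁, h₂⟩ := hs.factor_rel H
    rw [← hs.eq_push h₁, ← hs.eq_pull h₂]
  -- Conversely, the lift out of σ and the lift into σ' meet in a common cell, and their composite
  -- has the required faces up to identities.
  · intro e
    have H := hs.rel_pull α β σ'
    rw [← e] at H
    refine ((hs.rel_push σ β' γ).tcomp H).congr ?_ ?_ ?_ ?_ <;>
      simp only [WeakDouble.tid_tcomp, WeakDouble.tcomp_tid]

theorem Star.pull_tid (hs : I.Star) (σ : I.Sq h v w k) :
    hs.pull (I.hor.tid h) (I.ver.tid v) σ = σ :=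
  (hs.eq_pull (rel_tid σ)).symm

theorem Star.push_tid (hs : I.Star) (σ : I.Sq h v w k) :
    hs.push σ (I.ver.tid w) (I.hor.tid k) = σ :=
  (hs.eq_push (rel_tid σ)).symm

/-- The composite of two lifting cubes again has identities on the right and bottom, hence is the
lift of the composite cells. -/
theorem Star.pull_pull (hs : I.Star) (α' : I.hor.Cell h'' h') (β' : I.ver.Cell v'' v')
    (α : I.hor.Cell h' h) (β : I.ver.Cell v' v) (σ : I.Sq h v w k) :
    hs.pull α' β' (hs.pull α β σ) = hs.pull (I.hor.tcomp α' α) (I.ver.tcomp β' β) σ :=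
  hs.eq_pull (((hs.rel_pull _ _ _).tcomp (hs.rel_pull _ _ _)).congr rfl rfl
    (I.ver.tcomp_tid _) (I.hor.tcomp_tid _))

theorem Star.push_push (hs : I.Star) (σ : I.Sq h v w k) (β : I.ver.Cell w w')
    (γ : I.hor.Cell k k') (β' : I.ver.Cell w' w'') (γ' : I.hor.Cell k' k'') :
    hs.push (hs.push σ β γ) β' γ' = hs.push σ (I.ver.tcomp β β') (I.hor.tcomp γ γ') :=
  hs.eq_push (((hs.rel_push _ _ _).tcomp (hs.rel_push _ _ _)).congr (I.hor.tcomp_tid _)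
    (I.ver.tcomp_tid _) rfl rfl)

/-- This and the next three statements specialize the composition laws to one moving side, which is
the shape of the associativity axioms of the four actions. -/
theorem Star.pull_tcomp_tid (hs : I.Star) (α' : I.hor.Cell h'' h') (α : I.hor.Cell h' h)
    (σ : I.Sq h v w k) : hs.pull (I.hor.tcomp α' α) (I.ver.tid v) σ =
      hs.pull α' (I.ver.tid v) (hs.pull α (I.ver.tid v) σ) := by
  rw [hs.pull_pull, I.ver.tcomp_tid]

theorem Star.pull_tid_tcomp (hs : I.Star) (β' : I.ver.Cell v'' v') (β : I.ver.Cell v' v)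
    (σ : I.Sq h v w k) : hs.pull (I.hor.tid h) (I.ver.tcomp β' β) σ =
      hs.pull (I.hor.tid h) β' (hs.pull (I.hor.tid h) β σ) := by
  rw [hs.pull_pull, I.hor.tcomp_tid]

theorem Star.push_tcomp_tid (hs : I.Star) (σ : I.Sq h v w k) (β : I.ver.Cell w w')
    (β' : I.ver.Cell w' w'') : hs.push σ (I.ver.tcomp β β') (I.hor.tid k) =
      hs.push (hs.push σ β (I.hor.tid k)) β' (I.hor.tid k) := by
  rw [hs.push_push, I.hor.tcomp_tid]

theorem Star.push_tid_tcomp (hs : I.Star) (σ : I.Sq h v w k) (γ : I.hor.Cell k k')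
    (γ' : I.hor.Cell k' k'') : hs.push σ (I.ver.tid w) (I.hor.tcomp γ γ') =
      hs.push (hs.push σ (I.ver.tid w) γ) (I.ver.tid w) γ' := by
  rw [hs.push_push, I.ver.tcomp_tid]

/-- Moving the top and the left one after the other is the same as moving both together. As this
holds in either order, the two actions commute; the same is done below for the right and bottom. -/
theorem Star.pull_top_left (hs : I.Star) (α : I.hor.Cell h' h) (β : I.ver.Cell v' v)
    (σ : I.Sq h v w k) :
    hs.pull α (I.ver.tid v') (hs.pull (I.hor.tid h) β σ) = hs.pull α β σ := by
  rw [hs.pull_pull, I.hor.tcomp_tid, I.ver.tid_tcomp]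

theorem Star.pull_left_top (hs : I.Star) (α : I.hor.Cell h' h) (β : I.ver.Cell v' v)
    (σ : I.Sq h v w k) :
    hs.pull (I.hor.tid h') β (hs.pull α (I.ver.tid v) σ) = hs.pull α β σ := by
  rw [hs.pull_pull, I.hor.tid_tcomp, I.ver.tcomp_tid]

theorem Star.push_right_bot (hs : I.Star) (σ : I.Sq h v w k) (β : I.ver.Cell w w')
    (γ : I.hor.Cell k k') :
    hs.push (hs.push σ β (I.hor.tid k)) (I.ver.tid w') γ = hs.push σ β γ := by
  rw [hs.push_push, I.hor.tid_tcomp, I.ver.tcomp_tid]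

theorem Star.push_bot_right (hs : I.Star) (σ : I.Sq h v w k) (β : I.ver.Cell w w')
    (γ : I.hor.Cell k k') :
    hs.push (hs.push σ (I.ver.tid w) γ) β (I.hor.tid k') = hs.push σ β γ := by
  rw [hs.push_push, I.hor.tcomp_tid, I.ver.tid_tcomp]

/-- The lift into σ followed by the lift out of σ is a cube with faces α, β, β', γ, and
`Star.rel_iff` for this cube is the claimed commutation. -/
theorem Star.pull_push (hs : I.Star) (α : I.hor.Cell h' h) (β : I.ver.Cell v' v)
    (σ : I.Sq h v w k) (β' : I.ver.Cell w w') (γ : I.hor.Cell k k') :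
    hs.pull α β (hs.push σ β' γ) = hs.push (hs.pull α β σ) β' γ := by
  symm
  apply hs.rel_iff.mp
  refine ((hs.rel_pull α β σ).tcomp (hs.rel_push σ β' γ)).congr ?_ ?_ ?_ ?_ <;>
      simp only [WeakDouble.tid_tcomp, WeakDouble.tcomp_tid]

end

/-! ### Pasting of cubes -/

section

variable {A B C D E F : I.Obj}

/-- Witnessing cubes that share the face β' can be pasted along it. The hypotheses `e₁` and `e₂`
would follow from the cubes, but they are needed already to write down the composite faces. -/
theorem Rel.sqH {h₀ h₀' : I.hor.Arr A B} {h₁ h₁' : I.hor.Arr B C} {k₀ k₀' : I.hor.Arr D E}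
    {k₁ k₁' : I.hor.Arr E F} {v v' : I.ver.Arr A D} {w w' : I.ver.Arr B E} {x x' : I.ver.Arr C F}
    {σ : I.Sq h₀ v w k₀} {ρ : I.Sq h₁ w x k₁} {σ' : I.Sq h₀' v' w' k₀'} {ρ' : I.Sq h₁' w' x' k₁'}
    {α₀ α₁ β β' β'' γ₀ γ₁} (H : Rel σ σ' α₀ β β' γ₀) (H' : Rel ρ ρ' α₁ β' β'' γ₁)
    (e₁ : I.hor.tgt α₀ = I.hor.src α₁) (e₂ : I.hor.tgt γ₀ = I.hor.src γ₁) :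
    Rel (I.sqH σ ρ) (I.sqH σ' ρ') (I.hor.compCell α₀ α₁ e₁) β β'' (I.hor.compCell γ₀ γ₁ e₂) := by
  obtain ⟨c, rfl, rfl, rfl, rfl⟩ := H
  obtain ⟨d, rfl, e, rfl, rfl⟩ := H'
  exact ⟨I.cubeH c d e.symm, I.top_cubeH _ _ _, I.left_cubeH _ _ _, I.right_cubeH _ _ _,
    I.bot_cubeH _ _ _⟩

theorem Rel.sqV {h h' : I.hor.Arr A B} {k k' : I.hor.Arr C D} {l l' : I.hor.Arr E F}
    {v₀ v₀' : I.ver.Arr A C} {v₁ v₁' : I.ver.Arr C E} {w₀ w₀' : I.ver.Arr B D}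
    {w₁ w₁' : I.ver.Arr D F} {σ : I.Sq h v₀ w₀ k} {ρ : I.Sq k v₁ w₁ l} {σ' : I.Sq h' v₀' w₀' k'}
    {ρ' : I.Sq k' v₁' w₁' l'} {α γ δ β₀ β₁ β₀' β₁'} (H : Rel σ σ' α β₀ β₀' γ)
    (H' : Rel ρ ρ' γ β₁ β₁' δ) (e₁ : I.ver.tgt β₀ = I.ver.src β₁)
    (e₂ : I.ver.tgt β₀' = I.ver.src β₁') :
    Rel (I.sqV σ ρ) (I.sqV σ' ρ') α (I.ver.compCell β₀ β₁ e₁) (I.ver.compCell β₀' β₁' e₂) δ := by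
  obtain ⟨c, rfl, rfl, rfl, rfl⟩ := H
  obtain ⟨d, e, rfl, rfl, rfl⟩ := H'
  exact ⟨I.cubeV c d e.symm, I.top_cubeV _ _ _, I.left_cubeV _ _ _, I.right_cubeV _ _ _,
    I.bot_cubeV _ _ _⟩

end

end Intercategory

/-! ### From strict functors of weak double categories to strict functors of bicategories -/

theorem GCell.heq_of_inj {X : Type u} {B : Bicategory.{w, v} X} {a b : X} {f g f' g' : BArr B a b}
    {α : f ⟶ g} {β : f' ⟶ g'} (hf : f = f') (hg : g = g') (h : HEq (of α) (of β)) : HEq α β := by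
  subst hf hg
  exact heq_of_eq (of_inj (eq_of_heq h))

section

variable {X Y : Type u} {B : Bicategory.{w, v} X} {C : Bicategory.{w, v} Y}

open Bicategory

/-- The strict functor of bicategories underlying a strict functor of weak double categories. -/
def BicatFunctor.ofStrictFunctor {F : @CategoryTheory.Functor X (trivCat.{u, w} X) Y (trivCat.{u, w} Y)}
    (P : @WeakDouble.StrictFunctor X Y (trivCat X) (trivCat Y) (.ofBicategory B) (.ofBicategory C)
      F) :
    BicatFunctor B C (@Functor.obj X (trivCat X) Y (trivCat Y) F) :=
  letI := trivCat.{u, w} X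
  letI := trivCat.{u, w} Y
  let m {a b : X} (f : BArr B a b) : BArr C (F.obj a) (F.obj b) := P.arr f
  have hc {a b c : X} (f : BArr B a b) (g : BArr B b c) : m (f ≫ g) = m f ≫ m g := P.arr_comp f g
  have hi (a : X) : m (bid B a) = bid C (F.obj a) := P.arr_idArr a
  -- The cell `P.cell (GCell.of α)` contains equalities of an object with itself. Transport along
  -- these is definitionally trivial, so the underlying 2-cell has the type stated here.
  let m₂ {a b : X} {f g : BArr B a b} (α : f ⟶ g) : m f ⟶ m g :=
    GCell.cell (B := C) (f := m f) (f' := m g) (P.cell (GCell.of α))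
  have ht {a b : X} (f : BArr B a b) : m₂ (𝟙 f) = 𝟙 (m f) := GCell.of_inj (P.cell_tid f)
  { map := m
    map₂ := m₂
    map₂_id := ht
    map₂_comp := fun α β => GCell.of_inj (P.cell_tcomp (GCell.of α) (GCell.of β))
    map_bid := hi
    map_comp := hc
    map₂_whiskerLeft := by
      intro a b c f g h α
      -- Whiskering is composition with an identity cell: the composite is a whiskered identity
      -- followed by the wanted whiskering, and the former cancels on both sides because `P`
      -- preserves identities.
      have H := P.cell_compCell (GCell.of (𝟙 f)) (GCell.of α) rfl
      have H' := GCell.heq_of_inj (α := m₂ (𝟙 f ▷ g ≫ f ◁ α)) (β := m₂ (𝟙 f) ▷ m g ≫ m f ◁ m₂ α)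
        (hc f g) (hc f h) H
      rw [ht, id_whiskerRight, id_whiskerRight, Category.id_comp, Category.id_comp] at H'
      exact H'
    map₂_whiskerRight := by
      intro a b c f g α h
      have H := P.cell_compCell (GCell.of α) (GCell.of (𝟙 h)) rfl
      have H' := GCell.heq_of_inj (α := m₂ (α ▷ h ≫ g ◁ 𝟙 h)) (β := m₂ α ▷ m h ≫ m g ◁ m₂ (𝟙 h))
        (hc f h) (hc g h) H
      rw [ht, whiskerLeft_id, whiskerLeft_id, Category.comp_id, Category.comp_id] at H'
      exact H'
    map₂_associator := fun f g h => GCell.heq_of_inj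
      (by rw [hc, hc]) (by rw [hc, hc]) (P.cell_assoc f g h)
    map₂_leftUnitor := fun f => GCell.heq_of_inj (by rw [hc, hi]) rfl (P.cell_lunit f)
    map₂_rightUnitor := fun f => GCell.heq_of_inj (by rw [hc, hi]) rfl (P.cell_runit f) }

/-- Passing to 2-cells loses nothing: after substituting the equalities of endpoints, every cell is
given by a 2-cell, and there the two maps agree by definition. -/
theorem BicatFunctor.map_ofStrictFunctor
    {F : @CategoryTheory.Functor X (trivCat.{u, w} X) Y (trivCat.{u, w} Y)}
    (P : @WeakDouble.StrictFunctor X Y (trivCat X) (trivCat Y) (.ofBicategory B) (.ofBicategory C)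
      F) {a b a' b' : X} {f : BArr B a b} {f' : BArr B a' b'} (φ : GCell B f f') :
    GCell.map (BicatFunctor.ofStrictFunctor P) φ =
      @WeakDouble.StrictFunctor.cell _ _ (_) (_) _ _ _ P _ _ _ _ f f' φ := by
  obtain ⟨rfl, rfl, α⟩ := φ
  rfl

end

/-! ### Full faithfulness -/

namespace DoubleBicategory

variable {D E : DoubleBicategory.{u, v, w}}

/-- The condition `Rel` is the existence of a cube. Its image under `P` is a cube whose faces are
the images of the given faces, and the condition carried by that cube is the conclusion. -/
theorem rel_strictFunctor (P : Intercategory.StrictFunctor D.toIntercategory E.toIntercategory)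
    {a b c d h v w k h' v' w' k'} {σ : @D.Sq a b c d h v w k}
    {σ' : @D.Sq a b c d h' v' w' k'} {α : h ⟶ h'} {β : v ⟶ v'} {β' : w ⟶ w'} {γ : k ⟶ k'}
    (H : D.Rel σ σ' α β β' γ) : E.Rel (P.sq σ) (P.sq σ')
      ((BicatFunctor.ofStrictFunctor P.hor).map₂ α) ((BicatFunctor.ofStrictFunctor P.ver).map₂ β)
      ((BicatFunctor.ofStrictFunctor P.ver).map₂ β')
      ((BicatFunctor.ofStrictFunctor P.hor).map₂ γ) := by
  let c : D.toIntercategory.Cube σ σ' := DCube.of H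
  let x : E.DCube (P.sq σ) (P.sq σ') := P.cube c
  have hx : E.Cond (P.sq σ) (P.sq σ') x.top x.left x.right x.bot := x.cond
  have ht : x.top = P.hor.cell (D.toIntercategory.top c) := P.top_cube c
  have hl : x.left = P.ver.cell (D.toIntercategory.left c) := P.left_cube c
  have hr : x.right = P.ver.cell (D.toIntercategory.right c) := P.right_cube c
  have hb : x.bot = P.hor.cell (D.toIntercategory.bot c) := P.bot_cube c
  rw [ht, hl, hr, hb] at hx
  exact hx

/-- A square obtained by an action is characterized by a cube whose other three faces are
identities. These faces are kept as variables with equations because the image of an identity 2-cell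
under a strict functor is only provably an identity. The next three statements treat the other
sides. -/
theorem eq_actT_of_rel {a b c d h h' v w k} {τ : @D.Sq a b c d h' v w k} {σ : D.Sq h v w k}
    {α : h' ⟶ h} {β β' γ} (H : D.Rel τ σ α β β' γ) (e₁ : β = 𝟙 v) (e₂ : β' = 𝟙 w) (e₃ : γ = 𝟙 k) :
    τ = D.actT α σ := by
  subst e₁ e₂ e₃
  simpa only [Rel, D.actL_id, D.actR_id, D.actB_id] using H

theorem eq_actL_of_rel {a b c d h v v' w k} {τ : @D.Sq a b c d h v' w k} {σ : D.Sq h v w k}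
    {β : v' ⟶ v} {α β' γ} (H : D.Rel τ σ α β β' γ) (e₁ : α = 𝟙 h) (e₂ : β' = 𝟙 w) (e₃ : γ = 𝟙 k) :
    τ = D.actL β σ := by
  subst e₁ e₂ e₃
  simpa only [Rel, D.actT_id, D.actR_id, D.actB_id] using H

theorem eq_actR_of_rel {a b c d h v w w' k} {σ : @D.Sq a b c d h v w k} {τ : D.Sq h v w' k}
    {β' : w ⟶ w'} {α β γ} (H : D.Rel σ τ α β β' γ) (e₁ : α = 𝟙 h) (e₂ : β = 𝟙 v) (e₃ : γ = 𝟙 k) :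
    τ = D.actR σ β' := by
  subst e₁ e₂ e₃
  simpa only [Rel, D.actT_id, D.actL_id, D.actB_id] using H.symm

theorem eq_actB_of_rel {a b c d h v w k k'} {σ : @D.Sq a b c d h v w k} {τ : D.Sq h v w k'}
    {γ : k ⟶ k'} {α β β'} (H : D.Rel σ τ α β β' γ) (e₁ : α = 𝟙 h) (e₂ : β = 𝟙 v) (e₃ : β' = 𝟙 w) :
    τ = D.actB σ γ := by
  subst e₁ e₂ e₃
  simpa only [Rel, D.actT_id, D.actL_id, D.actR_id] using H.symm

/-- The strict functor of double bicategories underlying a strict functor between their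
intercategories. -/
def StrictFunctor.ofIntercategory
    (P : Intercategory.StrictFunctor D.toIntercategory E.toIntercategory) : StrictFunctor D E where
  obj := P.obj.obj
  hor := .ofStrictFunctor P.hor
  ver := .ofStrictFunctor P.ver
  sq σ := P.sq σ
  -- Preservation of the actions is not among the hypotheses on `P`. It is deduced by applying `P`
  -- to the cube that joins a square to the result of the action; the other three actions are
  -- treated in the same way.
  sq_actT {a b c d h h' v w k} α σ := by
    have H := rel_lift_left σ α (𝟙 v)
    rw [D.actL_id] at H
    exact eq_actT_of_rel (rel_strictFunctor P H) (BicatFunctor.map₂_id _ _)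
      (BicatFunctor.map₂_id _ _) (BicatFunctor.map₂_id _ _)
  sq_actL {a b c d h v v' w k} β σ := by
    have H := rel_lift_left σ (𝟙 h) β
    rw [D.actT_id] at H
    exact eq_actL_of_rel (rel_strictFunctor P H) (BicatFunctor.map₂_id _ _)
      (BicatFunctor.map₂_id _ _) (BicatFunctor.map₂_id _ _)
  sq_actR {a b c d h v w w' k} σ β := by
    have H := rel_lift_right σ β (𝟙 k)
    rw [D.actB_id] at H
    exact eq_actR_of_rel (rel_strictFunctor P H) (BicatFunctor.map₂_id _ _)
      (BicatFunctor.map₂_id _ _) (BicatFunctor.map₂_id _ _)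
  sq_actB {a b c d h v w k k'} σ γ := by
    have H := rel_lift_right σ (𝟙 w) γ
    rw [D.actR_id] at H
    exact eq_actB_of_rel (rel_strictFunctor P H) (BicatFunctor.map₂_id _ _)
      (BicatFunctor.map₂_id _ _) (BicatFunctor.map₂_id _ _)
  sq_hc σ ρ := P.sq_sqH σ ρ
  sq_vc σ ρ := P.sq_sqV σ ρ
  sq_hi v := P.sq_sqHid v
  sq_vi h := P.sq_sqVid h

/-- The values on objects, arrows, 2-cells and squares are returned unchanged, and the remaining
fields are propositions. -/
theorem ofIntercategory_toIntercategory (F : StrictFunctor D E) :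
    StrictFunctor.ofIntercategory (StrictFunctor.toIntercategory F) = F := rfl

/-- The two functors have the same values on objects, arrows and squares by definition. On cubes
they agree because a cube is determined by its faces and `P` commutes with taking faces. -/
theorem toIntercategory_ofIntercategory
    (P : Intercategory.StrictFunctor D.toIntercategory E.toIntercategory) :
    StrictFunctor.toIntercategory (StrictFunctor.ofIntercategory P) = P := by
  refine Intercategory.strictFunctor_ext rfl (heq_of_eq (WeakDouble.strictFunctor_ext rfl
    (heq_of_eq ?_))) (heq_of_eq (WeakDouble.strictFunctor_ext rfl (heq_of_eq ?_))) HEq.rfl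
    (heq_of_eq ?_)
  · funext a b a' b' f f' φ
    exact BicatFunctor.map_ofStrictFunctor P.hor φ
  · funext a b a' b' f f' φ
    exact BicatFunctor.map_ofStrictFunctor P.ver φ
  · funext _ _ _ _ _ _ _ _ _ _ _ _ _ _ _ _ _ _ x
    exact DCube.ext ((BicatFunctor.map_ofStrictFunctor P.hor x.top).trans (P.top_cube x).symm)
      ((BicatFunctor.map_ofStrictFunctor P.ver x.left).trans (P.left_cube x).symm)
      ((BicatFunctor.map_ofStrictFunctor P.ver x.right).trans (P.right_cube x).symm)
      ((BicatFunctor.map_ofStrictFunctor P.hor x.bot).trans (P.bot_cube x).symm)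

instance correspondence_faithful : correspondence.{u, v, w}.Faithful where
  map_injective {D E F G} e :=
    (ofIntercategory_toIntercategory (D := D) (E := E) F).symm.trans
      ((congrArg StrictFunctor.ofIntercategory (congrArg (fun f => f.hom) e)).trans
        (ofIntercategory_toIntercategory (D := D) (E := E) G))

instance correspondence_full : correspondence.{u, v, w}.Full where
  map_surjective {D E} P := ⟨StrictFunctor.ofIntercategory (D := D) (E := E) P.hom,
    ObjectProperty.hom_ext _ (toIntercategory_ofIntercategory (D := D) (E := E) P.hom)⟩

end DoubleBicategory

/-! ### The bicategory of a weak double category with only identity strict arrows -/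

namespace WeakDouble

section

variable {A : Type u} [Category.{w} A] (W : WeakDouble.{u, v, w} A)

theorem compCell_congr {a b c a' b' c' : A} {f : W.Arr a b} {g : W.Arr b c}
    {f' : W.Arr a' b'} {g' : W.Arr b' c'} {φ φ₁ : W.Cell f f'} {ψ ψ₁ : W.Cell g g'}
    (e : φ = φ₁) (e' : ψ = ψ₁) (h : W.tgt φ = W.src ψ) (h₁ : W.tgt φ₁ = W.src ψ₁) :
    W.compCell φ ψ h = W.compCell φ₁ ψ₁ h₁ := by
  subst e e'
  rfl

variable [IsDiscrete A]

/-- The composition of cells of a weak double category whose strict arrows are identities. -/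
def dcomp {a b c : A} {f f' : W.Arr a b} {g g' : W.Arr b c} (φ : W.Cell f f')
    (ψ : W.Cell g g') : W.Cell (W.comp f g) (W.comp f' g') :=
  W.compCell φ ψ (Subsingleton.elim _ _)

theorem dcomp_tid {a b c : A} (f : W.Arr a b) (g : W.Arr b c) :
    W.dcomp (W.tid f) (W.tid g) = W.tid (W.comp f g) :=
  W.compCell_tid f g

theorem dcomp_tcomp {a b c : A} {f f' f'' : W.Arr a b} {g g' g'' : W.Arr b c} (φ : W.Cell f f')
    (ψ : W.Cell g g') (φ' : W.Cell f' f'') (ψ' : W.Cell g' g'') :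
    W.dcomp (W.tcomp φ φ') (W.tcomp ψ ψ') = W.tcomp (W.dcomp φ ψ) (W.dcomp φ' ψ') :=
  W.compCell_tcomp φ ψ φ' ψ' _ _

theorem tid_dcomp_tcomp {a b c : A} (f : W.Arr a b) {g g' g'' : W.Arr b c}
    (ψ : W.Cell g g') (ψ' : W.Cell g' g'') :
    W.dcomp (W.tid f) (W.tcomp ψ ψ') = W.tcomp (W.dcomp (W.tid f) ψ) (W.dcomp (W.tid f) ψ') := by
  rw [← dcomp_tcomp, W.tid_tcomp]

theorem tcomp_dcomp_tid {a b c : A} {f f' f'' : W.Arr a b} (φ : W.Cell f f')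
    (φ' : W.Cell f' f'') (g : W.Arr b c) :
    W.dcomp (W.tcomp φ φ') (W.tid g) = W.tcomp (W.dcomp φ (W.tid g)) (W.dcomp φ' (W.tid g)) := by
  rw [← dcomp_tcomp, W.tid_tcomp]

/-- Functoriality of composition splits a composite of cells into two whiskerings. Comparison with
the opposite order in `tcomp_dcomp'` is the exchange law of a bicategory. -/
theorem tcomp_dcomp {a b c : A} {f f' : W.Arr a b} {g g' : W.Arr b c} (φ : W.Cell f f')
    (ψ : W.Cell g g') :
    W.tcomp (W.dcomp φ (W.tid g)) (W.dcomp (W.tid f') ψ) = W.dcomp φ ψ := by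
  rw [← dcomp_tcomp, W.tcomp_tid, W.tid_tcomp]

theorem tcomp_dcomp' {a b c : A} {f f' : W.Arr a b} {g g' : W.Arr b c} (φ : W.Cell f f')
    (ψ : W.Cell g g') :
    W.tcomp (W.dcomp (W.tid f) ψ) (W.dcomp φ (W.tid g')) = W.dcomp φ ψ := by
  rw [← dcomp_tcomp, W.tcomp_tid, W.tid_tcomp]

theorem dassoc_nat {a b c d : A} {f f' : W.Arr a b} {g g' : W.Arr b c} {k k' : W.Arr c d}
    (φ : W.Cell f f') (ψ : W.Cell g g') (θ : W.Cell k k') :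
    W.tcomp (W.dcomp (W.dcomp φ ψ) θ) (W.assoc f' g' k') =
      W.tcomp (W.assoc f g k) (W.dcomp φ (W.dcomp ψ θ)) :=
  W.assoc_nat φ ψ θ (Subsingleton.elim _ _) (Subsingleton.elim _ _)

/-- The only strict endomorphism of an object is its identity. This turns the unit naturality
squares, which involve identity cells on strict arrows, into statements about whiskering by an
identity arrow. -/
theorem idCell_eq_tid {a : A} (t : a ⟶ a) : W.idCell t = W.tid (W.idArr a) := by
  rw [Subsingleton.elim t (𝟙 a), W.idCell_id]

theorem dlunit_nat {a b : A} {f f' : W.Arr a b} (φ : W.Cell f f') :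
    W.tcomp (W.dcomp (W.tid (W.idArr a)) φ) (W.lunit f') = W.tcomp (W.lunit f) φ :=
  (congrArg (W.tcomp · _) (W.compCell_congr (W.idCell_eq_tid _).symm rfl _ _)).trans
    (W.lunit_nat φ)

theorem drunit_nat {a b : A} {f f' : W.Arr a b} (φ : W.Cell f f') :
    W.tcomp (W.dcomp φ (W.tid (W.idArr b))) (W.runit f') = W.tcomp (W.runit f) φ :=
  (congrArg (W.tcomp · _) (W.compCell_congr rfl (W.idCell_eq_tid _).symm _ _)).trans
    (W.runit_nat φ)

/-- The category of parallel arrows and the cells between them. -/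
@[reducible]
def homCategory (a b : A) : Category.{w} (W.Arr a b) where
  Hom f g := W.Cell f g
  id f := W.tid f
  comp φ ψ := W.tcomp φ ψ
  id_comp φ := W.tid_tcomp φ
  comp_id φ := W.tcomp_tid φ
  assoc φ ψ θ := W.tcomp_assoc φ ψ θ

/-- The associativity constraint as an isomorphism. -/
noncomputable def assocIso {a b c d : A} (f : W.Arr a b) (g : W.Arr b c) (k : W.Arr c d) :
    letI := W.homCategory a d
    W.comp (W.comp f g) k ≅ W.comp f (W.comp g k) :=
  letI := W.homCategory a d
  { hom := W.assoc f g k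
    inv := (W.assoc_iso f g k).choose
    hom_inv_id := (W.assoc_iso f g k).choose_spec.1
    inv_hom_id := (W.assoc_iso f g k).choose_spec.2 }

/-- The left unit constraint as an isomorphism. -/
noncomputable def lunitIso {a b : A} (f : W.Arr a b) :
    letI := W.homCategory a b
    W.comp (W.idArr a) f ≅ f :=
  letI := W.homCategory a b
  { hom := W.lunit f
    inv := (W.lunit_iso f).choose
    hom_inv_id := (W.lunit_iso f).choose_spec.1
    inv_hom_id := (W.lunit_iso f).choose_spec.2 }

/-- The right unit constraint as an isomorphism. -/
noncomputable def runitIso {a b : A} (f : W.Arr a b) :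
    letI := W.homCategory a b
    W.comp f (W.idArr b) ≅ f :=
  letI := W.homCategory a b
  { hom := W.runit f
    inv := (W.runit_iso f).choose
    hom_inv_id := (W.runit_iso f).choose_spec.1
    inv_hom_id := (W.runit_iso f).choose_spec.2 }

/-- Naturality of the constraints is a commuting square in a weak double category, whereas the
axioms of `Bicategory` express one whiskering as a conjugate of another. This lemma and the next
pass between the two forms. -/
theorem eq_conj {C : Type*} [Category* C] {a b c d : C} {f : a ⟶ b} (i : a ≅ c) (j : b ≅ d)
    {g : c ⟶ d} (h : f ≫ j.hom = i.hom ≫ g) : f = i.hom ≫ g ≫ j.inv := by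
  rw [← Category.assoc, ← h, Category.assoc, Iso.hom_inv_id, Category.comp_id]

theorem eq_conj' {C : Type*} [Category* C] {a b c d : C} {f : a ⟶ b} (i : a ≅ c) (j : b ≅ d)
    {g : c ⟶ d} (h : f ≫ j.hom = i.hom ≫ g) : g = i.inv ≫ f ≫ j.hom := by
  rw [h, Iso.inv_hom_id_assoc]

/-- A weak double category whose strict arrows are identities as a bicategory. -/
@[reducible]
noncomputable def toBicategory : Bicategory.{w, v} A where
  Hom := W.Arr
  id := W.idArr
  comp := W.comp
  homCategory := W.homCategory
  whiskerLeft f _ _ η := W.dcomp (W.tid f) η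
  whiskerRight η h := W.dcomp η (W.tid h)
  associator := W.assocIso
  leftUnitor := W.lunitIso
  rightUnitor := W.runitIso
  whiskerLeft_id f g := W.dcomp_tid f g
  whiskerLeft_comp f _ _ _ η θ := W.tid_dcomp_tcomp f η θ
  id_whiskerLeft {a b f g} η :=
    letI := W.homCategory a b
    eq_conj (W.lunitIso f) (W.lunitIso g) (W.dlunit_nat η)
  comp_whiskerLeft {a b c d} f g h h' η :=
    letI := W.homCategory a d
    eq_conj (W.assocIso f g h) (W.assocIso f g h') (by
      -- Naturality of the associator in its last argument; the composite of the two identity cells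
      -- is the identity of the composite arrow.
      have := W.dassoc_nat (W.tid f) (W.tid g) η
      rwa [dcomp_tid] at this)
  id_whiskerRight f g := W.dcomp_tid f g
  comp_whiskerRight η θ i := W.tcomp_dcomp_tid η θ i
  whiskerRight_id {a b f g} η :=
    letI := W.homCategory a b
    eq_conj (W.runitIso f) (W.runitIso g) (W.drunit_nat η)
  whiskerRight_comp {a b c d f f'} η g h :=
    letI := W.homCategory a d
    eq_conj' (W.assocIso f g h) (W.assocIso f' g h) (by
      have := W.dassoc_nat η (W.tid g) (W.tid h)
      rwa [dcomp_tid] at this)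
  whisker_assoc {a b c d} f g g' η h :=
    letI := W.homCategory a d
    eq_conj (W.assocIso f g h) (W.assocIso f g' h) (W.dassoc_nat (W.tid f) η (W.tid h))
  whisker_exchange η θ := (W.tcomp_dcomp' η θ).trans (W.tcomp_dcomp η θ).symm
  pentagon f g h i := (W.tcomp_assoc _ _ _).symm.trans (W.pentagon f g h i)
  triangle f g := W.triangle f g

end

end WeakDouble

/-! ### The double bicategory of an intercategory satisfying `(*)` -/

namespace Intercategory

variable {I : Intercategory.{u, v, w}} [IsDiscrete I.Obj]

section

variable {A B C D E F : I.Obj}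

/-- The compatibility conditions of `Rel.sqH` are automatic here, since parallel transversal arrows
are equal. -/
theorem Rel.hc {h₀ h₀' : I.hor.Arr A B} {h₁ h₁' : I.hor.Arr B C} {k₀ k₀' : I.hor.Arr D E}
    {k₁ k₁' : I.hor.Arr E F} {v v' : I.ver.Arr A D} {w w' : I.ver.Arr B E} {x x' : I.ver.Arr C F}
    {σ : I.Sq h₀ v w k₀} {ρ : I.Sq h₁ w x k₁} {σ' : I.Sq h₀' v' w' k₀'} {ρ' : I.Sq h₁' w' x' k₁'}
    {α₀ α₁ β β' β'' γ₀ γ₁} (H : Rel σ σ' α₀ β β' γ₀) (H' : Rel ρ ρ' α₁ β' β'' γ₁) :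
    Rel (I.sqH σ ρ) (I.sqH σ' ρ') (I.hor.dcomp α₀ α₁) β β'' (I.hor.dcomp γ₀ γ₁) :=
  H.sqH H' _ _

theorem Rel.vc {h h' : I.hor.Arr A B} {k k' : I.hor.Arr C D} {l l' : I.hor.Arr E F}
    {v₀ v₀' : I.ver.Arr A C} {v₁ v₁' : I.ver.Arr C E} {w₀ w₀' : I.ver.Arr B D}
    {w₁ w₁' : I.ver.Arr D F} {σ : I.Sq h v₀ w₀ k} {ρ : I.Sq k v₁ w₁ l} {σ' : I.Sq h' v₀' w₀' k'}
    {ρ' : I.Sq k' v₁' w₁' l'} {α γ δ β₀ β₁ β₀' β₁'} (H : Rel σ σ' α β₀ β₀' γ)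
    (H' : Rel ρ ρ' γ β₁ β₁' δ) :
    Rel (I.sqV σ ρ) (I.sqV σ' ρ') α (I.ver.dcomp β₀ β₁) (I.ver.dcomp β₀' β₁') δ :=
  H.sqV H' _ _

/-- The top and bottom of the horizontal identity cube on β are identity cells on transversal
arrows, and these arrows are identities. -/
theorem rel_hi {v v' : I.ver.Arr A B} (β : I.ver.Cell v v') :
    Rel (I.sqHid v) (I.sqHid v') (I.hor.tid _) β β (I.hor.tid _) :=
  ⟨I.cubeHid β, (I.top_cubeHid _).trans (I.hor.idCell_eq_tid _), I.left_cubeHid _,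
    I.right_cubeHid _, (I.bot_cubeHid _).trans (I.hor.idCell_eq_tid _)⟩

theorem rel_vi {h h' : I.hor.Arr A B} (α : I.hor.Cell h h') :
    Rel (I.sqVid h) (I.sqVid h') α (I.ver.tid _) (I.ver.tid _) α :=
  ⟨I.cubeVid α, I.top_cubeVid _, (I.left_cubeVid _).trans (I.ver.idCell_eq_tid _),
    (I.right_cubeVid _).trans (I.ver.idCell_eq_tid _), I.bot_cubeVid _⟩

end

/-- The double bicategory of an intercategory satisfying `(*)` whose transversal arrows are
identities. -/
noncomputable def Star.toDoubleBicategory (hs : I.Star) : DoubleBicategory.{u, v, w} where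
  Obj := I.Obj
  hor := I.hor.toBicategory
  ver := I.ver.toBicategory
  Sq h v w k := I.Sq h v w k
  -- Each action lifts a cell on one side together with the identity on the side paired with it in
  -- the span of `(*)`: top with left, right with bottom.
  actT α σ := hs.pull α (I.ver.tid _) σ
  actL β σ := hs.pull (I.hor.tid _) β σ
  actR σ β := hs.push σ β (I.hor.tid _)
  actB σ γ := hs.push σ (I.ver.tid _) γ
  actT_id σ := hs.pull_tid σ
  actL_id σ := hs.pull_tid σ
  actR_id σ := hs.push_tid σ
  actB_id σ := hs.push_tid σ
  actT_comp α' α σ := hs.pull_tcomp_tid α' α σ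
  actL_comp β' β σ := hs.pull_tid_tcomp β' β σ
  actR_comp σ β β' := hs.push_tcomp_tid σ β β'
  actB_comp σ γ γ' := hs.push_tid_tcomp σ γ γ'
  actT_actL α β σ := (hs.pull_top_left α β σ).trans (hs.pull_left_top α β σ).symm
  actT_actR _ _ _ := hs.pull_push _ _ _ _ _
  actT_actB _ _ _ := hs.pull_push _ _ _ _ _
  actL_actR _ _ _ := hs.pull_push _ _ _ _ _
  actL_actB _ _ _ := hs.pull_push _ _ _ _ _
  actR_actB σ β γ := (hs.push_right_bot σ β γ).trans (hs.push_bot_right σ β γ).symm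
  hc σ ρ := I.sqH σ ρ
  -- Pasting a lifting cube with the identity cube of the other square gives a cube of the shape
  -- that characterizes the lift of the composite. Compatibility of both pastings with the actions
  -- on outer sides is proved in this way.
  hc_actL _ _ ρ := hs.eq_pull (((hs.rel_pull _ _ _).hc (rel_tid ρ)).congr (I.hor.dcomp_tid _ _)
    rfl rfl (I.hor.dcomp_tid _ _))
  hc_actR σ _ _ := hs.eq_push (((rel_tid σ).hc (hs.rel_push _ _ _)).congr (I.hor.dcomp_tid _ _)
    rfl rfl (I.hor.dcomp_tid _ _))
  -- The lift out of σ along β and the lift into ρ along β have β as a common face. Pasted along it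
  -- they form a special cube, which forces its two ends to be equal; it runs against the direction
  -- of the stated equation.
  hc_mid σ β ρ := (hs.eq_of_rel (((hs.rel_push σ β _).hc (hs.rel_pull _ β ρ)).congr
    (I.hor.dcomp_tid _ _) rfl rfl (I.hor.dcomp_tid _ _))).symm
  hc_actT_left _ _ ρ := hs.eq_pull (((hs.rel_pull _ _ _).hc (rel_tid ρ)).congr rfl
    rfl rfl (I.hor.dcomp_tid _ _))
  hc_actT_right σ _ _ := hs.eq_pull (((rel_tid σ).hc (hs.rel_pull _ _ _)).congr rfl
    rfl rfl (I.hor.dcomp_tid _ _))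
  hc_actB_left _ _ ρ := hs.eq_push (((hs.rel_push _ _ _).hc (rel_tid ρ)).congr
    (I.hor.dcomp_tid _ _) rfl rfl rfl)
  hc_actB_right σ _ _ := hs.eq_push (((rel_tid σ).hc (hs.rel_push _ _ _)).congr
    (I.hor.dcomp_tid _ _) rfl rfl rfl)
  -- The constraint cubes exist with the faces given by the constraints of the two bicategories;
  -- `Star.rel_iff` translates this into associativity and unit laws modulo those constraints.
  hc_assoc σ ρ π := hs.rel_iff.mp ⟨I.hAssoc σ ρ π, I.top_hAssoc _ _ _, I.left_hAssoc _ _ _,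
    I.right_hAssoc _ _ _, I.bot_hAssoc _ _ _⟩
  hi v := I.sqHid v
  hi_nat β := hs.rel_iff.mp (rel_hi β)
  hc_hi_left σ := hs.rel_iff.mp ⟨I.hLunit σ, I.top_hLunit _, I.left_hLunit _, I.right_hLunit _,
    I.bot_hLunit _⟩
  hc_hi_right σ := hs.rel_iff.mp ⟨I.hRunit σ, I.top_hRunit _, I.left_hRunit _, I.right_hRunit _,
    I.bot_hRunit _⟩
  vc σ ρ := I.sqV σ ρ
  vc_actT _ _ ρ := hs.eq_pull (((hs.rel_pull _ _ _).vc (rel_tid ρ)).congr rfl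
    (I.ver.dcomp_tid _ _) (I.ver.dcomp_tid _ _) rfl)
  vc_actB σ _ _ := hs.eq_push (((rel_tid σ).vc (hs.rel_push _ _ _)).congr rfl
    (I.ver.dcomp_tid _ _) (I.ver.dcomp_tid _ _) rfl)
  vc_mid σ α ρ := (hs.eq_of_rel (((hs.rel_push σ _ α).vc (hs.rel_pull α _ ρ)).congr rfl
    (I.ver.dcomp_tid _ _) (I.ver.dcomp_tid _ _) rfl)).symm
  vc_actL_top _ _ ρ := hs.eq_pull (((hs.rel_pull _ _ _).vc (rel_tid ρ)).congr rfl
    rfl (I.ver.dcomp_tid _ _) rfl)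
  vc_actL_bot σ _ _ := hs.eq_pull (((rel_tid σ).vc (hs.rel_pull _ _ _)).congr rfl
    rfl (I.ver.dcomp_tid _ _) rfl)
  vc_actR_top _ _ ρ := hs.eq_push (((hs.rel_push _ _ _).vc (rel_tid ρ)).congr rfl
    (I.ver.dcomp_tid _ _) rfl rfl)
  vc_actR_bot σ _ _ := hs.eq_push (((rel_tid σ).vc (hs.rel_push _ _ _)).congr rfl
    (I.ver.dcomp_tid _ _) rfl rfl)
  vc_assoc σ ρ π := hs.rel_iff.mp ⟨I.vAssoc σ ρ π, I.top_vAssoc _ _ _, I.left_vAssoc _ _ _,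
    I.right_vAssoc _ _ _, I.bot_vAssoc _ _ _⟩
  vi h := I.sqVid h
  vi_nat α := hs.rel_iff.mp (rel_vi α)
  vc_vi_top σ := hs.rel_iff.mp ⟨I.vLunit σ, I.top_vLunit _, I.left_vLunit _, I.right_vLunit _,
    I.bot_vLunit _⟩
  vc_vi_bot σ := hs.rel_iff.mp ⟨I.vRunit σ, I.top_vRunit _, I.left_vRunit _, I.right_vRunit _,
    I.bot_vRunit _⟩
  -- Only the equality of the two ends of each interchanger is used. The cubes δ and τ point the
  -- other way from the axioms, whence the symmetries below.
  interchange σ₁ ρ₁ σ₂ ρ₂ := (hs.interchangersIdentities.1 σ₁ ρ₁ σ₂ ρ₂).1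
  vc_hi v w := (hs.interchangersIdentities.2.1 v w).1
  hc_vi h k := (hs.interchangersIdentities.2.2.1 h k).1.symm
  hi_bid a := (hs.interchangersIdentities.2.2.2 a).1.symm

end Intercategory

/-! ### Comparison of a weak double category with that of its bicategory -/

section

variable {A X : Type u} [i : Category.{w} A]

/-- The functor with given function on objects, from a category with only identity arrows. -/
def fromTrivCat (o : X → A) : @CategoryTheory.Functor X (trivCat.{u, w} X) A i :=
  letI := trivCat.{u, w} X
  { obj := o
    map := fun f => eqToHom (congrArg o f.down.down)
    map_id := fun _ => rfl
    map_comp := fun _ _ => (eqToHom_trans _ _).symm }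

/-- The functor with given function on objects, from a category all of whose arrows are
identities to a category with only identity arrows. -/
def toTrivCat [IsDiscrete A] (o : A → X) : @CategoryTheory.Functor A i X (trivCat.{u, w} X) :=
  letI := trivCat.{u, w} X
  { obj := o
    map := fun f => ⟨⟨congrArg o (IsDiscrete.eq_of_hom f)⟩⟩
    map_id := fun _ => rfl
    map_comp := fun _ _ => rfl }

end

namespace WeakDouble

variable {A : Type u} [Category.{w} A] (W : WeakDouble.{u, v, w} A) [IsDiscrete A]

/-- The cell of `W` given by a 2-cell of the bicategory of `W`. -/
noncomputable def toCell {a b a' b' : A} {f : W.Arr a b} {f' : W.Arr a' b'}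
    (φ : GCell W.toBicategory f f') : W.Cell f f' := by
  obtain ⟨rfl, rfl, φ⟩ := φ
  exact φ

/-- A cell between parallel arrows as a cell with identity sides. -/
noncomputable def ofCellAux {a b a' b' : A} (ea : a = a') (eb : b = b') {f : W.Arr a b} {f' : W.Arr a' b'}
    (φ : W.Cell f f') : GCell W.toBicategory f f' := by
  subst ea eb
  exact GCell.of (B := W.toBicategory) (a := a) (b := b) (f := f) (g := f') φ

/-- The 2-cell of the bicategory of `W` given by a cell of `W`. -/
noncomputable def ofCell {a b a' b' : A} {f : W.Arr a b} {f' : W.Arr a' b'} (φ : W.Cell f f') :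
    GCell W.toBicategory f f' :=
  W.ofCellAux (IsDiscrete.eq_of_hom (W.src φ)) (IsDiscrete.eq_of_hom (W.tgt φ)) φ

theorem toCell_ofCell {a b a' b' : A} {f : W.Arr a b} {f' : W.Arr a' b'} (φ : W.Cell f f') :
    W.toCell (W.ofCell φ) = φ := by
  obtain rfl := IsDiscrete.eq_of_hom (W.src φ)
  obtain rfl := IsDiscrete.eq_of_hom (W.tgt φ)
  rfl

theorem ofCell_toCell {a b a' b' : A} {f : W.Arr a b} {f' : W.Arr a' b'}
    (φ : GCell W.toBicategory f f') : W.ofCell (W.toCell φ) = φ := by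
  obtain ⟨rfl, rfl, φ⟩ := φ
  rfl

/-- Composition of cells in the weak double category of a bicategory is one whiskering followed by
another, and `tcomp_dcomp` reassembles the two. -/
theorem toCell_compCell {a b c a' b' c' : A} {f : W.Arr a b} {g : W.Arr b c}
    {f' : W.Arr a' b'} {g' : W.Arr b' c'} (φ : GCell W.toBicategory f f')
    (ψ : GCell W.toBicategory g g') (e : W.tgt (W.toCell φ) = W.src (W.toCell ψ)) :
    W.toCell (GCell.compCell φ ψ) = W.compCell (W.toCell φ) (W.toCell ψ) e := by
  obtain ⟨rfl, rfl, φ⟩ := φ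
  obtain ⟨_, rfl, ψ⟩ := ψ
  exact W.tcomp_dcomp φ ψ

/-- The equality `e` and the arrow `t` may be chosen independently, since parallel strict arrows are
equal. -/
theorem toCell_idCell {a a' : A} (e : a = a') (t : a ⟶ a') :
    W.toCell (GCell.idCell e) = W.idCell t := by
  subst e
  exact (W.idCell_eq_tid t).symm

theorem toCell_tcomp {a b a' b' a'' b'' : A} {f : W.Arr a b} {f' : W.Arr a' b'}
    {f'' : W.Arr a'' b''} (φ : GCell W.toBicategory f f') (ψ : GCell W.toBicategory f' f'') :
    W.toCell (GCell.tcomp φ ψ) = W.tcomp (W.toCell φ) (W.toCell ψ) := by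
  obtain ⟨rfl, rfl, φ⟩ := φ
  obtain ⟨rfl, rfl, ψ⟩ := ψ
  rfl

/-- Since `toCell` and `ofCell` are mutually inverse, this and the next two laws are transported
from those for `toCell`, where case analysis on the equalities of endpoints is available. -/
theorem ofCell_tcomp {a b a' b' a'' b'' : A} {f : W.Arr a b} {f' : W.Arr a' b'}
    {f'' : W.Arr a'' b''} (φ : W.Cell f f') (ψ : W.Cell f' f'') :
    W.ofCell (W.tcomp φ ψ) = GCell.tcomp (W.ofCell φ) (W.ofCell ψ) := by
  rw [← W.toCell_ofCell φ, ← W.toCell_ofCell ψ, ← W.toCell_tcomp]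
  simp only [W.ofCell_toCell]

theorem ofCell_compCell {a b c a' b' c' : A} {f : W.Arr a b} {g : W.Arr b c}
    {f' : W.Arr a' b'} {g' : W.Arr b' c'} (φ : W.Cell f f') (ψ : W.Cell g g')
    (e : W.tgt φ = W.src ψ) :
    W.ofCell (W.compCell φ ψ e) = GCell.compCell (W.ofCell φ) (W.ofCell ψ) := by
  have H := W.toCell_compCell (W.ofCell φ) (W.ofCell ψ) (by simpa only [W.toCell_ofCell] using e)
  simp only [W.toCell_ofCell] at H
  exact (congrArg W.ofCell H.symm).trans (W.ofCell_toCell _)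

theorem ofCell_idCell {a a' : A} (e : a = a') (t : a ⟶ a') :
    W.ofCell (W.idCell t) = GCell.idCell e :=
  (congrArg W.ofCell (W.toCell_idCell e t).symm).trans (W.ofCell_toCell _)

theorem tgt_toCell_eq_src_toCell {a b c a' b' c' : A} {f : W.Arr a b} {g : W.Arr b c}
    {f' : W.Arr a' b'} {g' : W.Arr b' c'} (φ : GCell W.toBicategory f f')
    (ψ : GCell W.toBicategory g g') : W.tgt (W.toCell φ) = W.src (W.toCell ψ) :=
  Subsingleton.elim _ _

/-- The strict functor to `W` from the weak double category of its bicategory. -/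
noncomputable def fromBicategory :
    @WeakDouble.StrictFunctor A A (trivCat A) _ (.ofBicategory W.toBicategory) W
      (fromTrivCat fun a => a) :=
  @WeakDouble.StrictFunctor.mk A A (trivCat A) _ (.ofBicategory W.toBicategory) W
    (fromTrivCat fun a => a) (fun f => f) W.toCell (fun _ => Subsingleton.elim _ _)
    (fun _ => Subsingleton.elim _ _) (fun _ => rfl) W.toCell_tcomp (fun _ => rfl)
    (fun t => heq_of_eq (W.toCell_idCell t.down.down _)) (fun _ _ => rfl)
    (fun φ ψ _ => heq_of_eq (W.toCell_compCell φ ψ _)) (fun _ _ _ => HEq.rfl) (fun _ => HEq.rfl)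
    (fun _ => HEq.rfl)

/-- The strict functor from `W` to the weak double category of its bicategory. -/
noncomputable def intoBicategory :
    @WeakDouble.StrictFunctor A A _ (trivCat A) W (.ofBicategory W.toBicategory)
      (toTrivCat fun a => a) :=
  @WeakDouble.StrictFunctor.mk A A _ (trivCat A) W (.ofBicategory W.toBicategory)
    (toTrivCat fun a => a) (fun f => f) W.ofCell (fun _ => rfl) (fun _ => rfl) (fun _ => rfl)
    W.ofCell_tcomp (fun _ => rfl)
    (fun t => heq_of_eq (W.ofCell_idCell (IsDiscrete.eq_of_hom t) t)) (fun _ _ => rfl)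
    (fun φ ψ e => heq_of_eq (W.ofCell_compCell φ ψ e)) (fun _ _ _ => HEq.rfl) (fun _ => HEq.rfl)
    (fun _ => HEq.rfl)

end WeakDouble

/-! ### Cubes of an intercategory and cubes of its double bicategory -/

namespace Intercategory

variable {I : Intercategory.{u, v, w}} [IsDiscrete I.Obj]

theorem eq_of_cell (W : WeakDouble.{u, v, w} I.Obj) {A B A' B'} {f : W.Arr A B} {f' : W.Arr A' B'}
    (φ : W.Cell f f') : A = A' ∧ B = B' :=
  ⟨IsDiscrete.eq_of_hom (W.src φ), IsDiscrete.eq_of_hom (W.tgt φ)⟩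

/-- A cube has transversal arrows joining the corners of its two ends. These are identities, so the
corners coincide and `Star.cube_ext` applies. -/
theorem Star.cube_ext' (hs : I.Star) {A B C D A' B' C' D' h v w k h' v' w' k'}
    {σ : @I.Sq A B C D h v w k} {σ' : @I.Sq A' B' C' D' h' v' w' k'} {c d : I.Cube σ σ'}
    (ht : I.top c = I.top d) (hl : I.left c = I.left d) (hr : I.right c = I.right d)
    (hb : I.bot c = I.bot d) : c = d := by
  obtain ⟨rfl, rfl⟩ := eq_of_cell _ (I.top c)
  obtain ⟨rfl, rfl⟩ := eq_of_cell _ (I.bot c)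
  exact hs.cube_ext ht hl hr hb

variable (hs : I.Star)

/-- The point where the two notions of cube meet. The condition in the double bicategory compares
successive actions on two sides; these combine into a joint push and a joint pull, whose equality is
`Star.rel_iff`. -/
theorem Star.rel_toDoubleBicategory {A B C D : I.Obj} {h h' : I.hor.Arr A B}
    {v v' : I.ver.Arr A C} {w w' : I.ver.Arr B D} {k k' : I.hor.Arr C D} {σ : I.Sq h v w k}
    {σ' : I.Sq h' v' w' k'} {α : I.hor.Cell h h'} {β : I.ver.Cell v v'} {β' : I.ver.Cell w w'}
    {γ : I.hor.Cell k k'} :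
    hs.toDoubleBicategory.Rel (h := h) (h' := h') (v := v) (v' := v') (w := w) (w' := w') (k := k)
      (k' := k') σ σ' α β β' γ ↔ Rel σ σ' α β β' γ := by
  rw [hs.rel_iff, ← hs.push_right_bot, ← hs.pull_top_left]
  exact Iff.rfl

/-- Such a cube is unique by `Star.cube_ext'`, so the choice made from this existence statement does
not affect functoriality. -/
theorem Star.exists_cube {A B C D A' B' C' D' h v w k h' v' w' k'}
    {σ : @I.Sq A B C D h v w k} {σ' : @I.Sq A' B' C' D' h' v' w' k'}
    (x : DoubleBicategory.DCube (D := hs.toDoubleBicategory) σ σ') :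
    Rel σ σ' (I.hor.toCell x.top) (I.ver.toCell x.left) (I.ver.toCell x.right)
      (I.hor.toCell x.bot) := by
  obtain ⟨⟨rfl, rfl, _⟩, ⟨_, rfl, _⟩, ⟨_, rfl, _⟩, ⟨_, _, _⟩, H⟩ := x
  exact hs.rel_toDoubleBicategory.mp H

/-- The cube given by a cube of the intercategory of the double bicategory. -/
noncomputable def Star.toCube {A B C D A' B' C' D' h v w k h' v' w' k'}
    {σ : @I.Sq A B C D h v w k} {σ' : @I.Sq A' B' C' D' h' v' w' k'}
    (x : DoubleBicategory.DCube (D := hs.toDoubleBicategory) σ σ') : I.Cube σ σ' :=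
  (hs.exists_cube x).choose

/-- The cube of the intercategory of the double bicategory given by a cube. -/
noncomputable def Star.ofCube {A B C D A' B' C' D' h v w k h' v' w' k'}
    {σ : @I.Sq A B C D h v w k} {σ' : @I.Sq A' B' C' D' h' v' w' k'}
    (c : I.Cube σ σ') : DoubleBicategory.DCube (D := hs.toDoubleBicategory) σ σ' where
  top := I.hor.ofCell (I.top c)
  left := I.ver.ofCell (I.left c)
  right := I.ver.ofCell (I.right c)
  bot := I.hor.ofCell (I.bot c)
  cond := by
    obtain ⟨rfl, rfl⟩ := eq_of_cell _ (I.top c)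
    obtain ⟨rfl, rfl⟩ := eq_of_cell _ (I.bot c)
    exact hs.rel_toDoubleBicategory.mpr ⟨c, rfl, rfl, rfl, rfl⟩

section

variable {A B C D A' B' C' D' : I.Obj} {h : I.hor.Arr A B} {v : I.ver.Arr A C} {w : I.ver.Arr B D}
  {k : I.hor.Arr C D} {h' : I.hor.Arr A' B'} {v' : I.ver.Arr A' C'} {w' : I.ver.Arr B' D'}
  {k' : I.hor.Arr C' D'} {σ : I.Sq h v w k} {σ' : I.Sq h' v' w' k'}
  (x : DoubleBicategory.DCube (D := hs.toDoubleBicategory) σ σ')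

theorem Star.top_toCube : I.top (hs.toCube x) = I.hor.toCell x.top :=
  (hs.exists_cube x).choose_spec.1

theorem Star.left_toCube : I.left (hs.toCube x) = I.ver.toCell x.left :=
  (hs.exists_cube x).choose_spec.2.1

theorem Star.right_toCube : I.right (hs.toCube x) = I.ver.toCell x.right :=
  (hs.exists_cube x).choose_spec.2.2.1

theorem Star.bot_toCube : I.bot (hs.toCube x) = I.hor.toCell x.bot :=
  (hs.exists_cube x).choose_spec.2.2.2

theorem Star.ofCube_toCube : hs.ofCube (hs.toCube x) = x :=
  DoubleBicategory.DCube.ext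
    ((congrArg I.hor.ofCell (hs.top_toCube x)).trans (I.hor.ofCell_toCell _))
    ((congrArg I.ver.ofCell (hs.left_toCube x)).trans (I.ver.ofCell_toCell _))
    ((congrArg I.ver.ofCell (hs.right_toCube x)).trans (I.ver.ofCell_toCell _))
    ((congrArg I.hor.ofCell (hs.bot_toCube x)).trans (I.hor.ofCell_toCell _))

theorem Star.toCube_ofCube (c : I.Cube σ σ') : hs.toCube (hs.ofCube c) = c :=
  hs.cube_ext' ((hs.top_toCube _).trans (I.hor.toCell_ofCell _))
    ((hs.left_toCube _).trans (I.ver.toCell_ofCell _))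
    ((hs.right_toCube _).trans (I.ver.toCell_ofCell _))
    ((hs.bot_toCube _).trans (I.hor.toCell_ofCell _))

/-- Since cubes are determined by their faces, each preservation law for `Star.toCube` reduces to
four laws for cells. -/
theorem Star.toCube_eq {c : I.Cube σ σ'} (ht : I.hor.toCell x.top = I.top c)
    (hl : I.ver.toCell x.left = I.left c) (hr : I.ver.toCell x.right = I.right c)
    (hb : I.hor.toCell x.bot = I.bot c) : hs.toCube x = c :=
  hs.cube_ext' ((hs.top_toCube x).trans ht) ((hs.left_toCube x).trans hl)
    ((hs.right_toCube x).trans hr) ((hs.bot_toCube x).trans hb)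

end

end Intercategory

/-! ### The isomorphism with the intercategory of the double bicategory -/

namespace Intercategory

variable {I : Intercategory.{u, v, w}} [IsDiscrete I.Obj] (hs : I.Star)

/-- The strict functor to an intercategory from the intercategory of its double bicategory. -/
noncomputable def Star.fromDoubleBicategory :
    StrictFunctor hs.toDoubleBicategory.toIntercategory I where
  obj := fromTrivCat fun a => a
  hor := I.hor.fromBicategory
  ver := I.ver.fromBicategory
  sq := fun σ => σ
  cube := fun x => hs.toCube x
  top_cube := fun x => hs.top_toCube x
  left_cube := fun x => hs.left_toCube x
  right_cube := fun x => hs.right_toCube x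
  bot_cube := fun x => hs.bot_toCube x
  cube_tid := fun _ => hs.toCube_eq _ (I.top_tid _).symm (I.left_tid _).symm (I.right_tid _).symm (I.bot_tid _).symm
  cube_tcomp := fun x y => hs.toCube_eq _
      ((I.hor.toCell_tcomp _ _).trans ((I.top_tcomp _ _).trans
        (congrArg₂ I.hor.tcomp (hs.top_toCube x) (hs.top_toCube y))).symm)
      ((I.ver.toCell_tcomp _ _).trans ((I.left_tcomp _ _).trans
        (congrArg₂ I.ver.tcomp (hs.left_toCube x) (hs.left_toCube y))).symm)
      ((I.ver.toCell_tcomp _ _).trans ((I.right_tcomp _ _).trans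
        (congrArg₂ I.ver.tcomp (hs.right_toCube x) (hs.right_toCube y))).symm)
      ((I.hor.toCell_tcomp _ _).trans ((I.bot_tcomp _ _).trans
        (congrArg₂ I.hor.tcomp (hs.bot_toCube x) (hs.bot_toCube y))).symm)
  sq_sqH := fun _ _ => HEq.rfl
  sq_sqV := fun _ _ => HEq.rfl
  sq_sqHid := fun _ => HEq.rfl
  sq_sqVid := fun _ => HEq.rfl
  cube_cubeH := fun x y _ => heq_of_eq (hs.toCube_eq _
      ((I.hor.toCell_compCell _ _ (I.hor.tgt_toCell_eq_src_toCell _ _)).trans ((I.top_cubeH _ _ _).trans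
        (I.hor.compCell_congr (hs.top_toCube _) (hs.top_toCube _) _ _)).symm)
      (((I.left_cubeH _ _ _).trans (hs.left_toCube x)).symm)
      (((I.right_cubeH _ _ _).trans (hs.right_toCube y)).symm)
      ((I.hor.toCell_compCell _ _ (I.hor.tgt_toCell_eq_src_toCell _ _)).trans ((I.bot_cubeH _ _ _).trans
        (I.hor.compCell_congr (hs.bot_toCube _) (hs.bot_toCube _) _ _)).symm))
  cube_cubeV := fun x y _ => heq_of_eq (hs.toCube_eq _
      (((I.top_cubeV _ _ _).trans (hs.top_toCube x)).symm)
      ((I.ver.toCell_compCell _ _ (I.ver.tgt_toCell_eq_src_toCell _ _)).trans ((I.left_cubeV _ _ _).trans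
        (I.ver.compCell_congr (hs.left_toCube _) (hs.left_toCube _) _ _)).symm)
      ((I.ver.toCell_compCell _ _ (I.ver.tgt_toCell_eq_src_toCell _ _)).trans ((I.right_cubeV _ _ _).trans
        (I.ver.compCell_congr (hs.right_toCube _) (hs.right_toCube _) _ _)).symm)
      (((I.bot_cubeV _ _ _).trans (hs.bot_toCube y)).symm))
  cube_cubeHid := fun _ => heq_of_eq (hs.toCube_eq _
      ((I.hor.toCell_idCell _ _).trans (I.top_cubeHid _).symm)
      ((I.left_cubeHid _).symm)
      ((I.right_cubeHid _).symm)
      ((I.hor.toCell_idCell _ _).trans (I.bot_cubeHid _).symm))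
  cube_cubeVid := fun _ => heq_of_eq (hs.toCube_eq _
      ((I.top_cubeVid _).symm)
      ((I.ver.toCell_idCell _ _).trans (I.left_cubeVid _).symm)
      ((I.ver.toCell_idCell _ _).trans (I.right_cubeVid _).symm)
      ((I.bot_cubeVid _).symm))
  -- The constraints of the two bicategories were taken from those of `I`, so the constraint cubes
  -- on both sides have the same faces.
  cube_hAssoc := fun _ _ _ => heq_of_eq (hs.toCube_eq _
      ((I.top_hAssoc _ _ _).symm)
      ((I.left_hAssoc _ _ _).symm)
      ((I.right_hAssoc _ _ _).symm)
      ((I.bot_hAssoc _ _ _).symm))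
  cube_hLunit := fun _ => heq_of_eq (hs.toCube_eq _
      ((I.top_hLunit _).symm)
      ((I.left_hLunit _).symm)
      ((I.right_hLunit _).symm)
      ((I.bot_hLunit _).symm))
  cube_hRunit := fun _ => heq_of_eq (hs.toCube_eq _
      ((I.top_hRunit _).symm)
      ((I.left_hRunit _).symm)
      ((I.right_hRunit _).symm)
      ((I.bot_hRunit _).symm))
  cube_vAssoc := fun _ _ _ => heq_of_eq (hs.toCube_eq _
      ((I.top_vAssoc _ _ _).symm)
      ((I.left_vAssoc _ _ _).symm)
      ((I.right_vAssoc _ _ _).symm)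
      ((I.bot_vAssoc _ _ _).symm))
  cube_vLunit := fun _ => heq_of_eq (hs.toCube_eq _
      ((I.top_vLunit _).symm)
      ((I.left_vLunit _).symm)
      ((I.right_vLunit _).symm)
      ((I.bot_vLunit _).symm))
  cube_vRunit := fun _ => heq_of_eq (hs.toCube_eq _
      ((I.top_vRunit _).symm)
      ((I.left_vRunit _).symm)
      ((I.right_vRunit _).symm)
      ((I.bot_vRunit _).symm))
  -- The interchangers on both sides are special, so all faces to be compared are identities.
  cube_chi := fun _ _ _ _ => heq_of_eq (hs.toCube_eq _
      ((I.top_chi _ _ _ _).symm)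
      ((I.left_chi _ _ _ _).symm)
      ((I.right_chi _ _ _ _).symm)
      ((I.bot_chi _ _ _ _).symm))
  cube_mu := fun _ _ => heq_of_eq (hs.toCube_eq _
      ((I.top_mu _ _).symm)
      ((I.left_mu _ _).symm)
      ((I.right_mu _ _).symm)
      ((I.bot_mu _ _).symm))
  cube_delta := fun _ _ => heq_of_eq (hs.toCube_eq _
      ((I.top_delta _ _).symm)
      ((I.left_delta _ _).symm)
      ((I.right_delta _ _).symm)
      ((I.bot_delta _ _).symm))
  cube_tau := fun _ => heq_of_eq (hs.toCube_eq _
      ((I.top_tau _).symm)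
      ((I.left_tau _).symm)
      ((I.right_tau _).symm)
      ((I.bot_tau _).symm))

/-- The strict functor from an intercategory to the intercategory of its double bicategory. -/
noncomputable def Star.intoDoubleBicategory :
    StrictFunctor I hs.toDoubleBicategory.toIntercategory where
  obj := toTrivCat fun a => a
  hor := I.hor.intoBicategory
  ver := I.ver.intoBicategory
  sq := fun σ => σ
  cube := fun c => hs.ofCube c
  top_cube := fun _ => rfl
  left_cube := fun _ => rfl
  right_cube := fun _ => rfl
  bot_cube := fun _ => rfl
  -- Cubes of the target are determined by their faces by construction, so every law below is the
  -- corresponding law for faces in `I`, transported along `ofCell`.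
  cube_tid := fun _ => DoubleBicategory.DCube.ext
      (congrArg I.hor.ofCell (I.top_tid _))
      (congrArg I.ver.ofCell (I.left_tid _))
      (congrArg I.ver.ofCell (I.right_tid _))
      (congrArg I.hor.ofCell (I.bot_tid _))
  cube_tcomp := fun _ _ => DoubleBicategory.DCube.ext
      ((congrArg I.hor.ofCell (I.top_tcomp _ _)).trans (I.hor.ofCell_tcomp _ _))
      ((congrArg I.ver.ofCell (I.left_tcomp _ _)).trans (I.ver.ofCell_tcomp _ _))
      ((congrArg I.ver.ofCell (I.right_tcomp _ _)).trans (I.ver.ofCell_tcomp _ _))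
      ((congrArg I.hor.ofCell (I.bot_tcomp _ _)).trans (I.hor.ofCell_tcomp _ _))
  sq_sqH := fun _ _ => HEq.rfl
  sq_sqV := fun _ _ => HEq.rfl
  sq_sqHid := fun _ => HEq.rfl
  sq_sqVid := fun _ => HEq.rfl
  cube_cubeH := fun _ _ _ => heq_of_eq (DoubleBicategory.DCube.ext
      ((congrArg I.hor.ofCell (I.top_cubeH _ _ _)).trans (I.hor.ofCell_compCell _ _ _))
      (congrArg I.ver.ofCell (I.left_cubeH _ _ _))
      (congrArg I.ver.ofCell (I.right_cubeH _ _ _))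
      ((congrArg I.hor.ofCell (I.bot_cubeH _ _ _)).trans (I.hor.ofCell_compCell _ _ _)))
  cube_cubeV := fun _ _ _ => heq_of_eq (DoubleBicategory.DCube.ext
      (congrArg I.hor.ofCell (I.top_cubeV _ _ _))
      ((congrArg I.ver.ofCell (I.left_cubeV _ _ _)).trans (I.ver.ofCell_compCell _ _ _))
      ((congrArg I.ver.ofCell (I.right_cubeV _ _ _)).trans (I.ver.ofCell_compCell _ _ _))
      (congrArg I.hor.ofCell (I.bot_cubeV _ _ _)))
  cube_cubeHid := fun _ => heq_of_eq (DoubleBicategory.DCube.ext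
      ((congrArg I.hor.ofCell (I.top_cubeHid _)).trans (I.hor.ofCell_idCell _ _))
      (congrArg I.ver.ofCell (I.left_cubeHid _))
      (congrArg I.ver.ofCell (I.right_cubeHid _))
      ((congrArg I.hor.ofCell (I.bot_cubeHid _)).trans (I.hor.ofCell_idCell _ _)))
  cube_cubeVid := fun _ => heq_of_eq (DoubleBicategory.DCube.ext
      (congrArg I.hor.ofCell (I.top_cubeVid _))
      ((congrArg I.ver.ofCell (I.left_cubeVid _)).trans (I.ver.ofCell_idCell _ _))
      ((congrArg I.ver.ofCell (I.right_cubeVid _)).trans (I.ver.ofCell_idCell _ _))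
      (congrArg I.hor.ofCell (I.bot_cubeVid _)))
  cube_hAssoc := fun _ _ _ => heq_of_eq (DoubleBicategory.DCube.ext
      (congrArg I.hor.ofCell (I.top_hAssoc _ _ _))
      (congrArg I.ver.ofCell (I.left_hAssoc _ _ _))
      (congrArg I.ver.ofCell (I.right_hAssoc _ _ _))
      (congrArg I.hor.ofCell (I.bot_hAssoc _ _ _)))
  cube_hLunit := fun _ => heq_of_eq (DoubleBicategory.DCube.ext
      (congrArg I.hor.ofCell (I.top_hLunit _))
      (congrArg I.ver.ofCell (I.left_hLunit _))
      (congrArg I.ver.ofCell (I.right_hLunit _))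
      (congrArg I.hor.ofCell (I.bot_hLunit _)))
  cube_hRunit := fun _ => heq_of_eq (DoubleBicategory.DCube.ext
      (congrArg I.hor.ofCell (I.top_hRunit _))
      (congrArg I.ver.ofCell (I.left_hRunit _))
      (congrArg I.ver.ofCell (I.right_hRunit _))
      (congrArg I.hor.ofCell (I.bot_hRunit _)))
  cube_vAssoc := fun _ _ _ => heq_of_eq (DoubleBicategory.DCube.ext
      (congrArg I.hor.ofCell (I.top_vAssoc _ _ _))
      (congrArg I.ver.ofCell (I.left_vAssoc _ _ _))
      (congrArg I.ver.ofCell (I.right_vAssoc _ _ _))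
      (congrArg I.hor.ofCell (I.bot_vAssoc _ _ _)))
  cube_vLunit := fun _ => heq_of_eq (DoubleBicategory.DCube.ext
      (congrArg I.hor.ofCell (I.top_vLunit _))
      (congrArg I.ver.ofCell (I.left_vLunit _))
      (congrArg I.ver.ofCell (I.right_vLunit _))
      (congrArg I.hor.ofCell (I.bot_vLunit _)))
  cube_vRunit := fun _ => heq_of_eq (DoubleBicategory.DCube.ext
      (congrArg I.hor.ofCell (I.top_vRunit _))
      (congrArg I.ver.ofCell (I.left_vRunit _))
      (congrArg I.ver.ofCell (I.right_vRunit _))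
      (congrArg I.hor.ofCell (I.bot_vRunit _)))
  cube_chi := fun _ _ _ _ => heq_of_eq (DoubleBicategory.DCube.ext
      (congrArg I.hor.ofCell (I.top_chi _ _ _ _))
      (congrArg I.ver.ofCell (I.left_chi _ _ _ _))
      (congrArg I.ver.ofCell (I.right_chi _ _ _ _))
      (congrArg I.hor.ofCell (I.bot_chi _ _ _ _)))
  cube_mu := fun _ _ => heq_of_eq (DoubleBicategory.DCube.ext
      (congrArg I.hor.ofCell (I.top_mu _ _))
      (congrArg I.ver.ofCell (I.left_mu _ _))
      (congrArg I.ver.ofCell (I.right_mu _ _))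
      (congrArg I.hor.ofCell (I.bot_mu _ _)))
  cube_delta := fun _ _ => heq_of_eq (DoubleBicategory.DCube.ext
      (congrArg I.hor.ofCell (I.top_delta _ _))
      (congrArg I.ver.ofCell (I.left_delta _ _))
      (congrArg I.ver.ofCell (I.right_delta _ _))
      (congrArg I.hor.ofCell (I.bot_delta _ _)))
  cube_tau := fun _ => heq_of_eq (DoubleBicategory.DCube.ext
      (congrArg I.hor.ofCell (I.top_tau _))
      (congrArg I.ver.ofCell (I.left_tau _))
      (congrArg I.ver.ofCell (I.right_tau _))
      (congrArg I.hor.ofCell (I.bot_tau _)))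

/-- The transversal category of `I` is discrete but need not be literally `trivCat`, so the two
functors agree on arrows only because parallel arrows are equal. -/
theorem toTrivCat_comp_fromTrivCat {A : Type u} [i : Category.{w} A] [IsDiscrete A] :
    @CategoryTheory.Functor.comp A i A (trivCat.{u, w} A) A i (toTrivCat fun a => a) (fromTrivCat fun a => a) =
      𝟭 A :=
  CategoryTheory.Functor.ext (fun _ => rfl) (fun _ _ _ => Subsingleton.elim _ _)

/-- The types of the horizontal and vertical parts depend on the functor on objects, and in the
application that functor is only propositionally equal to the identity. The underlying maps are
therefore compared one by one, heterogeneously; all other fields are propositions. -/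
theorem StrictFunctor.ext_of_obj {I J : Intercategory.{u, v, w}} {P Q : I.StrictFunctor J}
    (obj : P.obj = Q.obj) (harr : HEq (@P.hor.arr) (@Q.hor.arr))
    (hcell : HEq (@P.hor.cell) (@Q.hor.cell)) (varr : HEq (@P.ver.arr) (@Q.ver.arr))
    (vcell : HEq (@P.ver.cell) (@Q.ver.cell)) (sq : HEq (@P.sq) (@Q.sq))
    (cube : HEq (@P.cube) (@Q.cube)) : P = Q := by
  obtain ⟨_, ⟨_, _, _, _, _, _, _, _, _, _, _, _, _⟩, ⟨_, _, _, _, _, _, _, _, _, _, _, _, _⟩,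
    _, _, _, _, _, _, _, _, _, _, _, _, _, _, _, _, _, _, _, _, _, _, _, _, _, _⟩ := P
  obtain ⟨_, ⟨_, _, _, _, _, _, _, _, _, _, _, _, _⟩, ⟨_, _, _, _, _, _, _, _, _, _, _, _, _⟩,
    _, _, _, _, _, _, _, _, _, _, _, _, _, _, _, _, _, _, _, _, _, _, _, _, _, _⟩ := Q
  dsimp only at obj
  subst obj
  cases harr; cases hcell; cases varr; cases vcell; cases sq; cases cube
  rfl

theorem Star.into_comp_from : hs.intoDoubleBicategory.comp hs.fromDoubleBicategory = .id I := by
  refine StrictFunctor.ext_of_obj toTrivCat_comp_fromTrivCat HEq.rfl (heq_of_eq ?_) HEq.rfl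
    (heq_of_eq ?_) HEq.rfl (heq_of_eq ?_)
  · funext _ _ _ _ _ _ φ
    exact I.hor.toCell_ofCell φ
  · funext _ _ _ _ _ _ φ
    exact I.ver.toCell_ofCell φ
  · funext _ _ _ _ _ _ _ _ _ _ _ _ _ _ _ _ _ _ c
    exact hs.toCube_ofCube c

theorem Star.from_comp_into : hs.fromDoubleBicategory.comp hs.intoDoubleBicategory =
    .id hs.toDoubleBicategory.toIntercategory := by
  -- In this direction the functors on objects agree definitionally, because the arrows of `trivCat`
  -- are lifted proofs of equality.
  refine StrictFunctor.ext_of_obj rfl HEq.rfl (heq_of_eq ?_) HEq.rfl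
    (heq_of_eq ?_) HEq.rfl (heq_of_eq ?_)
  · funext _ _ _ _ _ _ φ
    exact I.hor.ofCell_toCell φ
  · funext _ _ _ _ _ _ φ
    exact I.ver.ofCell_toCell φ
  · funext _ _ _ _ _ _ _ _ _ _ _ _ _ _ _ _ _ _ x
    exact hs.ofCube_toCube x

/-- An intercategory satisfying `(*)` whose transversal arrows are identities is isomorphic to the
intercategory of its double bicategory. -/
noncomputable def Star.iso : hs.toDoubleBicategory.toIntercategory ≅ I where
  hom := hs.fromDoubleBicategory
  inv := hs.intoDoubleBicategory
  hom_inv_id := hs.from_comp_into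
  inv_hom_id := hs.into_comp_from

end Intercategory

/-! ### Essential surjectivity and the theorem -/

instance DoubleBicategory.correspondence_essSurj : correspondence.{u, v, w}.EssSurj where
  mem_essImage I := by
    have : IsDiscrete I.obj.Obj := I.property.1
    have hs : I.obj.Star := I.property.2
    exact ⟨hs.toDoubleBicategory, ⟨starProperty.isoMk hs.iso⟩⟩

end Intercat

theorem mainTheorem3 :
    (Intercat.DoubleBicategory.correspondence.{u, v, w}).IsEquivalence ∧
      ∀ I : Intercat.Intercategory.{u, v, w}, I.Star → I.InterchangersIdentities :=
  -- The empty structure is filled by the instances for faithfulness, fullness and essential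
  -- surjectivity. The second part uses only uniqueness of lifts and makes no separate assumption on
  -- transversal arrows.
  ⟨{}, fun _ hs => hs.interchangersIdentities⟩
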